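/- Let $(M,\omega)$ be a closed (compact, without boundary) smooth symplectic four-manifold and let $L \subset M$ be a Lagrangian sphere, i.e. the image of a smooth embedding $S^2 \to M$ under which $\omega$ pulls back to zero. Write $T^*S^2 = \{(u,v)\in\mathbb{R}^3\times\mathbb{R}^3 : \langle u,v\rangle = 0,\ \|v\| = 1\}$ with the symplectic form $du\wedge dv$, and $T^*_{\le\lambda}S^2$ for the subset where $\|u\|\le\lambda$. For $u \neq 0$ let $$\sigma_t(u,v) = \Big(\cos(t)\,u - \sin(t)\,\|u\|\,v,\ \cos(t)\,v + \sin(t)\,\tfrac{u}{\|u\|}\Big).$$ A Dehn twist along $L$ is any map $\tau_L : M \to M$ obtained as follows. Choose $\lambda>0$; a symplectic embedding $i : T^*_{\le\lambda}S^2 \to M$ which maps the zero-section onto $L$; and a smooth function $r:\mathbb{R}\to\mathbb{R}$ with $r(t) = 0$ for $t \ge \lambda/2$ and $r(-t) = r(t)-t$ for all $t$. Let $\tau(u,v) = \sigma_{2\pi r'(\|u\|)}(u,v)$ for $u\neq 0$ and $\tau(0,v) = (0,-v)$, and put $\tau_L = i\circ\tau\circ i^{-1}$ on the image of $i$ and $\tau_L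 = \mathrm{id}$ elsewhere. Then Dehn twists along $L$ exist, and for every Dehn twist $\tau_L$ along $L$ the square $\tau_L^2$ is potentially fragile. That is, there are $\varepsilon>0$, a smooth family $(\omega^s)_{s\in[0,\varepsilon)}$ of symplectic forms on $M$ and a smooth family $(\phi^s)_{s\in[0,\varepsilon)}$ of diffeomorphisms of $M$ with $(\phi^s)^*\omega^s = \omega^s$ for all $s$, such that $(\phi^0,\omega^0) = (\tau_L^2,\omega)$, and such that for every $s\in(0,\varepsilon)$ there is a smooth isotopy from the identity to $\phi^s$ through diffeomorphisms which preserve $\omega^s$. -/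

import Mathlib

open scoped Manifold ContDiff

noncomputable section

namespace FourDim

/-! ### Differential two-forms and symplectic forms on a four-manifold -/

section Forms

variable (M : Type*) [TopologicalSpace M] [ChartedSpace (EuclideanSpace ℝ (Fin 4)) M]

/-- A (not necessarily continuous) differential two-form on the four-manifold `M`. -/
abbrev TwoForm : Type _ :=
  ∀ x : M, (TangentSpace (𝓡 4) x) [⋀^Fin 2]→L[ℝ] ℝ

/-- A smooth diffeomorphism of `M`. -/
abbrev Diffeo : Type _ := M ≃ₘ^∞⟮𝓡 4, 𝓡 4⟯ M

variable {M}

/-- The coordinate expression of a two-form `η` in the preferred chart around `c`, that is, the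
pullback of `η` under the inverse of that chart. Only its values on the target of the chart are
meaningful. -/
def TwoForm.inChart (η : TwoForm M) (c : M) (y : EuclideanSpace ℝ (Fin 4)) :
    (EuclideanSpace ℝ (Fin 4)) [⋀^Fin 2]→L[ℝ] ℝ :=
  (η ((extChartAt (𝓡 4) c).symm y)).compContinuousLinearMap
    (mfderiv 𝓘(ℝ, EuclideanSpace ℝ (Fin 4)) (𝓡 4) (extChartAt (𝓡 4) c).symm y)

/-- A symplectic form: a smooth, closed, pointwise nondegenerate two-form. -/
structure IsSymplecticForm (η : TwoForm M) : Prop where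
  smooth : ∀ c : M, ContDiffOn ℝ ∞ (TwoForm.inChart η c) (extChartAt (𝓡 4) c).target
  closed : ∀ c : M, ∀ y ∈ (extChartAt (𝓡 4) c).target, extDeriv (TwoForm.inChart η c) y = 0
  nondegenerate : ∀ (x : M) (v : TangentSpace (𝓡 4) x),
    (∀ w : TangentSpace (𝓡 4) x, η x ![v, w] = 0) → v = 0

/-- `φ` is a symplectic automorphism of `(M, η)`: the pullback of `η` under `φ` is `η`. -/
def IsSymplecticAut (η : TwoForm M) (φ : Diffeo M) : Prop :=
  ∀ (x : M) (v w : TangentSpace (𝓡 4) x),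
    η (φ x) ![mfderiv (𝓡 4) (𝓡 4) φ x v, mfderiv (𝓡 4) (𝓡 4) φ x w] = η x ![v, w]

/-- The two-forms `Ω s` depend smoothly on the point of `M` and on the parameter `s ∈ S`
(jointly, up to those end points of the interval `S` which belong to `S`). -/
def SmoothFormFamily (S : Set ℝ) (Ω : ℝ → TwoForm M) : Prop :=
  ∀ c : M, ContDiffOn ℝ ∞
    (fun p : ℝ × EuclideanSpace ℝ (Fin 4) => TwoForm.inChart (Ω p.1) c p.2)
    (S ×ˢ (extChartAt (𝓡 4) c).target)

/-- The diffeomorphisms `Φ s` depend smoothly on the point of `M` and on the parameter `s ∈ S`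
(jointly). -/
def SmoothDiffeoFamily (S : Set ℝ) (Φ : ℝ → Diffeo M) : Prop :=
  ContMDiffOn (𝓘(ℝ, ℝ).prod (𝓡 4)) (𝓡 4) ∞ (fun p : ℝ × M => Φ p.1 p.2) (S ×ˢ Set.univ)

/-- `φ` is isotopic to the identity inside the group of symplectic automorphisms of `(M, η)`. -/
def SymplecticallyIsotopicToId (η : TwoForm M) (φ : Diffeo M) : Prop :=
  ∃ Ψ : ℝ → Diffeo M,
    SmoothDiffeoFamily (Set.Icc 0 1) Ψ ∧
    (∀ t ∈ Set.Icc (0 : ℝ) 1, IsSymplecticAut η (Ψ t)) ∧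
    (∀ x, Ψ 0 x = x) ∧ (∀ x, Ψ 1 x = φ x)

/-- Potential fragility of a self-map `φ` of `(M, η)`. The conditions at `s = 0` include that `φ`
is a symplectic automorphism of `(M, η)`. -/
def PotentiallyFragile (η : TwoForm M) (φ : M → M) : Prop :=
  ∃ ε : ℝ, 0 < ε ∧ ∃ (Ω : ℝ → TwoForm M) (Φ : ℝ → Diffeo M),
    SmoothFormFamily (Set.Ico 0 ε) Ω ∧
    (∀ s ∈ Set.Ico 0 ε, IsSymplecticForm (Ω s)) ∧
    SmoothDiffeoFamily (Set.Ico 0 ε) Φ ∧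
    (∀ s ∈ Set.Ico 0 ε, IsSymplecticAut (Ω s) (Φ s)) ∧
    (∀ x, Ω 0 x = η x) ∧ (∀ x, Φ 0 x = φ x) ∧
    (∀ s ∈ Set.Ioo 0 ε, SymplecticallyIsotopicToId (Ω s) (Φ s))

/-- `L` is a Lagrangian sphere in `(M, η)`: the image of a smooth embedding of the unit sphere of
`ℝ³` under which `η` pulls back to zero. -/
def IsLagrangianSphere (η : TwoForm M) (L : Set M) : Prop :=
  ∃ f : Metric.sphere (0 : EuclideanSpace ℝ (Fin 3)) 1 → M,
    Manifold.IsSmoothEmbedding (𝓡 2) (𝓡 4) ∞ f ∧ Set.range f = L ∧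
    ∀ (q : Metric.sphere (0 : EuclideanSpace ℝ (Fin 3)) 1) (a b : TangentSpace (𝓡 2) q),
      η (f q) ![mfderiv (𝓡 2) (𝓡 4) f q a, mfderiv (𝓡 2) (𝓡 4) f q b] = 0

end Forms

/-! ### The cotangent bundle of the two-sphere and the model Dehn twist -/

/-- The ambient space `ℝ³ × ℝ³` of the cotangent bundle of the sphere. -/
abbrev Ambient : Type := EuclideanSpace ℝ (Fin 3) × EuclideanSpace ℝ (Fin 3)

/-- The bundle of cotangent vectors of length at most `lam`:
pairs `(u, v)` with `⟨u, v⟩ = 0`, `‖v‖ = 1`, `‖u‖ ≤ lam`. -/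
def cotangentDisc (lam : ℝ) : Set Ambient :=
  {p | inner ℝ p.1 p.2 = 0 ∧ ‖p.2‖ = 1 ∧ ‖p.1‖ ≤ lam}

/-- `X` is tangent at `p` to the cotangent bundle `{⟨u, v⟩ = 0, ‖v‖ = 1}`. -/
def IsTangentCotangent (p X : Ambient) : Prop :=
  inner ℝ X.1 p.2 + inner ℝ p.1 X.2 = 0 ∧ inner ℝ p.2 X.2 = 0

/-- The two-form `du ∧ dv`. -/
def stdForm (X Y : Ambient) : ℝ := inner ℝ X.1 Y.2 - inner ℝ Y.1 X.2

/-- The normalized geodesic flow, a circle action on the complement `u ≠ 0` of the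
zero-section. -/
def geodesicFlow (t : ℝ) (p : Ambient) : Ambient :=
  (Real.cos t • p.1 - (Real.sin t * ‖p.1‖) • p.2, Real.cos t • p.2 + (Real.sin t / ‖p.1‖) • p.1)

open Classical in
/-- The model Dehn twist determined by the function `r`. -/
def modelTwist (r : ℝ → ℝ) (p : Ambient) : Ambient :=
  if p.1 = 0 then (0, -p.2) else geodesicFlow (2 * Real.pi * deriv r ‖p.1‖) p

/-- The functions `r` that define model Dehn twists supported in the cotangent vectors of length at
most `lam / 2`. -/
structure IsTwistProfile (lam : ℝ) (r : ℝ → ℝ) : Prop where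
  smooth : ContDiff ℝ ∞ r
  vanish : ∀ t, lam / 2 ≤ t → r t = 0
  reflect : ∀ t, r (-t) = r t - t

section Twist

variable {M : Type*} [TopologicalSpace M] [ChartedSpace (EuclideanSpace ℝ (Fin 4)) M]

/-- `i` restricts to a symplectic embedding of the bundle of cotangent vectors of length at
most `lam` into `(M, η)`, which maps the zero-section onto `L`. Smoothness on this subset of
`ℝ³ × ℝ³` means that `i` is smooth on an open neighbourhood of it; the values of `i` outside the
subset play no role. (The symplectic condition makes `i` an immersion, and an injective immersion
of a compact manifold is an embedding.) -/
structure IsWeinsteinEmbedding (η : TwoForm M) (L : Set M) (lam : ℝ) (i : Ambient → M) :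
    Prop where
  smooth : ∃ U : Set Ambient, IsOpen U ∧ cotangentDisc lam ⊆ U ∧
    ContMDiffOn 𝓘(ℝ, Ambient) (𝓡 4) ∞ i U
  injOn : Set.InjOn i (cotangentDisc lam)
  symplectic : ∀ p ∈ cotangentDisc lam, ∀ X Y : Ambient,
    IsTangentCotangent p X → IsTangentCotangent p Y →
      η (i p) ![mfderiv 𝓘(ℝ, Ambient) (𝓡 4) i p X, mfderiv 𝓘(ℝ, Ambient) (𝓡 4) i p Y]
        = stdForm X Y
  zeroSection : i '' {p : Ambient | p.1 = 0 ∧ ‖p.2‖ = 1} = L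

/-- `τ` is a Dehn twist along `L`: a model Dehn twist, transplanted to `M` by means of a symplectic
embedding `i` of a cotangent disc bundle that maps the zero-section to `L`, and extended by the
identity. -/
def IsDehnTwist (η : TwoForm M) (L : Set M) (τ : M → M) : Prop :=
  ∃ (lam : ℝ) (i : Ambient → M) (r : ℝ → ℝ),
    0 < lam ∧ IsWeinsteinEmbedding η L lam i ∧ IsTwistProfile lam r ∧
    (∀ p ∈ cotangentDisc lam, τ (i p) = i (modelTwist r p)) ∧
    (∀ x, x ∉ i '' cotangentDisc lam → τ x = x)

end Twist

end FourDim

end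

/-!
Squared Dehn twists along a Lagrangian sphere exist and are potentially fragile.

**Fragility.** On the cotangent bundle `T = {⟨u, v⟩ = 0, ‖v‖ = 1}` put `μ_s(u, v) = u × v + s v`.
The closed form `ω_s = du ∧ dv + s β`, where `β` is the pullback of the area form of the sphere, is
symplectic on `T`, and `μ_s` is the moment map of the action of `SO(3)` for `ω_s`. If `A` is the
gradient of a radial function on `ℝ³`, then `p ↦ exp (A (μ_s p)) p` is the time-one map of a
Hamiltonian flow for `ω_s`, so it preserves `ω_s`. Taking `A = -2π k(‖μ‖) μ` with
`k(ρ) = (2 r'(ρ) - 1) / ρ`, which is a smooth function of `μ` because the reflection property of `r`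
makes `2 r' - 1` odd, one obtains at `s = 0` the square of the model Dehn twist, and for every `s`
the identity outside the support of `r`. For `s > 0` one has `‖μ_s‖² = ‖u‖² + s² > 0`, so that
the summand with `-1`, which is a full rotation about the axis `μ`, may be dropped, and
the remaining radial field can be scaled to zero: this is the isotopy to the identity. To transplant
this family to `M`, the form `β` is replaced by a closed form that agrees with it near the zero
section and vanishes further out. It is `β` plus the derivative of a cut-off connection form
of the circle bundle of directions in `T`; it exists because `β` is exact away from the zero-section.
This part ends with `potentiallyFragile_sq`.

**Existence.** The point is the Lagrangian neighbourhood theorem for the sphere,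
`exists_isWeinsteinEmbedding`. Two functions on `M` with values in `ℝ³` are constructed: a left
inverse `V` of the embedding of the sphere, and a function `U` which vanishes along the sphere and
whose derivative pairs normal vectors with tangent vectors of the sphere by means of the symplectic
form. The map `(U, V)` followed by the retraction to `T` is inverted near the sphere
(`exists_tubularMap`), and the inverse pulls the symplectic form back to a form `σ₁`, which agrees
with the canonical form `σ₀` of `T` in vertical directions along the zero-section. Contraction of
the fibres gives a primitive `α` of `σ₁ - σ₀` which vanishes on the zero-section, and the Moser field
`V_t = -(σ₀ + t (σ₁ - σ₀))⁻¹ α` integrates to a map that takes `σ₁` to `σ₀` (`exists_moser_map`).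
The form `σ₀ + t (σ₁ - σ₀) + dt ∧ α` on space-time is closed and has `∂/∂t + V_t` in its kernel, so
the flow preserves it. All this is carried out on open subsets of `ℝ³ × ℝ³` instead of `T`, with
forms that are pulled back under the retraction; adding `d⟨u, v⟩ ∧ d(‖v‖² / 2)` makes them
nondegenerate, and the flow preserves both functions and hence `T`. Flows
(`exists_smooth_flow`) are obtained by inverting the operator `γ ↦ γ - ∫ W ∘ γ` on the space of
paths, which gives smooth dependence on the initial point at once.
-/

open scoped Manifold ContDiff

noncomputable section

namespace FourDim

/-! ### The cross product and rotations of three-space -/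

/-- Euclidean three-space. -/
abbrev R3 : Type := EuclideanSpace ℝ (Fin 3)

theorem R3.inner_eq (a b : R3) : inner ℝ a b = a 0 * b 0 + a 1 * b 1 + a 2 * b 2 := by
  simp [PiLp.inner_apply, Fin.sum_univ_three, mul_comm]

theorem R3.ext_iff' {a b : R3} : a = b ↔ a 0 = b 0 ∧ a 1 = b 1 ∧ a 2 = b 2 := by
  constructor
  · rintro rfl; simp
  · rintro ⟨h0, h1, h2⟩
    ext i; fin_cases i <;> assumption

/-- The cross product of three-space as a continuous bilinear map. -/
def crossL : R3 →L[ℝ] R3 →L[ℝ] R3 :=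
  LinearMap.toContinuousLinearMap
    ((LinearMap.toContinuousLinearMap : (R3 →ₗ[ℝ] R3) ≃ₗ[ℝ] (R3 →L[ℝ] R3)).toLinearMap ∘ₗ
      LinearMap.mk₂ ℝ (fun a b : R3 =>
        (!₂[a 1 * b 2 - a 2 * b 1, a 2 * b 0 - a 0 * b 2, a 0 * b 1 - a 1 * b 0] : R3))
        (by intro a b c; rw [R3.ext_iff']; simp; refine ⟨?_, ?_, ?_⟩ <;> ring)
        (by intro a b c; rw [R3.ext_iff']; simp; refine ⟨?_, ?_, ?_⟩ <;> ring)
        (by intro a b c; rw [R3.ext_iff']; simp; refine ⟨?_, ?_, ?_⟩ <;> ring)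
        (by intro a b c; rw [R3.ext_iff']; simp; refine ⟨?_, ?_, ?_⟩ <;> ring))

@[simp] theorem crossL_zero' (a b : R3) : (crossL a b) 0 = a 1 * b 2 - a 2 * b 1 := rfl
@[simp] theorem crossL_one' (a b : R3) : (crossL a b) 1 = a 2 * b 0 - a 0 * b 2 := rfl
@[simp] theorem crossL_two' (a b : R3) : (crossL a b) 2 = a 0 * b 1 - a 1 * b 0 := rfl

theorem crossL_anticomm (a b : R3) : crossL a b = - crossL b a := by
  rw [R3.ext_iff']; simp; refine ⟨?_, ?_, ?_⟩ <;> ring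

@[simp] theorem crossL_self (a : R3) : crossL a a = 0 := by
  rw [R3.ext_iff']; simp; refine ⟨?_, ?_, ?_⟩ <;> ring

theorem crossL_jacobi (w a b : R3) :
    crossL w (crossL a b) = crossL (crossL w a) b + crossL a (crossL w b) := by
  rw [R3.ext_iff']; simp; refine ⟨?_, ?_, ?_⟩ <;> ring

theorem inner_crossL_left (a b c : R3) : inner ℝ (crossL a b) c = - inner ℝ b (crossL a c) := by
  simp [R3.inner_eq]; ring

theorem inner_crossL_self_left (a b : R3) : inner ℝ (crossL a b) a = 0 := by
  simp [R3.inner_eq]; ring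

theorem inner_crossL_self_right (a b : R3) : inner ℝ (crossL a b) b = 0 := by
  simp [R3.inner_eq]; ring

theorem crossL_crossL (a b c : R3) :
    crossL a (crossL b c) = (inner ℝ a c : ℝ) • b - (inner ℝ a b : ℝ) • c := by
  rw [R3.ext_iff']; simp [R3.inner_eq]; refine ⟨?_, ?_, ?_⟩ <;> ring

theorem inner_crossL_crossL (a b c d : R3) : (inner ℝ (crossL a b) (crossL c d) : ℝ) =
    inner ℝ a c * inner ℝ b d - inner ℝ a d * inner ℝ b c := by
  simp [R3.inner_eq]; ring

/-- The rotation of three-space about the axis `w` by the angle `‖w‖`. -/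
def rot (w : R3) : R3 →L[ℝ] R3 := NormedSpace.exp (crossL w)

theorem contDiff_rot : ContDiff ℝ ∞ rot := by
  have h : ContDiff ℝ ∞ (NormedSpace.exp : (R3 →L[ℝ] R3) → (R3 →L[ℝ] R3)) :=
    AnalyticOnNhd.contDiff (𝕜 := ℝ) fun x _ => NormedSpace.exp_analytic x
  exact h.comp crossL.contDiff

@[simp] theorem rot_zero : rot 0 = 1 := by simp [rot]

theorem hasDerivAt_rot_smul (w : R3) (t : ℝ) (x : R3) :
    HasDerivAt (fun t : ℝ => rot (t • w) x) (crossL w (rot (t • w) x)) t := by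
  have h := hasDerivAt_exp_smul_const' (𝕂 := ℝ) (crossL w) t
  have h2 := (h.clm_apply (hasDerivAt_const t x))
  simpa [rot, map_smul] using h2

theorem eq_of_hasDerivAt_zero {E : Type*} [NormedAddCommGroup E] [NormedSpace ℝ E] {f : ℝ → E}
    (h : ∀ t, HasDerivAt f 0 t) (a b : ℝ) : f a = f b :=
  is_const_of_deriv_eq_zero (fun t => (h t).differentiableAt) (fun t => (h t).deriv) a b

theorem inner_rot_rot (w x y : R3) : (inner ℝ (rot w x) (rot w y) : ℝ) = inner ℝ x y := by
  have := eq_of_hasDerivAt_zero (f := fun t : ℝ => (inner ℝ (rot (t • w) x) (rot (t • w) y) : ℝ))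
    (fun t => by
      refine ((hasDerivAt_rot_smul w t x).inner ℝ (hasDerivAt_rot_smul w t y)).congr_deriv ?_
      rw [inner_crossL_left]; ring) 1 0
  simpa using this

@[simp] theorem norm_rot (w x : R3) : ‖rot w x‖ = ‖x‖ := by
  have h := inner_rot_rot w x x
  rw [real_inner_self_eq_norm_sq, real_inner_self_eq_norm_sq] at h
  exact (sq_eq_sq₀ (norm_nonneg _) (norm_nonneg _)).1 h

/-- If `y` solves the linear equation `y' = w × y` then it is the rotated initial vector. -/
theorem eq_rot_of_hasDerivAt {w : R3} {y : ℝ → R3} (hy : ∀ t, HasDerivAt y (crossL w (y t)) t)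
    (t : ℝ) : y t = rot (t • w) (y 0) := by
  have hd : ∀ t, HasDerivAt (fun t : ℝ => y t - rot (t • w) (y 0))
      (crossL w (y t - rot (t • w) (y 0))) t := fun t => by
    rw [map_sub]; exact (hy t).sub (hasDerivAt_rot_smul w t _)
  have := eq_of_hasDerivAt_zero
    (f := fun t : ℝ => (inner ℝ (y t - rot (t • w) (y 0)) (y t - rot (t • w) (y 0)) : ℝ))
    (fun t => by
      refine ((hd t).inner ℝ (hd t)).congr_deriv ?_
      rw [inner_crossL_left]; ring) t 0
  simp only [zero_smul, rot_zero, one_apply_eq_self, sub_self, inner_zero_left] at this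
  exact sub_eq_zero.1 (inner_self_eq_zero.1 this)

theorem rot_crossL (w a b : R3) : rot w (crossL a b) = crossL (rot w a) (rot w b) := by
  have := eq_rot_of_hasDerivAt (w := w) (y := fun t : ℝ => crossL (rot (t • w) a) (rot (t • w) b))
    (fun t => by
      rw [crossL_jacobi]
      exact (crossL.hasFDerivAt.comp_hasDerivAt t (hasDerivAt_rot_smul w t a)).clm_apply
        (hasDerivAt_rot_smul w t b)) 1
  simpa using this.symm

theorem rot_of_crossL_eq_zero {w x : R3} (h : crossL w x = 0) : rot w x = x := by
  have := eq_rot_of_hasDerivAt (w := w) (y := fun _ : ℝ => x)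
    (fun t => by rw [h]; exact hasDerivAt_const t x) 1
  simpa using this.symm

theorem rot_smul_orthogonal {n x : R3} (hn : ‖n‖ = 1) (hx : (inner ℝ n x : ℝ) = 0) (θ : ℝ) :
    rot (θ • n) x = Real.cos θ • x + Real.sin θ • crossL n x := by
  have := eq_rot_of_hasDerivAt (w := n)
    (y := fun t : ℝ => Real.cos t • x + Real.sin t • crossL n x)
    (fun t => by
      have h1 := (Real.hasDerivAt_cos t).smul_const x
      have h2 := (Real.hasDerivAt_sin t).smul_const (crossL n x)
      refine (h1.add h2).congr_deriv ?_
      rw [map_add, map_smul, map_smul, crossL_crossL, hx, real_inner_self_eq_norm_sq, hn]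
      simp [add_comm]) θ
  simpa using this.symm

theorem rot_two_pi {n : R3} (hn : ‖n‖ = 1) (x : R3) : rot ((2 * Real.pi) • n) x = x := by
  have hx : x = (x - (inner ℝ n x : ℝ) • n) + (inner ℝ n x : ℝ) • n := by abel
  have h1 : rot ((2 * Real.pi) • n) (x - (inner ℝ n x : ℝ) • n) = x - (inner ℝ n x : ℝ) • n := by
    rw [rot_smul_orthogonal hn]
    · simp
    · rw [inner_sub_right, inner_smul_right, real_inner_self_eq_norm_sq, hn]; ring
  have h2 : rot ((2 * Real.pi) • n) ((inner ℝ n x : ℝ) • n) = (inner ℝ n x : ℝ) • n :=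
    rot_of_crossL_eq_zero (by simp)
  conv_lhs => rw [hx, map_add, h1, h2]
  abel

theorem rot_add_smul (a b : ℝ) (n x : R3) :
    rot ((a + b) • n) x = rot (a • n) (rot (b • n) x) := by
  have := eq_rot_of_hasDerivAt (w := n) (y := fun t : ℝ => rot ((t + b) • n) x)
    (fun t => (hasDerivAt_rot_smul n (t + b) x).comp_add_const t b) a
  simpa using this

theorem rot_neg_apply_rot (w x : R3) : rot (-w) (rot w x) = x := by
  have h := rot_add_smul (-1) 1 w x
  simpa using h.symm

/-! ### The twisted symplectic forms and their moment maps -/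

/-- The bundle of all cotangent vectors of the sphere. -/
def cotangentBundle : Set Ambient := {p | inner ℝ p.1 p.2 = 0 ∧ ‖p.2‖ = 1}

/-- The symplectic form `du ∧ dv` plus `s` times the area form of the base, at the point `p`. -/
def twistedForm (s : ℝ) (p X Y : Ambient) : ℝ :=
  stdForm X Y + s * inner ℝ p.2 (crossL X.2 Y.2)

/-- The moment map of the rotation action for the form `twistedForm s`. -/
def moment (s : ℝ) (p : Ambient) : R3 := crossL p.1 p.2 + s • p.2

/-- The derivative of the moment map. -/
def momentDeriv (s : ℝ) (p X : Ambient) : R3 := crossL X.1 p.2 + crossL p.1 X.2 + s • X.2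

/-- The diagonal action of a rotation on `ℝ³ × ℝ³`. -/
def rotPair (w : R3) (p : Ambient) : Ambient := (rot w p.1, rot w p.2)

theorem contDiff_moment : ContDiff ℝ ∞ (fun q : ℝ × Ambient => moment q.1 q.2) := by
  unfold moment
  have h1 : ContDiff ℝ ∞ (fun q : ℝ × Ambient => q.2.1) := by fun_prop
  have h2 : ContDiff ℝ ∞ (fun q : ℝ × Ambient => q.2.2) := by fun_prop
  exact ((crossL.contDiff.comp h1).clm_apply h2).add (contDiff_fst.smul h2)

theorem contDiff_moment_right (s : ℝ) : ContDiff ℝ ∞ (moment s) := by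
  have h := contDiff_moment.comp (f := fun p : Ambient => (s, p))
    (contDiff_const.prodMk contDiff_id)
  exact h

theorem contDiff_rotPair : ContDiff ℝ ∞ (fun q : R3 × Ambient => rotPair q.1 q.2) := by
  unfold rotPair
  have h := contDiff_rot.comp (contDiff_fst (𝕜 := ℝ) (E := R3) (F := Ambient))
  exact (h.clm_apply (by fun_prop)).prodMk (h.clm_apply (by fun_prop))

theorem contDiffAt_rotPair {E : Type*} [NormedAddCommGroup E] [NormedSpace ℝ E] {a : E → R3}
    {b : E → Ambient} {z : E} (ha : ContDiffAt ℝ ∞ a z) (hb : ContDiffAt ℝ ∞ b z) :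
    ContDiffAt ℝ ∞ (fun z => rotPair (a z) (b z)) z := by
  have h := contDiff_rotPair.comp_contDiffAt (f := fun z => (a z, b z)) z (ha.prodMk hb)
  exact h

theorem hasFDerivAt_moment (s : ℝ) {E : Type*} [NormedAddCommGroup E] [NormedSpace ℝ E]
    {g : E → Ambient} {g' : E →L[ℝ] Ambient} {z : E} (hg : HasFDerivAt g g' z) (X : E) :
    ∃ m : E →L[ℝ] R3, HasFDerivAt (fun z => moment s (g z)) m z ∧
      m X = momentDeriv s (g z) (g' X) := by
  have h1 := (crossL.hasFDerivAt.comp z hg.fst).clm_apply hg.snd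
  refine ⟨_, h1.add (hg.snd.const_smul s), ?_⟩
  simp [momentDeriv]
  abel

theorem moment_rotPair (s : ℝ) (w : R3) (p : Ambient) :
    moment s (rotPair w p) = rot w (moment s p) := by
  simp [moment, rotPair, rot_crossL]

theorem rotPair_mem_cotangentBundle {w : R3} {p : Ambient} (hp : p ∈ cotangentBundle) :
    rotPair w p ∈ cotangentBundle := by
  simpa [rotPair, cotangentBundle, inner_rot_rot] using hp

theorem norm_moment_sq (s : ℝ) {p : Ambient} (hp : p ∈ cotangentBundle) :
    ‖moment s p‖ ^ 2 = ‖p.1‖ ^ 2 + s ^ 2 := by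
  have h1 := inner_crossL_crossL p.1 p.2 p.1 p.2
  have h2 := inner_crossL_self_right p.1 p.2
  simp only [real_inner_self_eq_norm_sq, hp.1, hp.2] at h1
  rw [moment, norm_add_sq_real, inner_smul_right, h1, h2, norm_smul, hp.2, mul_one,
    Real.norm_eq_abs, sq_abs]
  ring

/-- The defining property of the moment map, on vectors tangent to the cotangent bundle. -/
theorem twistedForm_rotation {s : ℝ} {p Z : Ambient} (hp : p ∈ cotangentBundle)
    (hZ : IsTangentCotangent p Z) (ξ : R3) :
    twistedForm s p (crossL ξ p.1, crossL ξ p.2) Z = inner ℝ ξ (momentDeriv s p Z) := by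
  have h1 : (inner ℝ p.2 p.2 : ℝ) = 1 := by rw [real_inner_self_eq_norm_sq, hp.2]; norm_num
  have h2 := hZ.2
  simp only [R3.inner_eq, twistedForm, stdForm, momentDeriv, crossL_zero', crossL_one', crossL_two',
    PiLp.add_apply, PiLp.smul_apply, smul_eq_mul] at *
  linear_combination s * (ξ 0 * Z.2 0 + ξ 1 * Z.2 1 + ξ 2 * Z.2 2) * h1 -
    s * (p.2 0 * ξ 0 + p.2 1 * ξ 1 + p.2 2 * ξ 2) * h2

theorem two_le_infty : (2 : WithTop ℕ∞) ≤ ∞ := by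
  exact WithTop.coe_le_coe.2 (le_top : (2 : ℕ∞) ≤ ⊤)

/-- Directional derivatives in two fixed directions commute. -/
theorem hasFDerivAt_fderiv_apply {E F : Type*} [NormedAddCommGroup E] [NormedSpace ℝ E]
    [NormedAddCommGroup F] [NormedSpace ℝ F] {G : E → F} {z : E} (hG : ContDiffAt ℝ ∞ G z)
    (u X : E) : ∃ m : E →L[ℝ] F, HasFDerivAt (fun z => fderiv ℝ G z X) m z ∧
      m u = fderiv ℝ (fun z => fderiv ℝ G z u) z X := by
  have hd : DifferentiableAt ℝ (fderiv ℝ G) z :=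
    (hG.fderiv_right (m := ∞) (by simp)).differentiableAt (by simp)
  have hs : IsSymmSndFDerivAt ℝ G z := hG.isSymmSndFDerivAt
    (by rw [minSmoothness_of_isRCLikeNormedField]; exact two_le_infty)
  refine ⟨_, hd.hasFDerivAt.clm_apply (hasFDerivAt_const X z), ?_⟩
  rw [(hd.hasFDerivAt.clm_apply (hasFDerivAt_const u z)).fderiv]
  simpa using hs u X

set_option maxHeartbeats 1000000 in
/-- A map of the form `p ↦ rot (A (μ p)) p`, where `A` is a gradient field which is everywhere
parallel to the position vector, preserves the twisted form. It is the time-one Hamiltonian flow of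
the pullback under the moment map of a potential of `A`. -/
theorem twistedForm_rotPair {s : ℝ} {A : R3 → R3} {p : Ambient} (hp : p ∈ cotangentBundle)
    (hA : ContDiffAt ℝ ∞ A (moment s p)) (hpar : ∀ m, crossL (A m) m = 0)
    (hsym : ∀ a b, (inner ℝ (fderiv ℝ A (moment s p) a) b : ℝ) =
      inner ℝ a (fderiv ℝ A (moment s p) b))
    {X Y : Ambient} (hX : IsTangentCotangent p X) (hY : IsTangentCotangent p Y) :
    twistedForm s (rotPair (A (moment s p)) p)
        (fderiv ℝ (fun p => rotPair (A (moment s p)) p) p X)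
        (fderiv ℝ (fun p => rotPair (A (moment s p)) p) p Y) = twistedForm s p X Y := by
  set w : Ambient → R3 := fun p => A (moment s p) with hw
  have hmom : ContDiff ℝ ∞ (moment s) := contDiff_moment_right s
  have hwc : ContDiffAt ℝ ∞ w p := ContDiffAt.comp (f := moment s) p hA hmom.contDiffAt
  set G : ℝ × Ambient → Ambient := fun q => rotPair (q.1 • w q.2) q.2 with hGdef
  have hGs : ∀ t p', ContDiffAt ℝ ∞ w p' → ContDiffAt ℝ ∞ G (t, p') := fun t p' h =>
    contDiffAt_rotPair (contDiffAt_fst.smul (ContDiffAt.comp (g := w) (f := Prod.snd) (t, p') h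
        contDiffAt_snd)) contDiffAt_snd
  have hG : ∀ t, ContDiffAt ℝ ∞ G (t, p) := fun t => hGs t p hwc
  have hGd : ∀ t, HasFDerivAt G (fderiv ℝ G (t, p)) (t, p) := fun t =>
    ((hG t).differentiableAt (by simp)).hasFDerivAt
  have hGt : ∀ t p', HasDerivAt (fun t => G (t, p'))
      (crossL (w p') (G (t, p')).1, crossL (w p') (G (t, p')).2) t := fun t p' =>
    (hasDerivAt_rot_smul (w p') t p'.1).prodMk (hasDerivAt_rot_smul (w p') t p'.2)
  -- the time derivative of the flow, as a function of time and of the initial point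
  have hpart : ∀ t, (fun q => fderiv ℝ G q (1, 0)) =ᶠ[nhds (t, p)]
      fun q => (crossL (w q.2) (G q).1, crossL (w q.2) (G q).2) := by
    intro t
    have hev : ∀ᶠ q : ℝ × Ambient in nhds (t, p), DifferentiableAt ℝ G q :=
      ((hG t).of_le (m := 1) (by simp)).eventually (by simp) |>.mono
        fun q hq => hq.differentiableAt (by simp)
    filter_upwards [hev] with q hq
    have h1 : HasDerivAt (fun t : ℝ => (t, q.2)) ((1 : ℝ), (0 : Ambient)) q.1 :=
      (hasDerivAt_id _).prodMk (hasDerivAt_const _ _)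
    exact (HasFDerivAt.comp_hasDerivAt (l := G) (f := fun t : ℝ => (t, q.2)) q.1
      hq.hasFDerivAt h1).unique (hGt q.1 q.2)
  have hwd : HasFDerivAt w (fderiv ℝ w p) p := (hwc.differentiableAt (by simp)).hasFDerivAt
  set Z : Ambient → ℝ → Ambient := fun X t => fderiv ℝ G (t, p) (0, X) with hZ
  set η : Ambient → R3 := fun X => fderiv ℝ w p X with hη
  have hZd : ∀ X t, HasDerivAt (Z X)
      (crossL (η X) (G (t, p)).1 + crossL (w p) (Z X t).1,
        crossL (η X) (G (t, p)).2 + crossL (w p) (Z X t).2) t := by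
    intro X t
    obtain ⟨m, hm, hmu⟩ := hasFDerivAt_fderiv_apply (hG t) (1, 0) (0, X)
    have h1 : HasDerivAt (fun t : ℝ => (t, p)) ((1 : ℝ), (0 : Ambient)) t :=
      (hasDerivAt_id _).prodMk (hasDerivAt_const _ _)
    refine (hm.comp_hasDerivAt t h1).congr_deriv ?_
    rw [hmu, (hpart t).fderiv_eq]
    have hw2 : HasFDerivAt (fun q : ℝ × Ambient => w q.2)
        ((fderiv ℝ w p).comp (ContinuousLinearMap.snd ℝ ℝ Ambient)) (t, p) :=
      HasFDerivAt.comp (g := w) (f := Prod.snd) (t, p) hwd hasFDerivAt_snd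
    have hc : HasFDerivAt (fun q : ℝ × Ambient => crossL (w q.2)) _ (t, p) :=
      crossL.hasFDerivAt.comp (t, p) hw2
    rw [((hc.clm_apply (hGd t).fst).prodMk (hc.clm_apply (hGd t).snd)).fderiv]
    exact Prod.ext (add_comm _ _) (add_comm _ _)
  -- the derivative of the flow in the direction of the second factor
  have hGp : ∀ t, HasFDerivAt (fun p' => G (t, p'))
      ((fderiv ℝ G (t, p)).comp (ContinuousLinearMap.inr ℝ ℝ Ambient)) p := fun t =>
    (hGd t).comp p ((hasFDerivAt_const t p).prodMk (hasFDerivAt_id p))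
  have hmem : ∀ t, G (t, p) ∈ cotangentBundle := fun t => rotPair_mem_cotangentBundle hp
  have htan : ∀ X, IsTangentCotangent p X → ∀ t, IsTangentCotangent (G (t, p)) (Z X t) := by
    intro X hX t
    constructor
    · have h1 := (hGp t).fst.inner ℝ (hGp t).snd
      have h2 := (hasFDerivAt_fst (𝕜 := ℝ) (E := R3) (F := R3) (p := p)).inner ℝ
        (hasFDerivAt_snd (𝕜 := ℝ) (E := R3) (F := R3) (p := p))
      have e : (fun p' : Ambient => (inner ℝ (G (t, p')).1 (G (t, p')).2 : ℝ)) =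
          fun p' => inner ℝ p'.1 p'.2 := by
        funext p'
        simp only [hGdef, rotPair, inner_rot_rot]
      rw [e] at h1
      have h3 := congrArg (fun f : Ambient →L[ℝ] ℝ => f X) (h1.unique h2)
      simp only [fderivInnerCLM_apply, ContinuousLinearMap.comp_apply,
        ContinuousLinearMap.prod_apply, ContinuousLinearMap.inr_apply,
        ContinuousLinearMap.coe_fst', ContinuousLinearMap.coe_snd'] at h3
      linarith [hX.1]
    · have h1 := (hGp t).snd.inner ℝ (hGp t).snd
      have h2 := (hasFDerivAt_snd (𝕜 := ℝ) (E := R3) (F := R3) (p := p)).inner ℝ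
        (hasFDerivAt_snd (𝕜 := ℝ) (E := R3) (F := R3) (p := p))
      have e : (fun p' : Ambient => (inner ℝ (G (t, p')).2 (G (t, p')).2 : ℝ)) =
          fun p' => inner ℝ p'.2 p'.2 := by
        funext p'
        simp only [hGdef, rotPair, inner_rot_rot]
      rw [e] at h1
      have h3 := congrArg (fun f : Ambient →L[ℝ] ℝ => f X) (h1.unique h2)
      simp only [fderivInnerCLM_apply, ContinuousLinearMap.comp_apply,
        ContinuousLinearMap.prod_apply, ContinuousLinearMap.inr_apply,
        ContinuousLinearMap.coe_snd'] at h3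
      have h4 : (inner ℝ (G (t, p)).2 (Z X t).2 : ℝ) = inner ℝ p.2 X.2 := by
        have e1 := real_inner_comm (G (t, p)).2 (fderiv ℝ G (t, p) (0, X)).2
        have e2 := real_inner_comm p.2 X.2
        simp only [hZ]
        linarith
      rw [h4, hX.2]
  have hmomZ : ∀ X t, momentDeriv s (G (t, p)) (Z X t) = momentDeriv s p X := by
    intro X t
    obtain ⟨m, hm, hmX⟩ := hasFDerivAt_moment s (hGp t) X
    obtain ⟨m', hm', hmX'⟩ := hasFDerivAt_moment s (hasFDerivAt_id (𝕜 := ℝ) p) X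
    have : (fun p' => moment s (G (t, p'))) = fun p' => moment s p' := by
      funext p'
      rw [moment_rotPair]
      exact rot_of_crossL_eq_zero (by simp [hw, hpar])
    rw [this] at hm
    have h := congrArg (fun f : Ambient →L[ℝ] R3 => f X) (hm.unique hm')
    simp only [hmX, hmX'] at h
    simpa using h
  have hηX : ∀ X, η X = fderiv ℝ A (moment s p) (momentDeriv s p X) := by
    intro X
    obtain ⟨m', hm', hmX'⟩ := hasFDerivAt_moment s (hasFDerivAt_id (𝕜 := ℝ) p) X
    have h := (hA.differentiableAt (by simp)).hasFDerivAt.comp p hm'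
    have h2 : η X = (fderiv ℝ A (moment s p)) (m' X) := by
      simp only [hη, hw]
      exact congrArg (fun f : Ambient →L[ℝ] R3 => f X) h.fderiv
    rw [h2, hmX']; rfl
  -- the pullback of the form is constant in time
  have hconst : ∀ t, HasDerivAt (fun t => twistedForm s (G (t, p)) (Z X t) (Z Y t)) 0 t := by
    intro t
    have hX1 := (hZd X t).hasFDerivAt.fst.hasDerivAt
    have hX2 := (hZd X t).hasFDerivAt.snd.hasDerivAt
    have hY1 := (hZd Y t).hasFDerivAt.fst.hasDerivAt
    have hY2 := (hZd Y t).hasFDerivAt.snd.hasDerivAt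
    have hv := (hGt t p).hasFDerivAt.snd.hasDerivAt
    have hcr := (crossL.hasFDerivAt.comp_hasDerivAt t hX2).clm_apply hY2
    have hall := ((hX1.inner ℝ hY2).sub (hY1.inner ℝ hX2)).add ((hv.inner ℝ hcr).const_mul s)
    refine hall.congr_deriv ?_
    have e1 := twistedForm_rotation (s := s) (hmem t) (htan Y hY t) (η X)
    have e2 := twistedForm_rotation (s := s) (hmem t) (htan X hX t) (η Y)
    rw [hmomZ, hηX, hsym] at e1
    rw [hmomZ, hηX, real_inner_comm] at e2
    have e3 := e1.trans e2.symm
    rw [← hηX, ← hηX] at e3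
    simp only [twistedForm, stdForm, R3.inner_eq, crossL_zero', crossL_one', crossL_two',
      PiLp.add_apply, ContinuousLinearMap.toSpanSingleton_apply, ContinuousLinearMap.comp_apply,
      ContinuousLinearMap.coe_fst', ContinuousLinearMap.coe_snd', one_smul,
      Function.comp_apply] at e3 ⊢
    linear_combination e3
  have h01 := eq_of_hasDerivAt_zero hconst 1 0
  have hZ1 : ∀ X, Z X 1 = fderiv ℝ (fun p => rotPair (w p) p) p X := by
    intro X
    have h := hGp 1
    simp only [hGdef, one_smul] at h
    rw [h.fderiv]; rfl
  have hZ0 : ∀ X, Z X 0 = X := by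
    intro X
    have h := hGp 0
    have h2 : (fun p' => G (0, p')) = id := by funext p'; simp [hGdef, rotPair]
    rw [h2] at h
    have := congrArg (fun f : Ambient →L[ℝ] Ambient => f X) (h.unique (hasFDerivAt_id p))
    simpa using this
  rw [hZ1, hZ1, hZ0, hZ0] at h01
  simpa [hGdef, rotPair] using h01

set_option linter.unusedSectionVars false

/-! ### Superposition operators on spaces of continuous paths -/

section Paths

universe u

variable {K : Type} [TopologicalSpace K] [CompactSpace K]
variable {E F : Type u} [NormedAddCommGroup E] [NormedSpace ℝ E]
  [NormedAddCommGroup F] [NormedSpace ℝ F]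

/-- The superposition operator `γ ↦ g ∘ γ` on continuous maps. -/
def superpose (g : E → F) (hg : Continuous g) (γ : C(K, E)) : C(K, F) :=
  ContinuousMap.comp ⟨g, hg⟩ γ

@[simp] theorem superpose_apply (g : E → F) (hg : Continuous g) (γ : C(K, E)) (t : K) :
    superpose g hg γ t = g (γ t) := rfl

/-- Pointwise application of a continuous family of linear maps to a continuous family of
vectors. -/
def pointwiseApply : C(K, E →L[ℝ] F) →L[ℝ] C(K, E) →L[ℝ] C(K, F) :=
  LinearMap.mkContinuous₂
    (LinearMap.mk₂ ℝ (fun (A : C(K, E →L[ℝ] F)) (γ : C(K, E)) =>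
        (⟨fun t => A t (γ t), by fun_prop⟩ : C(K, F)))
      (fun _ _ _ => by ext; simp) (fun _ _ _ => by ext; simp)
      (fun _ _ _ => by ext; simp) (fun _ _ _ => by ext; simp)) 1
    (fun A γ => by
      rw [one_mul, ContinuousMap.norm_le _ (by positivity)]
      intro t
      exact (ContinuousLinearMap.le_opNorm _ _).trans
        (mul_le_mul (A.norm_coe_le_norm t) (γ.norm_coe_le_norm t) (norm_nonneg _) (norm_nonneg A)))

@[simp] theorem pointwiseApply_apply (A : C(K, E →L[ℝ] F)) (γ : C(K, E)) (t : K) :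
    pointwiseApply A γ t = A t (γ t) := rfl

theorem hasFDerivAt_superpose {g : E → F} (hg : ContDiff ℝ 1 g) (γ : C(K, E)) :
    HasFDerivAt (superpose g hg.continuous)
      (pointwiseApply (superpose (fderiv ℝ g) (hg.continuous_fderiv (by simp)) γ)) γ := by
  set D := superpose (K := K) (fderiv ℝ g) (hg.continuous_fderiv (by simp)) with hD
  have hcont : Continuous D := ContinuousMap.continuous_postcomp _
  rw [hasFDerivAt_iff_isLittleO_nhds_zero, Asymptotics.isLittleO_iff]
  intro c hc
  obtain ⟨δ, hδ, hball⟩ := Metric.continuousAt_iff.1 hcont.continuousAt c hc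
  filter_upwards [Metric.ball_mem_nhds (0 : C(K, E)) hδ] with h hh
  rw [ContinuousMap.norm_le _ (by positivity)]
  intro t
  have hseg : ∀ x ∈ segment ℝ (γ t) (γ t + h t), ‖fderiv ℝ g x - fderiv ℝ g (γ t)‖ ≤ c := by
    intro x hx
    rw [segment_eq_image'] at hx
    obtain ⟨θ, hθ, rfl⟩ := hx
    have hd : dist (γ + θ • h) γ < δ := by
      rw [dist_eq_norm, add_sub_cancel_left, norm_smul, Real.norm_of_nonneg hθ.1]
      have : ‖h‖ < δ := by simpa using hh
      nlinarith [norm_nonneg h, hθ.2]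
    have h1 := (ContinuousMap.norm_coe_le_norm (D (γ + θ • h) - D γ) t).trans
      (by simpa [dist_eq_norm] using (hball hd).le)
    simpa [hD] using h1
  have := (convex_segment (γ t) (γ t + h t)).norm_image_sub_le_of_norm_fderiv_le' (𝕜 := ℝ)
    (fun x _ => hg.differentiable (by simp) x) hseg (left_mem_segment ℝ _ _)
    (right_mem_segment ℝ _ _)
  simp only [add_sub_cancel_left] at this
  refine le_trans ?_ (this.trans (mul_le_mul_of_nonneg_left (h.norm_coe_le_norm t) hc.le))
  simp [hD]

theorem contDiff_superpose_nat (n : ℕ) : ∀ {F : Type u} [NormedAddCommGroup F] [NormedSpace ℝ F]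
    {g : E → F} (_ : ContDiff ℝ n g) (hc : Continuous g),
    ContDiff ℝ n (superpose (K := K) g hc) := by
  induction n with
  | zero =>
    intro F _ _ g hg hc
    rw [Nat.cast_zero, contDiff_zero]
    exact ContinuousMap.continuous_postcomp _
  | succ n ih =>
    intro F _ _ g hg hc
    have hg1 : ContDiff ℝ 1 g := hg.of_le (by simp)
    have hD : ContDiff ℝ n (fderiv ℝ g) := hg.fderiv_right (by simp)
    clear hg
    rw [Nat.cast_add, Nat.cast_one, contDiff_succ_iff_fderiv]
    refine ⟨fun γ => (hasFDerivAt_superpose hg1 γ).differentiableAt, by simp, ?_⟩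
    have : fderiv ℝ (superpose (K := K) g hc) =
        fun γ => pointwiseApply (superpose (fderiv ℝ g) hD.continuous γ) := by
      funext γ
      exact (hasFDerivAt_superpose hg1 γ).fderiv
    rw [this]
    exact (pointwiseApply (K := K)).contDiff.comp (ih hD hD.continuous)

theorem contDiff_superpose {g : E → F} (hg : ContDiff ℝ ∞ g) :
    ContDiff ℝ ∞ (superpose (K := K) g hg.continuous) :=
  contDiff_infty.2 fun n => contDiff_superpose_nat n (contDiff_infty.1 hg n) hg.continuous

end Paths

/-! ### Integration along paths -/

section Integral

open unitInterval

variable {E : Type*} [NormedAddCommGroup E] [NormedSpace ℝ E]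

/-- The extension of a path over the unit interval to the real line, constant outside. -/
def extendPath (γ : C(I, E)) (t : ℝ) : E := γ (Set.projIcc 0 1 zero_le_one t)

theorem continuous_extendPath (γ : C(I, E)) : Continuous (extendPath γ) :=
  γ.continuous.comp continuous_projIcc

theorem extendPath_coe (γ : C(I, E)) (t : I) : extendPath γ t = γ t := by
  simp [extendPath]

theorem extendPath_of_mem (γ : C(I, E)) {t : ℝ} (ht : t ∈ Set.Icc (0 : ℝ) 1) :
    extendPath γ t = γ ⟨t, ht⟩ := by
  rw [extendPath, Set.projIcc_of_mem _ ht]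

theorem norm_extendPath_le (γ : C(I, E)) (t : ℝ) : ‖extendPath γ t‖ ≤ ‖γ‖ :=
  γ.norm_coe_le_norm _

/-- The primitive of a path which vanishes at `0`. -/
def primitive : C(I, E) →L[ℝ] C(I, E) :=
  LinearMap.mkContinuous
    { toFun := fun γ => ⟨fun t => ∫ s in (0 : ℝ)..t, extendPath γ s,
        (intervalIntegral.continuous_primitive
          (fun a b => (continuous_extendPath γ).intervalIntegrable a b) 0).comp
          continuous_subtype_val⟩
      map_add' := fun γ δ => by
        ext t
        exact intervalIntegral.integral_add ((continuous_extendPath γ).intervalIntegrable _ _)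
          ((continuous_extendPath δ).intervalIntegrable _ _)
      map_smul' := fun c γ => by
        ext t
        exact intervalIntegral.integral_smul c _ } 1
    (fun γ => by
      rw [one_mul, ContinuousMap.norm_le _ (norm_nonneg _)]
      intro t
      refine (intervalIntegral.norm_integral_le_of_norm_le_const
        (fun s _ => norm_extendPath_le γ s)).trans ?_
      rw [sub_zero, abs_of_nonneg t.2.1]
      exact mul_le_of_le_one_right (norm_nonneg _) t.2.2)

theorem primitive_apply (γ : C(I, E)) (t : I) :
    primitive γ t = ∫ s in (0 : ℝ)..t, extendPath γ s := rfl

theorem norm_primitive_apply_le (γ : C(I, E)) : ‖primitive γ‖ ≤ ‖γ‖ := by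
  rw [ContinuousMap.norm_le _ (norm_nonneg γ)]
  intro t
  refine (intervalIntegral.norm_integral_le_of_norm_le_const
    (fun s _ => norm_extendPath_le γ s)).trans ?_
  rw [sub_zero, abs_of_nonneg t.2.1]
  exact mul_le_of_le_one_right (norm_nonneg γ) t.2.2

theorem hasDerivWithinAt_extendPath [CompleteSpace E] {γ v : C(I, E)} {x : E}
    (h : ∀ t : I, γ t = x + primitive v t) {t : ℝ} (ht : t ∈ Set.Ico (0 : ℝ) 1) :
    HasDerivWithinAt (extendPath γ) (extendPath v t) (Set.Ici t) t := by
  have h1 : HasDerivAt (fun t => x + ∫ s in (0 : ℝ)..t, extendPath v s) (extendPath v t) t :=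
    (intervalIntegral.integral_hasDerivAt_right
      ((continuous_extendPath v).intervalIntegrable _ _)
      ((continuous_extendPath v).stronglyMeasurableAtFilter _ _)
      (continuous_extendPath v).continuousAt).const_add x
  refine h1.hasDerivWithinAt.congr_of_eventuallyEq ?_ ?_
  · filter_upwards [Icc_mem_nhdsGE ht.2] with s hs
    have hs' : s ∈ Set.Icc (0 : ℝ) 1 := ⟨ht.1.trans hs.1, hs.2⟩
    rw [extendPath_of_mem _ hs', h]; rfl
  · have hs' : t ∈ Set.Icc (0 : ℝ) 1 := ⟨ht.1, ht.2.le⟩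
    rw [extendPath_of_mem _ hs', h]; rfl

/-- A quantity whose right derivative vanishes along a path is conserved. -/
theorem eq_of_hasDerivWithinAt_zero {f : ℝ → E} (hf : ContinuousOn f (Set.Icc 0 1))
    (h : ∀ t ∈ Set.Ico (0 : ℝ) 1, HasDerivWithinAt f 0 (Set.Ici t) t) (t : ℝ)
    (ht : t ∈ Set.Icc (0 : ℝ) 1) : f t = f 0 :=
  constant_of_has_deriv_right_zero hf h t ht

/-- Integrals over the unit interval depend smoothly on parameters, and may be differentiated under
the integral sign. -/
theorem contDiff_unitIntegral {P G : Type} [NormedAddCommGroup P] [NormedSpace ℝ P]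
    [NormedAddCommGroup G] [NormedSpace ℝ G] {g : ℝ × P → G} (hg : ContDiff ℝ ∞ g) :
    ContDiff ℝ ∞ (fun p => ∫ s in (0 : ℝ)..1, g (s, p)) ∧
    ∀ p X, fderiv ℝ (fun p => ∫ s in (0 : ℝ)..1, g (s, p)) p X =
      ∫ s in (0 : ℝ)..1, fderiv ℝ g (s, p) (0, X) := by
  let c : P → C(I, ℝ × P) := fun p => ⟨fun t => ((t : ℝ), p), by fun_prop⟩
  let L : P →L[ℝ] C(I, ℝ × P) := LinearMap.mkContinuous
    { toFun := fun p => ⟨fun _ => ((0 : ℝ), p), by fun_prop⟩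
      map_add' := fun _ _ => by ext <;> simp
      map_smul' := fun _ _ => by ext <;> simp } 1
    (fun p => by
      rw [one_mul, ContinuousMap.norm_le _ (norm_nonneg _)]
      intro t; simp)
  have hc : c = fun p => c 0 + L p := by
    funext p; ext t <;> simp [c, L]
  have hcd : ContDiff ℝ ∞ c := by rw [hc]; exact contDiff_const.add L.contDiff
  have hcf : ∀ p, HasFDerivAt c L p := fun p => by
    rw [hc]; exact L.hasFDerivAt.const_add _
  let ev : C(I, G) →L[ℝ] G := ContinuousMap.evalCLM ℝ (1 : I)
  have heq : (fun p => ∫ s in (0 : ℝ)..1, g (s, p)) =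
      fun p => ev (primitive (superpose g hg.continuous (c p))) := by
    funext p
    change _ = ∫ s in (0 : ℝ)..((1 : I) : ℝ), extendPath (superpose g hg.continuous (c p)) s
    refine intervalIntegral.integral_congr fun s hs => ?_
    rw [Set.uIcc_of_le zero_le_one] at hs
    rw [extendPath_of_mem _ hs]; rfl
  refine ⟨?_, fun p X => ?_⟩
  · rw [heq]
    have h1 : ContDiff ℝ ∞ (fun p => superpose g hg.continuous (c p)) :=
      (contDiff_superpose hg).comp hcd
    exact (ev.comp primitive).contDiff.comp h1
  · have hg1 : ContDiff ℝ 1 g := hg.of_le (by simp)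
    have h1 := ev.hasFDerivAt.comp p (primitive.hasFDerivAt.comp p
      ((hasFDerivAt_superpose hg1 (c p)).comp p (hcf p)))
    rw [heq]
    have h2 := congrArg (fun f : P →L[ℝ] G => f X) h1.fderiv
    refine h2.trans ?_
    change ∫ s in (0 : ℝ)..((1 : I) : ℝ), extendPath (pointwiseApply (superpose (fderiv ℝ g)
      (hg1.continuous_fderiv (by simp)) (c p)) (L X)) s = _
    refine intervalIntegral.integral_congr fun s hs => ?_
    replace hs : s ∈ Set.Icc (0 : ℝ) 1 := by rwa [← Set.uIcc_of_le zero_le_one]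
    rw [extendPath_of_mem _ hs]; rfl

end Integral

/-! ### Flows of vector fields with a small Lipschitz constant -/

section Flow

open unitInterval

set_option maxHeartbeats 1000000 in
/-- A smooth vector field whose Lipschitz constant is less than one has a flow over the unit time
interval, which depends smoothly on the initial point. The operator `γ ↦ γ - ∫ W ∘ γ` on the space
of paths is a diffeomorphism, being a Lipschitz small perturbation of the identity, and the flow is
the restriction of its inverse to constant paths. -/
theorem exists_smooth_flow {E : Type} [NormedAddCommGroup E] [NormedSpace ℝ E] [CompleteSpace E]
    {W : E → E} (hW : ContDiff ℝ ∞ W) {k : NNReal} (hk : LipschitzWith k W) (hk1 : k < 1) :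
    ∃ Γ : E → C(I, E), ContDiff ℝ ∞ Γ ∧
      (∀ x t, Γ x t = x + primitive (superpose W hW.continuous (Γ x)) t) ∧
      (∀ x (γ : C(I, E)), (∀ t, γ t = x + primitive (superpose W hW.continuous γ) t) → γ = Γ x) ∧
      (∀ x y, Γ x 1 = Γ y 1 → x = y) ∧
      (∀ x X t, fderiv ℝ Γ x X t = X + primitive (pointwiseApply (superpose (fderiv ℝ W)
        (hW.continuous_fderiv (by simp)) (Γ x)) (fderiv ℝ Γ x X)) t) := by
  set N : C(I, E) → C(I, E) := superpose W hW.continuous with hN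
  set G : C(I, E) → C(I, E) := fun γ => γ - primitive (N γ) with hG
  have hNlip : ∀ a b, ‖N a - N b‖ ≤ k * ‖a - b‖ := by
    intro a b
    rw [ContinuousMap.norm_le _ (by positivity)]
    intro t
    have h1 := hk.norm_sub_le (a t) (b t)
    exact h1.trans (mul_le_mul_of_nonneg_left ((a - b).norm_coe_le_norm t) k.2)
  have hNd : ContDiff ℝ ∞ N := contDiff_superpose hW
  have hGd : ContDiff ℝ ∞ G := contDiff_id.sub
    (((primitive (E := E)).contDiff (n := ∞)).comp hNd)
  have happ : ApproximatesLinearOn G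
      ((ContinuousLinearEquiv.refl ℝ C(I, E) : C(I, E) ≃L[ℝ] C(I, E)) :
        C(I, E) →L[ℝ] C(I, E)) Set.univ k := by
    intro a _ b _
    have : G a - G b - (a - b) = - primitive (N a - N b) := by
      simp only [hG, map_sub]; abel
    simp only [ContinuousLinearEquiv.coe_refl, ContinuousLinearMap.id_apply]
    rw [this, norm_neg]
    exact (norm_primitive_apply_le _).trans (hNlip a b)
  have hc : Subsingleton C(I, E) ∨
      k < ‖((ContinuousLinearEquiv.refl ℝ C(I, E)).symm : C(I, E) →L[ℝ] C(I, E))‖₊⁻¹ := by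
    rcases subsingleton_or_nontrivial C(I, E) with h | h
    · exact Or.inl h
    · right
      have : ‖((ContinuousLinearEquiv.refl ℝ C(I, E)).symm : C(I, E) →L[ℝ] C(I, E))‖₊ = 1 := by
        simp [ContinuousLinearEquiv.refl_symm]
      rw [this]; simpa using hk1
  let H : C(I, E) ≃ₜ C(I, E) := happ.toHomeomorph G hc
  have hHG : ∀ γ, H γ = G γ := fun γ => rfl
  set D : C(I, E) → (C(I, E) →L[ℝ] C(I, E)) := fun γ => primitive.comp
    (pointwiseApply (superpose (fderiv ℝ W) (hW.continuous_fderiv (by simp)) γ)) with hD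
  have hDn : ∀ γ, ‖D γ‖ < 1 := by
    intro γ
    refine lt_of_le_of_lt ?_ (show (k : ℝ) < 1 from hk1)
    refine ContinuousLinearMap.opNorm_le_bound _ k.2 fun h => ?_
    refine (norm_primitive_apply_le _).trans ?_
    refine (ContinuousMap.norm_le _ (mul_nonneg k.2 (norm_nonneg h))).2 fun t => ?_
    exact (ContinuousLinearMap.le_opNorm _ _).trans (mul_le_mul
      (norm_fderiv_le_of_lipschitz ℝ hk) (h.norm_coe_le_norm t) (norm_nonneg _) k.2)
  let e : C(I, E) → (C(I, E) ≃L[ℝ] C(I, E)) := fun γ =>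
    ContinuousLinearEquiv.ofUnit (Units.oneSub (D γ) (hDn γ))
  have he : ∀ γ, HasFDerivAt H (e γ : C(I, E) →L[ℝ] C(I, E)) γ := by
    intro γ
    have h1 : HasFDerivAt N _ γ := hasFDerivAt_superpose (hW.of_le (by simp)) γ
    exact (hasFDerivAt_id γ).sub ((primitive (E := E)).hasFDerivAt.comp γ h1)
  have hHd : ContDiff ℝ ∞ H.symm := H.contDiff_symm he hGd
  let cst : E →L[ℝ] C(I, E) := LinearMap.mkContinuous
    { toFun := fun x => ContinuousMap.const I x
      map_add' := fun _ _ => by ext; simp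
      map_smul' := fun _ _ => by ext; simp } 1
    (fun p => by
      rw [one_mul, ContinuousMap.norm_le _ (norm_nonneg _)]
      intro t; simp)
  have hfix : ∀ x, H.symm (cst x) = cst x + primitive (N (H.symm (cst x))) := by
    intro x
    have h1 : G (H.symm (cst x)) = cst x := H.apply_symm_apply (cst x)
    simp only [hG] at h1
    exact sub_eq_iff_eq_add.1 h1
  have hΓd : ContDiff ℝ ∞ (fun x => H.symm (cst x)) := hHd.comp cst.contDiff
  refine ⟨fun x => H.symm (cst x), hΓd, ?_, ?_, ?_, ?_⟩
  · intro x t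
    exact congrArg (fun γ : C(I, E) => γ t) (hfix x)
  · intro x γ hγ
    have : G γ = cst x := by
      ext t
      simp only [hG, ContinuousMap.sub_apply]
      rw [hγ t]; simp [hN, cst]
    change γ = H.symm (cst x)
    rw [← this, ← hHG, H.symm_apply_apply]
  · intro x y hxy
    set a := H.symm (cst x) with ha
    set b := H.symm (cst y) with hb
    have hax := hfix x
    have hby := hfix y
    rw [← ha] at hax
    rw [← hb] at hby
    have hd : ∀ t : I, (a - b) t = - ∫ s in (t : ℝ)..1, extendPath (N a - N b) s := by
      intro t
      have e1 := congrArg (fun γ : C(I, E) => γ t) hax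
      have e2 := congrArg (fun γ : C(I, E) => γ t) hby
      have e3 := congrArg (fun γ : C(I, E) => γ 1) hax
      have e4 := congrArg (fun γ : C(I, E) => γ 1) hby
      have f1 : a t - b t = x - y + primitive (N a - N b) t := by
        rw [e1, e2]; simp [cst]; abel
      have f2 : (0 : E) = x - y + primitive (N a - N b) 1 := by
        rw [← sub_eq_zero.2 hxy, e3, e4]; simp [cst]; abel
      rw [primitive_apply] at f1 f2
      have hadd := intervalIntegral.integral_add_adjacent_intervals
        ((continuous_extendPath (N a - N b)).intervalIntegrable (μ := MeasureTheory.volume) 0 t)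
        ((continuous_extendPath (N a - N b)).intervalIntegrable (μ := MeasureTheory.volume) t 1)
      have f3 : ((1 : I) : ℝ) = 1 := rfl
      rw [f3, ← hadd, ← add_assoc, ← f1] at f2
      rw [ContinuousMap.sub_apply]
      exact eq_neg_of_add_eq_zero_left f2.symm
    have hn : ‖a - b‖ ≤ k * ‖a - b‖ := by
      refine (ContinuousMap.norm_le _ (by positivity)).2 fun t => ?_
      rw [hd t, norm_neg]
      refine (intervalIntegral.norm_integral_le_of_norm_le_const
        (fun s _ => norm_extendPath_le (N a - N b) s)).trans ?_
      have h1 : |1 - (t : ℝ)| ≤ 1 := by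
        rw [abs_of_nonneg (by linarith [t.2.2])]; linarith [t.2.1]
      calc ‖N a - N b‖ * |1 - (t : ℝ)| ≤ ‖N a - N b‖ * 1 :=
            mul_le_mul_of_nonneg_left h1 (norm_nonneg _)
        _ ≤ k * ‖a - b‖ := by rw [mul_one]; exact hNlip a b
    have h0 : ‖a - b‖ = 0 := by
      have hk1' : (k : ℝ) < 1 := hk1
      nlinarith [norm_nonneg (a - b)]
    have hab : cst x = cst y := H.symm.injective (sub_eq_zero.1 (norm_eq_zero.1 h0))
    exact congrArg (fun γ : C(I, E) => γ 0) hab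
  · intro x X t
    have h1 : HasFDerivAt (fun x => H.symm (cst x)) _ x :=
      (hΓd.differentiable (by simp) x).hasFDerivAt
    have h2 := cst.hasFDerivAt (x := x) |>.add ((primitive (E := E)).hasFDerivAt.comp x
      ((hasFDerivAt_superpose (hW.of_le (by simp)) (H.symm (cst x))).comp x h1))
    have h3 : (fun x => H.symm (cst x)) = fun x => cst x + primitive (N (H.symm (cst x))) :=
      funext hfix
    have h4 := h1
    rw [h3] at h4
    have h5 := congrArg (fun f : E →L[ℝ] C(I, E) => f X t) (h4.unique h2)
    rw [← h3] at h5
    exact h5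

end Flow

/-! ### Even functions of the norm -/

theorem hasDerivAt_of_smooth {h : ℝ → ℝ} (hh : ContDiff ℝ ∞ h) (t : ℝ) :
    HasDerivAt h (deriv h t) t := (hh.differentiable (by simp) t).hasDerivAt

theorem contDiff_deriv_of_smooth {h : ℝ → ℝ} (hh : ContDiff ℝ ∞ h) : ContDiff ℝ ∞ (deriv h) :=
  (contDiff_infty_iff_deriv.1 hh).2

theorem deriv_even_of_odd {h : ℝ → ℝ} (hodd : ∀ t, h (-t) = - h t) (t : ℝ) :
    deriv h (-t) = deriv h t := by
  have h1 : (fun t => h (-t)) = fun t => - h t := funext hodd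
  have h2 := congrArg (fun f => deriv f t) h1
  simp only [deriv_comp_neg, deriv.fun_neg, neg_inj] at h2
  exact h2

theorem deriv_odd_of_even {h : ℝ → ℝ} (heven : ∀ t, h (-t) = h t) (t : ℝ) :
    deriv h (-t) = - deriv h t := by
  have h1 : (fun t => h (-t)) = fun t => h t := funext heven
  have h2 := congrArg (fun f => deriv f t) h1
  simp only [deriv_comp_neg] at h2
  linarith

/-- Hadamard's lemma for odd functions: the quotient by the coordinate is smooth and even. -/
theorem exists_smooth_even_quotient {h : ℝ → ℝ} (hh : ContDiff ℝ ∞ h)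
    (hodd : ∀ t, h (-t) = - h t) :
    ∃ k : ℝ → ℝ, ContDiff ℝ ∞ k ∧ (∀ t, k (-t) = k t) ∧ ∀ t, h t = t * k t := by
  have hd := contDiff_deriv_of_smooth hh
  refine ⟨fun t => ∫ s in (0 : ℝ)..1, deriv h (s * t), ?_, ?_, ?_⟩
  · exact (contDiff_unitIntegral (g := fun q : ℝ × ℝ => deriv h (q.1 * q.2))
      (hd.comp (contDiff_fst.mul contDiff_snd))).1
  · intro t
    simp only [mul_neg, deriv_even_of_odd hodd]
  · intro t
    have h0 : h 0 = 0 := by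
      have := hodd 0
      simp only [neg_zero] at this
      linarith
    have hder : ∀ s ∈ Set.uIcc (0 : ℝ) 1, HasDerivAt (fun s => h (s * t)) (t * deriv h (s * t)) s := by
      intro s _
      refine ((hasDerivAt_of_smooth hh (s * t)).comp s ((hasDerivAt_id s).mul_const t)).congr_deriv ?_
      ring
    have hint := intervalIntegral.integral_eq_sub_of_hasDerivAt hder
      (Continuous.intervalIntegrable (by
        have := hd.continuous
        fun_prop) _ _)
    rw [intervalIntegral.integral_const_mul] at hint
    rw [hint]; simp [h0]

section Radial

variable {E : Type} [NormedAddCommGroup E] [InnerProductSpace ℝ E]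

theorem hasFDerivAt_radial_of_ne {q : ℝ → ℝ} {q' : ℝ} {μ : E} (hμ : μ ≠ 0)
    (hq : HasDerivAt q q' ‖μ‖) :
    HasFDerivAt (fun μ : E => q ‖μ‖) ((q' / ‖μ‖) • innerSL ℝ μ) μ := by
  have h1 := (hasStrictFDerivAt_norm_sq μ).hasFDerivAt
  have hpos : 0 < ‖μ‖ := norm_pos_iff.2 hμ
  have h2 := h1.sqrt (by positivity)
  simp only [Real.sqrt_sq (norm_nonneg _)] at h2
  refine (hq.comp_hasFDerivAt μ h2).congr_fderiv ?_
  ext x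
  simp
  field_simp

theorem hasFDerivAt_radial {k k1 : ℝ → ℝ} (hk : ContDiff ℝ ∞ k) (hk1 : ∀ t, deriv k t = t * k1 t)
    (μ : E) : HasFDerivAt (fun μ : E => k ‖μ‖) (k1 ‖μ‖ • innerSL ℝ μ) μ := by
  by_cases hμ : μ = 0
  · subst hμ
    have h1 := hasDerivAt_of_smooth hk 0
    rw [hk1, zero_mul, hasDerivAt_iff_isLittleO_nhds_zero] at h1
    simp only [map_zero, smul_zero]
    rw [hasFDerivAt_iff_isLittleO_nhds_zero]
    have h2 : Filter.Tendsto (fun x : E => ‖x‖) (nhds 0) (nhds 0) := by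
      simpa using (continuous_norm (E := E)).tendsto 0
    have h3 := (h1.comp_tendsto h2)
    simp only [Function.comp_def, zero_add, smul_zero, sub_zero] at h3
    simpa using h3.of_norm_right
  · refine (hasFDerivAt_radial_of_ne hμ (hasDerivAt_of_smooth hk _)).congr_fderiv ?_
    rw [hk1, mul_div_cancel_left₀ _ (norm_ne_zero_iff.2 hμ)]

/-- A smooth even function of the norm is smooth. -/
theorem contDiff_radial {k : ℝ → ℝ} (hk : ContDiff ℝ ∞ k) (heven : ∀ t, k (-t) = k t) :
    ContDiff ℝ ∞ (fun μ : E => k ‖μ‖) := by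
  refine contDiff_infty.2 fun n => ?_
  induction n generalizing k with
  | zero => exact contDiff_zero.2 (hk.continuous.comp continuous_norm)
  | succ n ih =>
    obtain ⟨k1, hk1, hk1e, hk1d⟩ := exists_smooth_even_quotient (contDiff_deriv_of_smooth hk)
      (deriv_odd_of_even heven)
    rw [Nat.cast_add, Nat.cast_one, contDiff_succ_iff_fderiv]
    refine ⟨fun μ => (hasFDerivAt_radial hk hk1d μ).differentiableAt, by simp, ?_⟩
    have : fderiv ℝ (fun μ : E => k ‖μ‖) = fun μ => k1 ‖μ‖ • innerSL ℝ μ := by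
      funext μ
      exact (hasFDerivAt_radial hk hk1d μ).fderiv
    rw [this]
    exact (ih hk1 hk1e).smul (innerSL ℝ).contDiff

/-- The derivative of a radially scaled position field is symmetric. -/
theorem fderiv_radial_smul_symmetric {c : E → ℝ} {κ : ℝ} {μ : E}
    (hc : HasFDerivAt c (κ • innerSL ℝ μ) μ) (a b : E) :
    (inner ℝ (fderiv ℝ (fun μ => c μ • μ) μ a) b : ℝ) =
      inner ℝ a (fderiv ℝ (fun μ => c μ • μ) μ b) := by
  have h : HasFDerivAt (fun μ => c μ • μ) _ μ := hc.smul (hasFDerivAt_id μ)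
  rw [h.fderiv]
  simp [inner_add_left, inner_add_right, inner_smul_left, inner_smul_right]
  rw [real_inner_comm a μ]
  ring

end Radial

/-! ### The model twist as a rotation -/

theorem norm_moment_pos {s : ℝ} {p : Ambient} (hp : p ∈ cotangentBundle) (h : p.1 ≠ 0 ∨ s ≠ 0) :
    moment s p ≠ 0 := by
  intro h0
  have := norm_moment_sq s hp
  rw [h0, norm_zero] at this
  rcases h with h | h
  · have := norm_pos_iff.2 h
    nlinarith [sq_nonneg s]
  · have := sq_pos_of_ne_zero h
    nlinarith [sq_nonneg ‖p.1‖]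

theorem norm_le_norm_moment (s : ℝ) {p : Ambient} (hp : p ∈ cotangentBundle) :
    ‖p.1‖ ≤ ‖moment s p‖ := by
  have := norm_moment_sq s hp
  exact le_of_sq_le_sq (by nlinarith [sq_nonneg s]) (norm_nonneg _)

theorem norm_moment_zero {p : Ambient} (hp : p ∈ cotangentBundle) : ‖moment 0 p‖ = ‖p.1‖ := by
  have := norm_moment_sq 0 hp
  rw [zero_pow two_ne_zero, add_zero] at this
  exact (sq_eq_sq₀ (norm_nonneg _) (norm_nonneg _)).1 this

/-- The normalized geodesic flow rotates about the normalized angular momentum. -/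
theorem geodesicFlow_eq_rotPair {p : Ambient} (hp : p ∈ cotangentBundle) (hu : p.1 ≠ 0) (θ : ℝ) :
    geodesicFlow θ p = rotPair ((-(θ / ‖p.1‖)) • moment 0 p) p := by
  have hρ : ‖p.1‖ ≠ 0 := norm_ne_zero_iff.2 hu
  set n : R3 := (‖p.1‖⁻¹) • crossL p.1 p.2 with hn
  have hm : moment 0 p = crossL p.1 p.2 := by simp [moment]
  have hn1 : ‖n‖ = 1 := by
    rw [hn, norm_smul, ← hm, norm_moment_zero hp, norm_inv, norm_norm, inv_mul_cancel₀ hρ]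
  have hax : (-(θ / ‖p.1‖)) • moment 0 p = (-θ) • n := by
    rw [hm, hn, smul_smul]; congr 1; ring
  have hnu : crossL n p.1 = ‖p.1‖ • p.2 := by
    rw [hn, map_smul, smul_apply, crossL_anticomm, crossL_crossL, hp.1,
      real_inner_self_eq_norm_sq, zero_smul, zero_sub, neg_neg, smul_smul]
    congr 1; field_simp
  have hnv : crossL n p.2 = -(‖p.1‖⁻¹ • p.1) := by
    rw [hn, map_smul, smul_apply, crossL_anticomm, crossL_crossL,
      real_inner_self_eq_norm_sq, hp.2, real_inner_comm, hp.1]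
    simp
  have hou : (inner ℝ n p.1 : ℝ) = 0 := by
    rw [hn, inner_smul_left, inner_crossL_self_left, mul_zero]
  have hov : (inner ℝ n p.2 : ℝ) = 0 := by
    rw [hn, inner_smul_left, inner_crossL_self_right, mul_zero]
  rw [hax, rotPair, rot_smul_orthogonal hn1 hou, rot_smul_orthogonal hn1 hov, hnu, hnv,
    geodesicFlow]
  refine Prod.ext ?_ ?_
  · simp [smul_smul, sub_eq_add_neg]
  · simp [smul_smul, div_eq_mul_inv]

theorem geodesicFlow_two {p : Ambient} (hp : p ∈ cotangentBundle) (hu : p.1 ≠ 0) (θ : ℝ) :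
    geodesicFlow θ (geodesicFlow θ p) = rotPair ((-(2 * θ / ‖p.1‖)) • moment 0 p) p := by
  have hq : geodesicFlow θ p ∈ cotangentBundle := by
    rw [geodesicFlow_eq_rotPair hp hu]; exact rotPair_mem_cotangentBundle hp
  have hn : ‖(geodesicFlow θ p).1‖ = ‖p.1‖ := by
    rw [geodesicFlow_eq_rotPair hp hu]; simp [rotPair]
  have hqu : (geodesicFlow θ p).1 ≠ 0 := by
    rw [← norm_ne_zero_iff, hn]; exact norm_ne_zero_iff.2 hu
  rw [geodesicFlow_eq_rotPair hq hqu, hn, geodesicFlow_eq_rotPair hp hu, moment_rotPair,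
    rot_of_crossL_eq_zero (x := moment 0 p) (by simp)]
  have h2 : (-(2 * θ / ‖p.1‖)) • moment 0 p =
      (-(θ / ‖p.1‖) + -(θ / ‖p.1‖)) • moment 0 p := by congr 1; ring
  rw [h2]
  simp only [rotPair, rot_add_smul]

theorem rotPair_sub_two_pi (a : ℝ) {m : R3} (hm : m ≠ 0) (p : Ambient) :
    rotPair ((a + 2 * Real.pi / ‖m‖) • m) p = rotPair (a • m) p := by
  have h1 : ∀ x, rot ((2 * Real.pi / ‖m‖) • m) x = x := fun x => by
    have : (2 * Real.pi / ‖m‖) • m = (2 * Real.pi) • (‖m‖⁻¹ • m) := by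
      rw [smul_smul, div_eq_mul_inv]
    rw [this]
    refine rot_two_pi ?_ x
    rw [norm_smul, norm_inv, norm_norm, inv_mul_cancel₀ (norm_ne_zero_iff.2 hm)]
  simp only [rotPair, rot_add_smul, h1]

namespace IsTwistProfile

variable {lam : ℝ} {r : ℝ → ℝ}

theorem deriv_eq_zero (hr : IsTwistProfile lam r) {t : ℝ} (ht : lam / 2 ≤ t) : deriv r t = 0 := by
  have h1 : HasDerivWithinAt r (deriv r t) (Set.Ici t) t :=
    (hasDerivAt_of_smooth hr.smooth t).hasDerivWithinAt
  have h2 : HasDerivWithinAt r 0 (Set.Ici t) t :=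
    (hasDerivWithinAt_const t (Set.Ici t) (0 : ℝ)).congr
      (fun x hx => hr.vanish x (ht.trans hx)) (hr.vanish t ht)
  exact (uniqueDiffWithinAt_Ici t).eq_deriv _ h1 h2

/-- The factor `k` with `2 r' t - 1 = t * k t`. -/
theorem exists_factor (hr : IsTwistProfile lam r) :
    ∃ k : ℝ → ℝ, ContDiff ℝ ∞ k ∧ (∀ t, k (-t) = k t) ∧ ∀ t, 2 * deriv r t - 1 = t * k t := by
  refine exists_smooth_even_quotient (h := fun t => 2 * deriv r t - 1)
    ((contDiff_const.mul (contDiff_deriv_of_smooth hr.smooth)).sub contDiff_const) fun t => ?_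
  have h1 : (fun t => r (-t)) = fun t => r t - t := funext hr.reflect
  have h2 := congrArg (fun f => deriv f t) h1
  simp only [deriv_comp_neg] at h2
  have h3 : HasDerivAt (fun t => r t - t) _ t :=
    (hasDerivAt_of_smooth hr.smooth t).sub (hasDerivAt_id t)
  rw [h3.deriv] at h2
  linarith

end IsTwistProfile

/-- The rotation field of the squared twist. -/
def sqField (k : ℝ → ℝ) (m : R3) : R3 := (-(2 * Real.pi * k ‖m‖)) • m

/-- The rotation field of the isotopy from the identity to the squared twist. -/
def isoField (r : ℝ → ℝ) (t : ℝ) (m : R3) : R3 := (-(t * (4 * Real.pi * deriv r ‖m‖ / ‖m‖))) • m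

section Fields

variable {lam : ℝ} {r k : ℝ → ℝ}

theorem contDiff_sqField (hk : ContDiff ℝ ∞ k) (heven : ∀ t, k (-t) = k t) :
    ContDiff ℝ ∞ (sqField k) :=
  ((contDiff_const.mul (contDiff_radial hk heven)).neg).smul contDiff_id

theorem sqField_symmetric (hk : ContDiff ℝ ∞ k) (heven : ∀ t, k (-t) = k t) (μ a b : R3) :
    (inner ℝ (fderiv ℝ (sqField k) μ a) b : ℝ) = inner ℝ a (fderiv ℝ (sqField k) μ b) := by
  obtain ⟨k1, -, -, hk1d⟩ := exists_smooth_even_quotient (contDiff_deriv_of_smooth hk)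
      (deriv_odd_of_even heven)
  have h1 := ((hasFDerivAt_radial hk hk1d μ).const_mul (2 * Real.pi)).neg
  rw [smul_smul, ← neg_smul] at h1
  exact fderiv_radial_smul_symmetric h1 a b

theorem contDiffAt_isoField (hr : ContDiff ℝ ∞ r) (t : ℝ) {m : R3} (hm : m ≠ 0) :
    ContDiffAt ℝ ∞ (fun q : ℝ × R3 => isoField r q.1 q.2) (t, m) := by
  unfold isoField
  have hn : ContDiffAt ℝ ∞ (fun q : ℝ × R3 => ‖q.2‖) (t, m) :=
    contDiffAt_snd.norm ℝ (by simpa using hm)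
  have hd : ContDiffAt ℝ ∞ (fun q : ℝ × R3 => deriv r ‖q.2‖) (t, m) :=
    ContDiffAt.comp (g := deriv r) (f := fun q : ℝ × R3 => ‖q.2‖) (t, m)
      (contDiff_deriv_of_smooth hr).contDiffAt hn
  exact ((contDiffAt_fst.mul ((contDiffAt_const.mul hd).div hn (by simpa using hm))).neg).smul
    contDiffAt_snd

theorem isoField_symmetric (hr : ContDiff ℝ ∞ r) (t : ℝ) {μ : R3} (hμ : μ ≠ 0) (a b : R3) :
    (inner ℝ (fderiv ℝ (isoField r t) μ a) b : ℝ) = inner ℝ a (fderiv ℝ (isoField r t) μ b) := by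
  have hq : DifferentiableAt ℝ (fun ρ : ℝ => -(t * (4 * Real.pi * deriv r ρ / ρ))) ‖μ‖ := by
    have h1 : DifferentiableAt ℝ (deriv r) ‖μ‖ :=
      (contDiff_deriv_of_smooth hr).differentiable (by simp) _
    have h2 : ‖μ‖ ≠ 0 := norm_ne_zero_iff.2 hμ
    fun_prop (disch := assumption)
  exact fderiv_radial_smul_symmetric (hasFDerivAt_radial_of_ne hμ hq.hasDerivAt) a b

theorem rotPair_sqField_eq_isoField (hkr : ∀ t, 2 * deriv r t - 1 = t * k t) {m : R3} (hm : m ≠ 0)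
    (p : Ambient) : rotPair (sqField k m) p = rotPair (isoField r 1 m) p := by
  have hρ : ‖m‖ ≠ 0 := norm_ne_zero_iff.2 hm
  rw [isoField, ← rotPair_sub_two_pi _ hm, sqField]
  congr 2
  have := hkr ‖m‖
  field_simp
  linear_combination 2 * this

theorem isoField_eq_zero (hr : IsTwistProfile lam r) (t : ℝ) {m : R3} (hm : lam / 2 ≤ ‖m‖) :
    isoField r t m = 0 := by
  simp [isoField, hr.deriv_eq_zero hm]

theorem rotPair_zero (p : Ambient) : rotPair 0 p = p := by simp [rotPair]

/-- The square of the model twist in terms of rotations. -/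
theorem modelTwist_modelTwist (hkr : ∀ t, 2 * deriv r t - 1 = t * k t) {p : Ambient}
    (hp : p ∈ cotangentBundle) :
    modelTwist r (modelTwist r p) = rotPair (sqField k (moment 0 p)) p := by
  by_cases hu : p.1 = 0
  · have h1 : p = (0, p.2) := Prod.ext hu rfl
    rw [h1]
    simp [modelTwist, moment, sqField, rotPair]
  · have h1 : modelTwist r p = geodesicFlow (2 * Real.pi * deriv r ‖p.1‖) p := by
      simp [modelTwist, hu]
    have hn : ‖(modelTwist r p).1‖ = ‖p.1‖ := by
      rw [h1, geodesicFlow_eq_rotPair hp hu]; simp [rotPair]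
    have hu2 : (modelTwist r p).1 ≠ 0 := by
      rw [← norm_ne_zero_iff, hn]; exact norm_ne_zero_iff.2 hu
    have h2 : modelTwist r (modelTwist r p) =
        geodesicFlow (2 * Real.pi * deriv r ‖p.1‖) (modelTwist r p) := by
      conv_lhs => rw [modelTwist]
      rw [if_neg hu2, hn]
    rw [h2, h1, geodesicFlow_two hp hu,
      rotPair_sqField_eq_isoField hkr (norm_moment_pos hp (Or.inl hu)), isoField,
      norm_moment_zero hp]
    congr 3
    ring

end Fields

/-! ### Two-forms and bilinear maps -/

section Forms

variable {E F : Type*} [NormedAddCommGroup E] [NormedSpace ℝ E]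
  [NormedAddCommGroup F] [NormedSpace ℝ F]

theorem form_ext {σ σ' : E [⋀^Fin 2]→L[ℝ] ℝ} (h : ∀ x y, σ ![x, y] = σ' ![x, y]) : σ = σ' := by
  ext v
  have : v = ![v 0, v 1] := by
    funext i; fin_cases i <;> rfl
  rw [this]; exact h _ _

/-- The alternating form `(x, y) ↦ B x y - B y x`. -/
def altForm : (E →L[ℝ] E →L[ℝ] ℝ) →L[ℝ] (E [⋀^Fin 2]→L[ℝ] ℝ) :=
  (ContinuousAlternatingMap.alternatizeUncurryFinCLM ℝ E ℝ (n := 1)).comp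
    (ContinuousLinearMap.compL ℝ E (E →L[ℝ] ℝ) (E [⋀^Fin 1]→L[ℝ] ℝ)
      (ContinuousAlternatingMap.ofSubsingletonLIE (𝕜 := ℝ) (E := E) (F := ℝ)
        (0 : Fin 1)).toContinuousLinearEquiv.toContinuousLinearMap)

theorem altForm_apply (B : E →L[ℝ] E →L[ℝ] ℝ) (x y : E) : altForm B ![x, y] = B x y - B y x := by
  change ContinuousAlternatingMap.alternatizeUncurryFin _ ![x, y] = _
  rw [ContinuousAlternatingMap.alternatizeUncurryFin_apply, Fin.sum_univ_two]
  simp [Fin.removeNth, sub_eq_add_neg]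

/-- The bilinear map underlying a two-form. -/
def toBilin : (E [⋀^Fin 2]→L[ℝ] ℝ) →L[ℝ] (E →L[ℝ] E →L[ℝ] ℝ) :=
  (ContinuousLinearMap.compL ℝ E (E [⋀^Fin 1]→L[ℝ] ℝ) (E →L[ℝ] ℝ)
    (ContinuousAlternatingMap.ofSubsingletonLIE (𝕜 := ℝ) (E := E) (F := ℝ)
        (0 : Fin 1)).symm.toContinuousLinearEquiv.toContinuousLinearMap).comp
    (ContinuousAlternatingMap.curryLeftLI (𝕜 := ℝ) (E := E) (F := ℝ) (n := 1)).toContinuousLinearMap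

theorem toBilin_apply (σ : E [⋀^Fin 2]→L[ℝ] ℝ) (x y : E) : toBilin σ x y = σ ![x, y] := by
  change σ (Matrix.vecCons x (fun _ => y)) = _
  congr 1
  funext i; fin_cases i <;> rfl

theorem form_swap (σ : E [⋀^Fin 2]→L[ℝ] ℝ) (x y : E) : σ ![x, y] = - σ ![y, x] := by
  have h := σ.map_swap ![y, x] (i := 0) (j := 1) (by decide)
  change σ (![y, x] ∘ Equiv.swap 0 1) = -σ ![y, x] at h
  rw [← h]
  congr 1
  funext i; fin_cases i <;> rfl

theorem form_self (σ : E [⋀^Fin 2]→L[ℝ] ℝ) (x : E) : σ ![x, x] = 0 := by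
  have := form_swap σ x x
  linarith

theorem eq_altForm_toBilin (σ : E [⋀^Fin 2]→L[ℝ] ℝ) : σ = (1 / 2 : ℝ) • altForm (toBilin σ) := by
  refine form_ext fun x y => ?_
  rw [ContinuousAlternatingMap.smul_apply, altForm_apply, toBilin_apply, toBilin_apply, form_swap σ y x]
  simp
  ring

theorem compContinuousLinearMap_apply_pair (σ : F [⋀^Fin 2]→L[ℝ] ℝ) (L : E →L[ℝ] F) (x y : E) :
    σ.compContinuousLinearMap L ![x, y] = σ ![L x, L y] := by
  rw [ContinuousAlternatingMap.compContinuousLinearMap_apply]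
  congr 1
  funext i; fin_cases i <;> rfl

/-- A family of two-forms on a finite-dimensional space is smooth as soon as its values on pairs of
fixed vectors are. -/
theorem contDiffWithinAt_form [FiniteDimensional ℝ E] {n : WithTop ℕ∞} {σ : F → E [⋀^Fin 2]→L[ℝ] ℝ}
    {s : Set F} {p : F} (h : ∀ x y, ContDiffWithinAt ℝ n (fun p => σ p ![x, y]) s p) :
    ContDiffWithinAt ℝ n σ s p := by
  let b := Module.finBasis ℝ E
  let c : Fin (Module.finrank ℝ E) → E →L[ℝ] ℝ := fun i => LinearMap.toContinuousLinearMap (b.coord i)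
  have key : σ = fun p => ∑ i, ∑ j, σ p ![b i, b j] •
      ((1 / 2 : ℝ) • altForm ((c i).smulRight (c j))) := by
    funext p
    conv_lhs => rw [eq_altForm_toBilin (σ p)]
    have hB : toBilin (σ p) = ∑ i, ∑ j, σ p ![b i, b j] • (c i).smulRight (c j) := by
      ext x y
      have hx := b.sum_repr x
      have hy := b.sum_repr y
      conv_lhs => rw [← hx, ← hy]
      simp only [map_sum, map_smul, sum_apply, smul_apply, smul_eq_mul,
        ContinuousLinearMap.smulRight_apply, toBilin_apply, Finset.mul_sum]
      rw [Finset.sum_comm]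
      refine Finset.sum_congr rfl fun i _ => Finset.sum_congr rfl fun j _ => ?_
      simp [c]
      ring
    rw [hB]
    simp only [map_sum, map_smul, Finset.smul_sum]
    refine Finset.sum_congr rfl fun i _ => Finset.sum_congr rfl fun j _ => ?_
    rw [smul_comm]
  rw [key]
  exact ContDiffWithinAt.sum fun i _ => ContDiffWithinAt.sum fun j _ =>
    (h (b i) (b j)).smul contDiffWithinAt_const

theorem contDiffAt_form [FiniteDimensional ℝ E] {n : WithTop ℕ∞} {σ : F → E [⋀^Fin 2]→L[ℝ] ℝ}
    {p : F} (h : ∀ x y, ContDiffAt ℝ n (fun p => σ p ![x, y]) p) : ContDiffAt ℝ n σ p :=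
  contDiffWithinAt_univ.1 (contDiffWithinAt_form fun x y => (h x y).contDiffWithinAt)

theorem extDeriv_two_apply {σ : E → E [⋀^Fin 2]→L[ℝ] ℝ} {p : E} (h : DifferentiableAt ℝ σ p)
    (a b c : E) : extDeriv σ p ![a, b, c] = fderiv ℝ (fun p => σ p ![b, c]) p a -
      fderiv ℝ (fun p => σ p ![a, c]) p b + fderiv ℝ (fun p => σ p ![a, b]) p c := by
  rw [extDeriv_apply h, Fin.sum_univ_three]
  have h0 : (0 : Fin 3).removeNth ![a, b, c] = ![b, c] := by
    funext i; fin_cases i <;> rfl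
  have h1 : (1 : Fin 3).removeNth ![a, b, c] = ![a, c] := by
    funext i; fin_cases i <;> rfl
  have h2 : (2 : Fin 3).removeNth ![a, b, c] = ![a, b] := by
    funext i; fin_cases i <;> rfl
  rw [h0, h1, h2]
  simp
  ring

/-- The exterior derivative of a one-form, given as a family of linear functionals. -/
def extDerivOne (θ : E → E →L[ℝ] ℝ) : E → E [⋀^Fin 2]→L[ℝ] ℝ :=
  extDeriv fun p => ContinuousAlternatingMap.ofSubsingletonLIE (𝕜 := ℝ) (E := E) (F := ℝ)
        (0 : Fin 1) (θ p)

theorem extDerivOne_eq {θ : E → E →L[ℝ] ℝ} {p : E} (h : DifferentiableAt ℝ θ p) :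
    extDerivOne θ p = altForm (fderiv ℝ θ p) := by
  unfold extDerivOne extDeriv
  have := ((ContinuousAlternatingMap.ofSubsingletonLIE (𝕜 := ℝ) (E := E) (F := ℝ)
        (0 : Fin 1)).toContinuousLinearEquiv.toContinuousLinearMap.hasFDerivAt.comp p
          h.hasFDerivAt).fderiv
  refine (congrArg _ this).trans ?_
  rfl

theorem extDerivOne_apply {θ : E → E →L[ℝ] ℝ} {p : E} (h : DifferentiableAt ℝ θ p) (x y : E) :
    extDerivOne θ p ![x, y] = fderiv ℝ (fun p => θ p y) p x - fderiv ℝ (fun p => θ p x) p y := by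
  rw [extDerivOne_eq h, altForm_apply]
  have hx : ∀ z, fderiv ℝ (fun p => θ p z) p = (fderiv ℝ θ p).flip z := fun z => by
    have := (h.hasFDerivAt.clm_apply (hasFDerivAt_const z p)).fderiv
    rw [this]; ext; simp
  rw [hx, hx]
  simp

theorem extDeriv_extDerivOne {θ : E → E →L[ℝ] ℝ} {p : E} (h : ContDiffAt ℝ ∞ θ p) :
    extDeriv (extDerivOne θ) p = 0 :=
  extDeriv_extDeriv_apply (r := ∞)
    ((ContinuousAlternatingMap.ofSubsingletonLIE (𝕜 := ℝ) (E := E) (F := ℝ)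
      (0 : Fin 1)).toContinuousLinearEquiv.contDiff.contDiffAt.comp p h)
    (by rw [minSmoothness_of_isRCLikeNormedField]; exact two_le_infty)

theorem contDiff_extDerivOne {θ : E → E →L[ℝ] ℝ} (h : ContDiff ℝ ∞ θ) :
    ContDiff ℝ ∞ (extDerivOne θ) := by
  have : extDerivOne θ = fun p => altForm (fderiv ℝ θ p) :=
    funext fun p => extDerivOne_eq (h.differentiable (by simp) p)
  rw [this]
  exact altForm.contDiff.comp (h.fderiv_right (m := ∞) (by simp))

end Forms

/-! ### A closed two-form near the zero-section which is positive on it -/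

/-- The pullback of the area form of the sphere to its cotangent bundle, extended to the ambient
space as `(X, Y) ↦ det (v, X₂, Y₂)`. -/
def baseForm (p : Ambient) : Ambient [⋀^Fin 2]→L[ℝ] ℝ :=
  (1 / 2 : ℝ) • altForm ((ContinuousLinearMap.compL ℝ R3 R3 ℝ (innerSL ℝ p.2) ∘L crossL).bilinearComp
    (ContinuousLinearMap.snd ℝ R3 R3) (ContinuousLinearMap.snd ℝ R3 R3))

theorem baseForm_apply (p X Y : Ambient) : baseForm p ![X, Y] = inner ℝ p.2 (crossL X.2 Y.2) := by
  rw [baseForm, ContinuousAlternatingMap.smul_apply, altForm_apply]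
  simp only [ContinuousLinearMap.bilinearComp_apply, ContinuousLinearMap.comp_apply,
    ContinuousLinearMap.compL_apply, ContinuousLinearMap.coe_snd', innerSL_apply_apply]
  rw [crossL_anticomm Y.2, inner_neg_right, smul_eq_mul]
  ring

theorem contDiff_baseForm : ContDiff ℝ ∞ baseForm := by
  rw [contDiff_iff_contDiffAt]
  refine fun p => contDiffAt_form fun x y => ?_
  simp only [baseForm_apply]
  exact contDiffAt_snd.inner ℝ contDiffAt_const

/-- Three vectors orthogonal to a common nonzero vector have vanishing triple product. -/
theorem triple_product_eq_zero {v a b c : R3} (hv : ‖v‖ = 1) (ha : (inner ℝ v a : ℝ) = 0)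
    (hb : (inner ℝ v b : ℝ) = 0) (hc : (inner ℝ v c : ℝ) = 0) :
    (inner ℝ a (crossL b c) : ℝ) = 0 := by
  have h1 : crossL v (crossL b c) = 0 := by rw [crossL_crossL, hb, hc]; simp
  have h2 := crossL_crossL v v (crossL b c)
  rw [h1, map_zero, real_inner_self_eq_norm_sq, hv] at h2
  have h3 : crossL b c = (inner ℝ v (crossL b c) : ℝ) • v := by
    rw [one_pow, one_smul] at h2
    exact (sub_eq_zero.1 h2.symm).symm
  rw [h3, inner_smul_right, real_inner_comm v a, ha, mul_zero]

theorem extDeriv_baseForm {p X Y Z : Ambient} (hp : ‖p.2‖ = 1) (hX : inner ℝ p.2 X.2 = (0 : ℝ))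
    (hY : inner ℝ p.2 Y.2 = (0 : ℝ)) (hZ : inner ℝ p.2 Z.2 = (0 : ℝ)) :
    extDeriv baseForm p ![X, Y, Z] = 0 := by
  have hd : ∀ (w : R3) (A : Ambient), fderiv ℝ (fun p : Ambient => (inner ℝ p.2 w : ℝ)) p A =
      inner ℝ A.2 w := by
    intro w A
    have := ((hasFDerivAt_snd (𝕜 := ℝ) (E := R3) (F := R3) (p := p)).inner ℝ
      (hasFDerivAt_const w p)).fderiv
    rw [this]; simp [real_inner_comm]
  rw [extDeriv_two_apply (contDiff_baseForm.differentiable (by simp) p)]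
  simp only [baseForm_apply, hd]
  rw [triple_product_eq_zero hp hX hY hZ, triple_product_eq_zero hp hY hX hZ,
    triple_product_eq_zero hp hZ hX hY]
  ring

/-- The connection form of the unit cotangent bundle, scaled by a function of the length. -/
def connForm (g : ℝ → ℝ) (p : Ambient) : Ambient →L[ℝ] ℝ :=
  g (‖p.1‖ ^ 2) • (innerSL ℝ (crossL p.2 p.1)).comp (ContinuousLinearMap.fst ℝ R3 R3)

theorem connForm_apply (g : ℝ → ℝ) (p X : Ambient) :
    connForm g p X = g (‖p.1‖ ^ 2) * inner ℝ (crossL p.2 p.1) X.1 := by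
  simp [connForm]

theorem contDiff_connForm {g : ℝ → ℝ} (hg : ContDiff ℝ ∞ g) : ContDiff ℝ ∞ (connForm g) := by
  rw [contDiff_clm_apply_iff]
  intro X
  simp only [connForm_apply]
  have h1 : ContDiff ℝ ∞ (fun p : Ambient => crossL p.2 p.1) :=
    (crossL.contDiff.comp contDiff_snd).clm_apply contDiff_fst
  exact (hg.comp (contDiff_fst.norm_sq ℝ)).mul (h1.inner ℝ contDiff_const)

theorem fderiv_connForm {g : ℝ → ℝ} (hg : ContDiff ℝ ∞ g) (p X Y : Ambient) :
    fderiv ℝ (fun p => connForm g p Y) p X =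
      g (‖p.1‖ ^ 2) * inner ℝ (crossL X.2 p.1 + crossL p.2 X.1) Y.1 +
        deriv g (‖p.1‖ ^ 2) * (2 * inner ℝ p.1 X.1) * inner ℝ (crossL p.2 p.1) Y.1 := by
  have h1 : HasFDerivAt (fun p : Ambient => crossL p.2 p.1) _ p :=
    (crossL.hasFDerivAt.comp p hasFDerivAt_snd).clm_apply hasFDerivAt_fst
  have h2 := h1.inner ℝ (hasFDerivAt_const Y.1 p)
  have h3 : HasFDerivAt (fun p : Ambient => ‖p.1‖ ^ 2) _ p := hasFDerivAt_fst.norm_sq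
  have h4 := (hasDerivAt_of_smooth hg (‖p.1‖ ^ 2)).comp_hasFDerivAt p h3
  have h5 := h4.mul h2
  have h6 : (fun p => connForm g p Y) =
      fun p : Ambient => g (‖p.1‖ ^ 2) * inner ℝ (crossL p.2 p.1) Y.1 :=
    funext fun p => connForm_apply g p Y
  rw [h6]
  refine (congrArg (fun f : Ambient →L[ℝ] ℝ => f X) h5.fderiv).trans ?_
  simp [inner_add_left]
  ring

/-- The base form, corrected by the exterior derivative of a scaled connection form. -/
def thomForm (g : ℝ → ℝ) (p : Ambient) : Ambient [⋀^Fin 2]→L[ℝ] ℝ :=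
  baseForm p + extDerivOne (connForm g) p

section Thom

variable {g : ℝ → ℝ} (hg : ContDiff ℝ ∞ g)
include hg

theorem contDiff_thomForm : ContDiff ℝ ∞ (thomForm g) :=
  contDiff_baseForm.add (contDiff_extDerivOne (contDiff_connForm hg))

theorem extDeriv_thomForm {p X Y Z : Ambient} (hp : ‖p.2‖ = 1) (hX : inner ℝ p.2 X.2 = (0 : ℝ))
    (hY : inner ℝ p.2 Y.2 = (0 : ℝ)) (hZ : inner ℝ p.2 Z.2 = (0 : ℝ)) :
    extDeriv (thomForm g) p ![X, Y, Z] = 0 := by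
  have h1 := extDeriv_fun_add (contDiff_baseForm.differentiable (by simp) p)
    ((contDiff_extDerivOne (contDiff_connForm hg)).differentiable (by simp) p)
  have h2 : extDeriv (thomForm g) p = _ := h1
  rw [h2, ContinuousAlternatingMap.add_apply, extDeriv_baseForm hp hX hY hZ,
    extDeriv_extDerivOne (contDiff_connForm hg).contDiffAt]
  simp

theorem thomForm_apply (p X Y : Ambient) : thomForm g p ![X, Y] = inner ℝ p.2 (crossL X.2 Y.2) +
    (g (‖p.1‖ ^ 2) * inner ℝ (crossL X.2 p.1 + crossL p.2 X.1) Y.1 +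
        deriv g (‖p.1‖ ^ 2) * (2 * inner ℝ p.1 X.1) * inner ℝ (crossL p.2 p.1) Y.1 -
      (g (‖p.1‖ ^ 2) * inner ℝ (crossL Y.2 p.1 + crossL p.2 Y.1) X.1 +
        deriv g (‖p.1‖ ^ 2) * (2 * inner ℝ p.1 Y.1) * inner ℝ (crossL p.2 p.1) X.1)) := by
  rw [thomForm, ContinuousAlternatingMap.add_apply, baseForm_apply,
    extDerivOne_apply ((contDiff_connForm hg).differentiable (by simp) p), fderiv_connForm hg,
    fderiv_connForm hg]

theorem thomForm_of_eq_zero {p : Ambient} (h : g (‖p.1‖ ^ 2) = 0) (h' : deriv g (‖p.1‖ ^ 2) = 0)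
    (X Y : Ambient) : thomForm g p ![X, Y] = inner ℝ p.2 (crossL X.2 Y.2) := by
  rw [thomForm_apply hg, h, h']; simp

/-- Where `g x = x⁻¹` the two terms cancel on the cotangent bundle, by the structure equation of
the rotation group. -/
theorem thomForm_of_eq_inv {p : Ambient} (hp : p ∈ cotangentBundle) (hu : p.1 ≠ 0)
    (h : g (‖p.1‖ ^ 2) = (‖p.1‖ ^ 2)⁻¹) (h' : deriv g (‖p.1‖ ^ 2) = -((‖p.1‖ ^ 2) ^ 2)⁻¹)
    {X Y : Ambient} (hX : IsTangentCotangent p X) (hY : IsTangentCotangent p Y) :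
    thomForm g p ![X, Y] = 0 := by
  have hρ : 0 < ‖p.1‖ ^ 2 := by have := norm_pos_iff.2 hu; positivity
  obtain ⟨u, v⟩ := p
  simp only at *
  set ρ := ‖u‖ ^ 2 with hρd
  have huu : (inner ℝ u u : ℝ) = ρ := real_inner_self_eq_norm_sq u
  have hvv : (inner ℝ v v : ℝ) = 1 := by rw [real_inner_self_eq_norm_sq, hp.2]; norm_num
  have huv : (inner ℝ u v : ℝ) = 0 := hp.1
  have hvu : (inner ℝ v u : ℝ) = 0 := by rw [real_inner_comm]; exact huv
  set n := crossL v u with hn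
  have hnn : (inner ℝ n n : ℝ) = ρ := by
    rw [hn, inner_crossL_crossL, hvv, huu, hvu, huv]; ring
  have hun : (inner ℝ u n : ℝ) = 0 := by
    rw [real_inner_comm]; exact inner_crossL_self_right v u
  have hvn : (inner ℝ v n : ℝ) = 0 := by
    rw [real_inner_comm]; exact inner_crossL_self_left v u
  have hvxn : crossL v n = -u := by rw [hn, crossL_crossL, hvu, hvv]; simp
  have huxn : crossL u n = ρ • v := by rw [hn, crossL_crossL, huu, huv]; simp
  -- expansion of a vector in the orthogonal frame `v`, `u`, `n`
  have hexp : ∀ x : R3, ∃ α β γ : ℝ, x = α • v + β • u + γ • n := by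
    intro x
    have h1 : crossL n (crossL n x) = (inner ℝ n x : ℝ) • n - ρ • x := by
      rw [crossL_crossL, hnn]
    have h2 : crossL n x = (inner ℝ v x : ℝ) • u - (inner ℝ u x : ℝ) • v := by
      rw [hn, crossL_anticomm, crossL_crossL, real_inner_comm u x, real_inner_comm v x]
      abel
    rw [h2, map_sub, map_smul, map_smul, crossL_anticomm n u, crossL_anticomm n v, hvxn, huxn] at h1
    refine ⟨inner ℝ v x, ρ⁻¹ * inner ℝ u x, ρ⁻¹ * inner ℝ n x, ?_⟩
    have h3 : ρ • x = (inner ℝ n x : ℝ) • n + ((inner ℝ v x : ℝ) • ρ • v + (inner ℝ u x : ℝ) • u) := by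
      have h4 : ρ • x = (inner ℝ n x : ℝ) • n - ((inner ℝ n x : ℝ) • n - ρ • x) := by abel
      rw [h4, ← h1]
      simp only [smul_neg]
      abel
    refine smul_right_injective R3 hρ.ne' ?_
    simp only [smul_add, smul_smul, mul_inv_cancel_left₀ hρ.ne']
    rw [h3, smul_smul, mul_comm ρ]
    abel
  have hunxu : crossL n u = -(ρ • v) := by rw [crossL_anticomm, huxn]
  have hnxv : crossL n v = u := by rw [crossL_anticomm, hvxn, neg_neg]
  have huxv : crossL u v = -n := by rw [crossL_anticomm, ← hn]
  have hnv : (inner ℝ n v : ℝ) = 0 := by rw [real_inner_comm]; exact hvn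
  have hnu : (inner ℝ n u : ℝ) = 0 := by rw [real_inner_comm]; exact hun
  obtain ⟨X1, X2⟩ := X
  obtain ⟨Y1, Y2⟩ := Y
  obtain ⟨a, b, c, rfl⟩ := hexp X1
  obtain ⟨a', b', c', rfl⟩ := hexp X2
  obtain ⟨d, e, f, rfl⟩ := hexp Y1
  obtain ⟨d', e', f', rfl⟩ := hexp Y2
  have hX1 := hX.1
  have hX2 := hX.2
  have hY1 := hY.1
  have hY2 := hY.2
  rw [thomForm_apply hg]
  simp only [inner_add_left, inner_add_right, inner_smul_left, inner_smul_right, map_add, map_smul,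
    add_apply, smul_apply, inner_neg_left, inner_neg_right, crossL_self,
    inner_zero_left, inner_zero_right, smul_zero, smul_neg,
    huu, hvv, huv, hvu, hnn, hun, hvn, hvxn, huxn, hunxu, hnxv, huxv, hnv, hnu, ← hn,
    conj_trivial] at hX1 hX2 hY1 hY2 ⊢
  have ea : a' = 0 := by linarith
  have ed : d' = 0 := by linarith
  have ea1 : a = -(b' * ρ) := by linarith
  have ed1 : d = -(e' * ρ) := by linarith
  subst ea ed ea1 ed1
  simp only [← hρd, h, h']
  field_simp
  ring

end Thom

/-! ### Pulling back two-forms from the manifold -/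

section Pullback

open Filter Topology

variable {M : Type*} [TopologicalSpace M] [ChartedSpace (EuclideanSpace ℝ (Fin 4)) M]
  {E : Type*} [NormedAddCommGroup E] [NormedSpace ℝ E]

/-- The pullback of a two-form under a map from a normed space to the four-manifold. -/
def pullForm (σ : TwoForm M) (κ : E → M) (p : E) : E [⋀^Fin 2]→L[ℝ] ℝ :=
  (σ (κ p)).compContinuousLinearMap (mfderiv 𝓘(ℝ, E) (𝓡 4) κ p)

theorem pullForm_apply (σ : TwoForm M) (κ : E → M) (p X Y : E) : pullForm σ κ p ![X, Y] =
    σ (κ p) ![mfderiv 𝓘(ℝ, E) (𝓡 4) κ p X, mfderiv 𝓘(ℝ, E) (𝓡 4) κ p Y] :=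
  compContinuousLinearMap_apply_pair (E := E) (F := EuclideanSpace ℝ (Fin 4)) _ _ X Y

theorem inChart_apply (σ : TwoForm M) (c : M) (y X Y : EuclideanSpace ℝ (Fin 4)) :
    TwoForm.inChart σ c y ![X, Y] = σ ((extChartAt (𝓡 4) c).symm y)
      ![mfderiv 𝓘(ℝ, EuclideanSpace ℝ (Fin 4)) (𝓡 4) (extChartAt (𝓡 4) c).symm y X,
        mfderiv 𝓘(ℝ, EuclideanSpace ℝ (Fin 4)) (𝓡 4) (extChartAt (𝓡 4) c).symm y Y] :=
  pullForm_apply σ (extChartAt (𝓡 4) c).symm y X Y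

variable [IsManifold (𝓡 4) ∞ M]

set_option linter.unusedSectionVars false

theorem one_le_infty : (1 : WithTop ℕ∞) ≤ ∞ := by
  exact_mod_cast le_top (a := (1 : ℕ∞))

theorem one_ne_infty : (1 : WithTop ℕ∞) ≠ ∞ := by
  exact_mod_cast ENat.one_ne_top

theorem mdifferentiableAt_extChartAt_symm {c : M} {y : EuclideanSpace ℝ (Fin 4)}
    (hy : y ∈ (extChartAt (𝓡 4) c).target) :
    MDifferentiableAt 𝓘(ℝ, EuclideanSpace ℝ (Fin 4)) (𝓡 4) (extChartAt (𝓡 4) c).symm y :=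
  ((contMDiffOn_extChartAt_symm (n := ∞) c).contMDiffAt
    ((isOpen_extChartAt_target c).mem_nhds hy)).mdifferentiableAt (by simp)

theorem pullForm_eventuallyEq (σ : TwoForm M) {κ : E → M} {p₀ : E}
    (hκ : ContMDiffAt 𝓘(ℝ, E) (𝓡 4) ∞ κ p₀) :
    pullForm σ κ =ᶠ[𝓝 p₀] fun p =>
      (TwoForm.inChart σ (κ p₀) (extChartAt (𝓡 4) (κ p₀) (κ p))).compContinuousLinearMap
        (fderiv ℝ (fun p => extChartAt (𝓡 4) (κ p₀) (κ p)) p) := by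
  have h1 : ∀ᶠ p in 𝓝 p₀, ContMDiffAt 𝓘(ℝ, E) (𝓡 4) 1 κ p := by
    have _inst : IsManifold (𝓡 4) 1 M := IsManifold.of_le (n := ∞) one_le_infty
    exact (contMDiffAt_iff_contMDiffAt_nhds one_ne_infty).1 (hκ.of_le one_le_infty)
  have h2 : ∀ᶠ p in 𝓝 p₀, κ p ∈ (extChartAt (𝓡 4) (κ p₀)).source :=
    hκ.continuousAt (extChartAt_source_mem_nhds (I := 𝓡 4) (κ p₀))
  filter_upwards [h1, h2, eventually_eventually_nhds.2 h2] with p hp hps hpn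
  have hk : MDifferentiableAt 𝓘(ℝ, E) 𝓘(ℝ, EuclideanSpace ℝ (Fin 4))
      (fun p => extChartAt (𝓡 4) (κ p₀) (κ p)) p := by
    have := (contMDiffAt_extChartAt' (n := 1) (I := 𝓡 4) (x := κ p₀) (x' := κ p)
      (by simpa using hps)).mdifferentiableAt one_ne_zero
    exact this.comp p (hp.mdifferentiableAt one_ne_zero)
  have ht := (extChartAt (𝓡 4) (κ p₀)).map_source hps
  have h3 : κ =ᶠ[𝓝 p]
      (extChartAt (𝓡 4) (κ p₀)).symm ∘ fun p => extChartAt (𝓡 4) (κ p₀) (κ p) := by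
    filter_upwards [hpn] with q hq using ((extChartAt (𝓡 4) (κ p₀)).left_inv hq).symm
  have h4 := h3.mfderiv_eq (I := 𝓘(ℝ, E)) (I' := 𝓡 4)
  rw [mfderiv_comp p (mdifferentiableAt_extChartAt_symm ht) hk, mfderiv_eq_fderiv] at h4
  have hl := (extChartAt (𝓡 4) (κ p₀)).left_inv hps
  refine form_ext fun X Y => ?_
  rw [pullForm_apply]
  refine Eq.trans ?_ (compContinuousLinearMap_apply_pair _ _ X Y).symm
  rw [inChart_apply, h4]
  have key : ∀ x y : M, x = y → ∀ a b : EuclideanSpace ℝ (Fin 4),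
      (σ x : EuclideanSpace ℝ (Fin 4) [⋀^Fin 2]→L[ℝ] ℝ) ![a, b] =
      (σ y : EuclideanSpace ℝ (Fin 4) [⋀^Fin 2]→L[ℝ] ℝ) ![a, b] := by
    rintro x _ rfl a b; rfl
  exact key _ _ hl.symm _ _

theorem contDiffAt_extChartAt_comp {κ : E → M} {p₀ : E}
    (hκ : ContMDiffAt 𝓘(ℝ, E) (𝓡 4) ∞ κ p₀) :
    ContDiffAt ℝ ∞ (fun p => extChartAt (𝓡 4) (κ p₀) (κ p)) p₀ := by
  rw [← contMDiffAt_iff_contDiffAt]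
  exact (contMDiffAt_extChartAt (n := ∞) (I := 𝓡 4) (x := κ p₀)).comp p₀ hκ

theorem contDiff_toBilin {F : Type*} [NormedAddCommGroup F] [NormedSpace ℝ F] :
    ContDiff ℝ ∞ (fun σ : F [⋀^Fin 2]→L[ℝ] ℝ => toBilin σ) :=
  ContinuousLinearMap.contDiff (𝕜 := ℝ) (E := F [⋀^Fin 2]→L[ℝ] ℝ) (F := F →L[ℝ] F →L[ℝ] ℝ) toBilin

/-- Composition of a smooth family of two-forms with a smooth map and its derivative. -/
theorem contDiffAt_pullback {F : Type*} [NormedAddCommGroup F] [NormedSpace ℝ F]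
    [FiniteDimensional ℝ E] {τ : F → F [⋀^Fin 2]→L[ℝ] ℝ} {k : E → F} {p : E}
    (hτ : ContDiffAt ℝ ∞ τ (k p)) (hk : ContDiffAt ℝ ∞ k p) :
    ContDiffAt ℝ ∞ (fun q => (τ (k q)).compContinuousLinearMap (fderiv ℝ k q)) p := by
  refine contDiffAt_form fun X Y => ?_
  simp only [compContinuousLinearMap_apply_pair]
  have h1 : ContDiffAt ℝ ∞ (fderiv ℝ k) p := hk.fderiv_right (m := ∞) (by simp)
  have h2 : ContDiffAt ℝ ∞ (fun q => toBilin (τ (k q))) p :=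
    contDiff_toBilin.contDiffAt.comp p (hτ.comp p hk)
  have h3 := (h2.clm_apply (h1.clm_apply (contDiffAt_const (c := X)))).clm_apply
    (h1.clm_apply (contDiffAt_const (c := Y)))
  simpa only [toBilin_apply] using h3

theorem contDiffAt_pullForm [FiniteDimensional ℝ E] {σ : TwoForm M} (hσ : IsSymplecticForm σ)
    {κ : E → M} {p₀ : E} (hκ : ContMDiffAt 𝓘(ℝ, E) (𝓡 4) ∞ κ p₀) :
    ContDiffAt ℝ ∞ (pullForm σ κ) p₀ :=
  (contDiffAt_pullback (τ := TwoForm.inChart σ (κ p₀))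
    (k := fun p => extChartAt (𝓡 4) (κ p₀) (κ p)) (p := p₀)
    ((hσ.smooth (κ p₀)).contDiffAt (extChartAt_target_mem_nhds (κ p₀)))
    (contDiffAt_extChartAt_comp hκ)).congr_of_eventuallyEq (pullForm_eventuallyEq σ hκ)

theorem extDeriv_pullForm {σ : TwoForm M} (hσ : IsSymplecticForm σ)
    {κ : E → M} {p₀ : E} (hκ : ContMDiffAt 𝓘(ℝ, E) (𝓡 4) ∞ κ p₀) :
    extDeriv (pullForm σ κ) p₀ = 0 := by
  have h1 := (pullForm_eventuallyEq σ hκ).extDeriv_eq (𝕜 := ℝ)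
  rw [h1]
  have h2 := (hσ.smooth (κ p₀)).contDiffAt (extChartAt_target_mem_nhds (κ p₀))
  have h3 := extDeriv_pullback (r := ∞) (f := fun p => extChartAt (𝓡 4) (κ p₀) (κ p)) (x := p₀)
    (h2.differentiableAt (by simp)) (contDiffAt_extChartAt_comp hκ)
    (by rw [minSmoothness_of_isRCLikeNormedField]; exact two_le_infty)
  rw [h3, hσ.closed (κ p₀) _ (mem_extChartAt_target (κ p₀))]
  ext v
  simp

end Pullback

/-! ### Local inverses and the inverse of a Weinstein embedding -/

section Inverse

set_option linter.unusedSectionVars false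

open Filter Topology

/-- The inverse function theorem, for a smooth map between finite-dimensional spaces of equal
dimension whose derivative is injective. -/
theorem exists_local_inverse {E F : Type*} [NormedAddCommGroup E] [NormedSpace ℝ E]
    [NormedAddCommGroup F] [NormedSpace ℝ F] [FiniteDimensional ℝ E] [FiniteDimensional ℝ F]
    {G : E → F} {p : E} (hG : ContDiffAt ℝ ∞ G p) (hinj : ∀ X, fderiv ℝ G p X = 0 → X = 0)
    (hdim : Module.finrank ℝ E = Module.finrank ℝ F) :
    ∃ H : F → E, ContDiffAt ℝ ∞ H (G p) ∧ H (G p) = p ∧ (∀ᶠ y in 𝓝 (G p), G (H y) = y) ∧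
      ∀ᶠ x in 𝓝 p, H (G x) = x := by
  have := FiniteDimensional.complete ℝ E
  let e : E ≃L[ℝ] F := (LinearMap.linearEquivOfInjective (fderiv ℝ G p).toLinearMap
    ((injective_iff_map_eq_zero _).2 hinj) hdim).toContinuousLinearEquiv
  have he : (e : E →L[ℝ] F) = fderiv ℝ G p := by ext x; rfl
  have hd : HasFDerivAt G (e : E →L[ℝ] F) p := by
    rw [he]; exact (hG.differentiableAt (by simp)).hasFDerivAt
  have hs : HasStrictFDerivAt G (e : E →L[ℝ] F) p := hG.hasStrictFDerivAt' hd (by simp)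
  refine ⟨hG.localInverse hd (by simp), hG.to_localInverse hd (by simp),
    hG.localInverse_apply_image hd (by simp), hs.eventually_right_inverse,
    hs.eventually_left_inverse⟩

/-- The retraction of `{v ≠ 0}` onto the cotangent bundle of the sphere. -/
def cotangentRetraction (p : Ambient) : Ambient :=
  (p.1 - (inner ℝ p.1 (‖p.2‖⁻¹ • p.2) : ℝ) • ‖p.2‖⁻¹ • p.2, ‖p.2‖⁻¹ • p.2)

theorem cotangentRetraction_mem {p : Ambient} (hp : p.2 ≠ 0) :
    cotangentRetraction p ∈ cotangentBundle := by
  have hn : ‖‖p.2‖⁻¹ • p.2‖ = 1 := by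
    rw [norm_smul, norm_inv, norm_norm, inv_mul_cancel₀ (norm_ne_zero_iff.2 hp)]
  have h (u n : R3) (hn : ‖n‖ = 1) : (inner ℝ (u - (inner ℝ u n : ℝ) • n) n : ℝ) = 0 := by
    rw [inner_sub_left, inner_smul_left, real_inner_self_eq_norm_sq, hn]
    simp
  exact ⟨h _ _ hn, hn⟩

theorem cotangentRetraction_of_mem {p : Ambient} (hp : p ∈ cotangentBundle) :
    cotangentRetraction p = p := by
  obtain ⟨u, v⟩ := p
  have h1 : (inner ℝ u v : ℝ) = 0 := hp.1
  have h2 : ‖v‖ = 1 := hp.2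
  simp [cotangentRetraction, h1, h2]

theorem contDiffAt_cotangentRetraction {p : Ambient} (hp : p.2 ≠ 0) :
    ContDiffAt ℝ ∞ cotangentRetraction p := by
  have h1 : ContDiffAt ℝ ∞ (fun p : Ambient => ‖p.2‖⁻¹ • p.2) p :=
    ((contDiffAt_snd.norm ℝ hp).inv (norm_ne_zero_iff.2 hp)).smul contDiffAt_snd
  exact (contDiffAt_fst.sub ((contDiffAt_fst.inner ℝ h1).smul h1)).prodMk h1

theorem ne_zero_of_mem_cotangentBundle {p : Ambient} (hp : p ∈ cotangentBundle) : p.2 ≠ 0 := by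
  have h2 : ‖p.2‖ = 1 := hp.2
  intro h
  rw [h] at h2
  simp at h2

theorem fderiv_cotangentRetraction {p X : Ambient} (hp : p ∈ cotangentBundle)
    (hX : IsTangentCotangent p X) : fderiv ℝ cotangentRetraction p X = X := by
  have hv := ne_zero_of_mem_cotangentBundle hp
  have hn : ‖p.2‖ = 1 := hp.2
  have hsq : HasFDerivAt (fun p : Ambient => ‖p.2‖ ^ 2) _ p :=
    (hasFDerivAt_snd (𝕜 := ℝ) (E := R3) (F := R3) (p := p)).norm_sq
  have h1 := (hasDerivAt_inv (x := √(‖p.2‖ ^ 2)) (by simp [hn])).comp_hasFDerivAt p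
    (hsq.sqrt (by simp [hn]))
  have h2 : HasFDerivAt (fun p : Ambient => ‖p.2‖⁻¹) _ p := h1.congr_of_eventuallyEq
    (Eventually.of_forall fun q => by simp)
  obtain ⟨f', hf', hf'X⟩ : ∃ f' : Ambient →L[ℝ] ℝ,
      HasFDerivAt (fun p : Ambient => ‖p.2‖⁻¹) f' p ∧ f' X = 0 := by
    refine ⟨_, h2, ?_⟩
    have := hX.2
    simp [this]
  have h3 : HasFDerivAt (fun p : Ambient => ‖p.2‖⁻¹ • p.2) _ p := hf'.smul hasFDerivAt_snd
  have h4 : HasFDerivAt cotangentRetraction _ p :=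
    (hasFDerivAt_fst.sub ((hasFDerivAt_fst.inner ℝ h3).smul h3)).prodMk h3
  rw [h4.fderiv]
  have h5 : (inner ℝ p.1 p.2 : ℝ) = 0 := hp.1
  have h6 : (inner ℝ p.1 X.2 : ℝ) + inner ℝ X.1 p.2 = 0 := by linarith [hX.1]
  ext1 <;> simp [hn, hf'X, h5, h6]

/-- The canonical symplectic form is nondegenerate on the cotangent bundle. -/
theorem eq_zero_of_stdForm {p X : Ambient} (hp : p ∈ cotangentBundle)
    (hX : IsTangentCotangent p X) (h : ∀ Y, IsTangentCotangent p Y → stdForm X Y = 0) :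
    X = 0 := by
  have hv : (inner ℝ p.2 p.2 : ℝ) = 1 := by
    rw [real_inner_self_eq_norm_sq, hp.2]; norm_num
  have h2 : X.2 = 0 := by
    have := h (X.2, 0) ⟨by simpa [real_inner_comm] using hX.2, by simp⟩
    simpa [stdForm] using this
  have h1 : (inner ℝ p.2 X.1 : ℝ) = 0 := by
    have := hX.1; rw [h2] at this; simpa [real_inner_comm] using this
  have h3 := h (-(inner ℝ p.1 X.1 : ℝ) • p.2, X.1)
    ⟨by simp only [inner_smul_left, hv]; simp, h1⟩
  rw [stdForm, h2] at h3
  have h4 : X.1 = 0 := by simpa using h3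
  exact Prod.ext h4 h2

/-- The open disc bundle in the cotangent bundle of the sphere. -/
def openDisc (lam : ℝ) : Set Ambient := {p | p ∈ cotangentBundle ∧ ‖p.1‖ < lam}

variable {M : Type*} [TopologicalSpace M] [ChartedSpace (EuclideanSpace ℝ (Fin 4)) M]
  [IsManifold (𝓡 4) ∞ M]
  {η : TwoForm M} {L : Set M} {lam : ℝ} {i : Ambient → M}

theorem openDisc_subset : openDisc lam ⊆ cotangentDisc lam :=
  fun _ hp => ⟨hp.1.1, hp.1.2, hp.2.le⟩

theorem IsWeinsteinEmbedding.contMDiffAt (hi : IsWeinsteinEmbedding η L lam i) {p : Ambient}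
    (hp : p ∈ cotangentDisc lam) : ContMDiffAt 𝓘(ℝ, Ambient) (𝓡 4) ∞ i p := by
  obtain ⟨U, hU, hs, h⟩ := hi.smooth
  exact h.contMDiffAt (hU.mem_nhds (hs hp))

theorem IsWeinsteinEmbedding.local_inverse (hi : IsWeinsteinEmbedding η L lam i) {p : Ambient}
    (hp : p ∈ openDisc lam) : ∃ h : M → Ambient, ContMDiffAt (𝓡 4) 𝓘(ℝ, Ambient) ∞ h (i p) ∧
      ∀ᶠ x in 𝓝 (i p), h x ∈ openDisc lam ∧ i (h x) = x := by
  have hpT := hp.1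
  have hr := cotangentRetraction_of_mem hpT
  have hv := ne_zero_of_mem_cotangentBundle hpT
  have hip := hi.contMDiffAt (openDisc_subset hp)
  have hk := contDiffAt_extChartAt_comp hip
  have hkr : ContDiffAt ℝ ∞ (fun q => extChartAt (𝓡 4) (i p) (i (cotangentRetraction q))) p := by
    refine ContDiffAt.comp (g := fun q => extChartAt (𝓡 4) (i p) (i q)) p ?_
      (contDiffAt_cotangentRetraction hv)
    rw [hr]; exact hk
  let G : Ambient → EuclideanSpace ℝ (Fin 4) × (ℝ × ℝ) := fun q =>
    (extChartAt (𝓡 4) (i p) (i (cotangentRetraction q)), inner ℝ q.1 q.2, inner ℝ q.2 q.2)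
  have hG : ContDiffAt ℝ ∞ G p :=
    hkr.prodMk ((contDiffAt_fst.inner ℝ contDiffAt_snd).prodMk
      (contDiffAt_snd.inner ℝ contDiffAt_snd))
  have hGd : ∀ X, fderiv ℝ G p X = 0 → X = 0 := by
    intro X hX
    have h1 : HasFDerivAt (fun q : Ambient => (inner ℝ q.1 q.2 : ℝ)) _ p :=
      hasFDerivAt_fst.inner ℝ hasFDerivAt_snd
    have h2 : HasFDerivAt (fun q : Ambient => (inner ℝ q.2 q.2 : ℝ)) _ p :=
      hasFDerivAt_snd.inner ℝ hasFDerivAt_snd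
    have h3 : HasFDerivAt G _ p :=
      (hkr.differentiableAt (by simp)).hasFDerivAt.prodMk (h1.prodMk h2)
    rw [h3.fderiv] at hX
    have e1 := congrArg Prod.fst hX
    have e2 := congrArg (fun z => z.2.1) hX
    have e3 := congrArg (fun z => z.2.2) hX
    simp only [ContinuousLinearMap.prod_apply, Prod.fst_zero, Prod.snd_zero] at e1 e2 e3
    have hXt : IsTangentCotangent p X := by
      refine ⟨?_, ?_⟩
      · simp at e2; linarith
      · simp at e3; have := real_inner_comm p.2 X.2; linarith
    have e4 : fderiv ℝ (fun q => extChartAt (𝓡 4) (i p) (i q)) p X = 0 := by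
      have h4 := (hk.differentiableAt (by simp)).hasFDerivAt
      have h5 := ((contDiffAt_cotangentRetraction hv).differentiableAt (by simp)).hasFDerivAt
      have h6 := HasFDerivAt.comp (g := fun q => extChartAt (𝓡 4) (i p) (i q))
        (f := cotangentRetraction) p (by rw [hr]; exact h4) h5
      have h7 := h6.fderiv
      rw [show (fun q => extChartAt (𝓡 4) (i p) (i q)) ∘ cotangentRetraction =
        fun q => extChartAt (𝓡 4) (i p) (i (cotangentRetraction q)) from rfl] at h7
      rw [h7, ContinuousLinearMap.comp_apply, fderiv_cotangentRetraction hpT hXt] at e1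
      exact e1
    refine eq_zero_of_stdForm hpT hXt fun Y hY => ?_
    rw [← hi.symplectic p (openDisc_subset hp) X Y hXt hY, ← pullForm_apply,
      (pullForm_eventuallyEq η hip).self_of_nhds, compContinuousLinearMap_apply_pair, e4]
    exact ContinuousAlternatingMap.map_coord_zero _ 0 rfl
  obtain ⟨H, hH, hHp, hGH, -⟩ := exists_local_inverse hG hGd (by simp)
  have hGp : G p = (extChartAt (𝓡 4) (i p) (i p), 0, 1) := by
    have h1 : (inner ℝ p.1 p.2 : ℝ) = 0 := hpT.1
    have h2 : (inner ℝ p.2 p.2 : ℝ) = 1 := by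
      rw [real_inner_self_eq_norm_sq, hpT.2]; norm_num
    simp only [G, hr, h1, h2]
  let e : M → EuclideanSpace ℝ (Fin 4) × (ℝ × ℝ) := fun x => (extChartAt (𝓡 4) (i p) x, 0, 1)
  have he : ContMDiffAt (𝓡 4) 𝓘(ℝ, EuclideanSpace ℝ (Fin 4) × (ℝ × ℝ)) ∞ e (i p) :=
    (contMDiffAt_extChartAt (n := ∞) (I := 𝓡 4) (x := i p)).prodMk_space contMDiffAt_const
  have hep : e (i p) = G p := hGp.symm
  have hh : ContMDiffAt (𝓡 4) 𝓘(ℝ, Ambient) ∞ (fun x => H (e x)) (i p) := by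
    refine ContMDiffAt.comp (g := H) (i p) ?_ he
    rw [hep]; exact hH.contMDiffAt
  refine ⟨fun x => H (e x), hh, ?_⟩
  have hhc := hh.continuousAt
  have hhp : H (e (i p)) = p := by rw [hep, hHp]
  have ev1 : ∀ᶠ x in 𝓝 (i p), G (H (e x)) = e x := by
    have := he.continuousAt
    rw [ContinuousAt, hep] at this
    exact this.eventually hGH
  have ev2 : ∀ᶠ x in 𝓝 (i p), ‖(H (e x)).1‖ < lam := by
    refine (hhc.fst.norm).eventually (p := fun y => y < lam) (isOpen_Iio.mem_nhds ?_)
    change ‖(H (e (i p))).1‖ < lam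
    rw [hhp]; exact hp.2
  have ev3 : ∀ᶠ x in 𝓝 (i p), i (H (e x)) ∈ (extChartAt (𝓡 4) (i p)).source := by
    have : ContinuousAt (fun x => i (H (e x))) (i p) :=
      ContinuousAt.comp (g := i) (by rw [hhp]; exact hip.continuousAt) hhc
    refine this (?_ : _ ∈ 𝓝 (i (H (e (i p)))))
    rw [hhp]; exact extChartAt_source_mem_nhds (I := 𝓡 4) (i p)
  filter_upwards [ev1, ev2, ev3, extChartAt_source_mem_nhds (I := 𝓡 4) (i p)] with x h1 h2 h3 h4
  have a1 := congrArg Prod.fst h1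
  have a2 : (inner ℝ (H (e x)).1 (H (e x)).2 : ℝ) = 0 := congrArg (fun z => z.2.1) h1
  have a3 : (inner ℝ (H (e x)).2 (H (e x)).2 : ℝ) = 1 := congrArg (fun z => z.2.2) h1
  have hT : H (e x) ∈ cotangentBundle := by
    refine ⟨a2, ?_⟩
    rw [real_inner_self_eq_norm_sq] at a3
    exact (pow_eq_one_iff_of_nonneg (norm_nonneg _) two_ne_zero).1 a3
  refine ⟨⟨hT, h2⟩, ?_⟩
  have a4 : extChartAt (𝓡 4) (i p) (i (cotangentRetraction (H (e x)))) =
    extChartAt (𝓡 4) (i p) x := a1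
  rw [cotangentRetraction_of_mem hT] at a4
  exact (extChartAt (𝓡 4) (i p)).injOn h3 h4 a4

/-- A smooth inverse of `i`, defined on the image of the open disc bundle, which is open. -/
structure IsWeinsteinInverse (lam : ℝ) (i : Ambient → M) (j : M → Ambient) : Prop where
  isOpen : IsOpen (i '' openDisc lam)
  smooth : ∀ x ∈ i '' openDisc lam, ContMDiffAt (𝓡 4) 𝓘(ℝ, Ambient) ∞ j x
  mem : ∀ x ∈ i '' openDisc lam, j x ∈ openDisc lam
  right_inv : ∀ x ∈ i '' openDisc lam, i (j x) = x
  left_inv : ∀ p ∈ openDisc lam, j (i p) = p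

theorem IsWeinsteinEmbedding.exists_inverse (hi : IsWeinsteinEmbedding η L lam i) :
    ∃ j : M → Ambient, IsWeinsteinInverse lam i j := by
  have hinj : Set.InjOn i (openDisc lam) := hi.injOn.mono openDisc_subset
  have hmem : ∀ x ∈ i '' openDisc lam, Function.invFunOn i (openDisc lam) x ∈ openDisc lam :=
    fun x hx => Function.invFunOn_mem hx
  have hr : ∀ x ∈ i '' openDisc lam, i (Function.invFunOn i (openDisc lam) x) = x :=
    fun x hx => Function.invFunOn_eq hx
  refine ⟨Function.invFunOn i (openDisc lam), ?_, ?_, hmem, hr,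
    fun p hp => hinj.leftInvOn_invFunOn hp⟩
  · rw [isOpen_iff_mem_nhds]
    rintro _ ⟨p, hp, rfl⟩
    obtain ⟨h, -, hh⟩ := hi.local_inverse hp
    filter_upwards [hh] with x hx using ⟨h x, hx⟩
  · rintro _ ⟨p, hp, rfl⟩
    obtain ⟨h, hs, hh⟩ := hi.local_inverse hp
    refine hs.congr_of_eventuallyEq ?_
    filter_upwards [hh] with x hx
    have hx' : x ∈ i '' openDisc lam := ⟨h x, hx⟩
    exact hinj (hmem x hx') hx.1 ((hr x hx').trans hx.2.symm)

end Inverse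

/-! ### Transplanting maps and forms from the cotangent bundle to the manifold -/

section Transplant

set_option linter.unusedSectionVars false

open Filter Topology

variable {M : Type*} [TopologicalSpace M] [T2Space M] [CompactSpace M]
  [ChartedSpace (EuclideanSpace ℝ (Fin 4)) M] [IsManifold (𝓡 4) ∞ M]
  {η : TwoForm M} {L : Set M} {lam : ℝ} {i : Ambient → M} {j : M → Ambient}

theorem isCompact_cotangentDisc (c : ℝ) : IsCompact (cotangentDisc c) := by
  refine Metric.isCompact_of_isClosed_isBounded ?_ ?_
  · have h1 : IsClosed {p : Ambient | (inner ℝ p.1 p.2 : ℝ) = 0} :=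
      isClosed_eq (by fun_prop) continuous_const
    have h2 : IsClosed {p : Ambient | ‖p.2‖ = 1} := isClosed_eq (by fun_prop) continuous_const
    have h3 : IsClosed {p : Ambient | ‖p.1‖ ≤ c} := isClosed_le (by fun_prop) continuous_const
    exact h1.inter (h2.inter h3)
  · refine (Metric.isBounded_closedBall (x := (0 : Ambient)) (r := max c 1)).subset ?_
    rintro p ⟨-, h2, h3⟩
    rw [mem_closedBall_zero_iff, Prod.norm_def]
    exact max_le_max h3 h2.le

theorem IsWeinsteinEmbedding.isClosed_image (hi : IsWeinsteinEmbedding η L lam i) {c : ℝ}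
    (hc : c ≤ lam) : IsClosed (i '' cotangentDisc c) := by
  have hs : cotangentDisc c ⊆ cotangentDisc lam := fun p hp => ⟨hp.1, hp.2.1, hp.2.2.trans hc⟩
  refine ((isCompact_cotangentDisc c).image_of_continuousOn fun p hp => ?_).isClosed
  exact (hi.contMDiffAt (hs hp)).continuousAt.continuousWithinAt

theorem form_congr (σ : TwoForm M) {x y : M} (h : x = y) (a b : EuclideanSpace ℝ (Fin 4)) :
    (σ x : EuclideanSpace ℝ (Fin 4) [⋀^Fin 2]→L[ℝ] ℝ) ![a, b] =
      (σ y : EuclideanSpace ℝ (Fin 4) [⋀^Fin 2]→L[ℝ] ℝ) ![a, b] := by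
  subst h; rfl

theorem IsWeinsteinInverse.mem_nhds (hj : IsWeinsteinInverse lam i j) {x : M}
    (hx : x ∈ i '' openDisc lam) : i '' openDisc lam ∈ 𝓝 x :=
  hj.isOpen.mem_nhds hx

theorem IsWeinsteinInverse.mdifferentiableAt (hj : IsWeinsteinInverse lam i j) {x : M}
    (hx : x ∈ i '' openDisc lam) : MDifferentiableAt (𝓡 4) 𝓘(ℝ, Ambient) j x :=
  (hj.smooth x hx).mdifferentiableAt (by simp)

theorem mfderiv_comp_eq_zero_of_eventually_const {f : Ambient → ℝ} {c : ℝ} {x : M}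
    (hjx : MDifferentiableAt (𝓡 4) 𝓘(ℝ, Ambient) j x) (hf : DifferentiableAt ℝ f (j x))
    (h : ∀ᶠ y in 𝓝 x, f (j y) = c) (v : TangentSpace (𝓡 4) x) :
    fderiv ℝ f (j x) (mfderiv (𝓡 4) 𝓘(ℝ, Ambient) j x v) = 0 := by
  have h1 : HasMFDerivAt (𝓡 4) 𝓘(ℝ, ℝ) (f ∘ j) x
      ((fderiv ℝ f (j x)).comp (mfderiv (𝓡 4) 𝓘(ℝ, Ambient) j x)) :=
    HasMFDerivAt.comp x hf.hasFDerivAt.hasMFDerivAt hjx.hasMFDerivAt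
  have h2 : HasMFDerivAt (𝓡 4) 𝓘(ℝ, ℝ) (f ∘ j) x
      (0 : EuclideanSpace ℝ (Fin 4) →L[ℝ] ℝ) :=
    (hasMFDerivAt_const (I := 𝓡 4) (I' := 𝓘(ℝ, ℝ)) c x).congr_of_eventuallyEq
      (f₁ := f ∘ j) h
  have h3 := hasMFDerivAt_unique h1 h2
  exact congrArg (fun f : EuclideanSpace ℝ (Fin 4) →L[ℝ] ℝ => f v) h3

theorem IsWeinsteinInverse.isTangentCotangent (hj : IsWeinsteinInverse lam i j) {x : M}
    (hx : x ∈ i '' openDisc lam) (v : TangentSpace (𝓡 4) x) :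
    IsTangentCotangent (j x) (mfderiv (𝓡 4) 𝓘(ℝ, Ambient) j x v) := by
  have h1 : HasFDerivAt (fun q : Ambient => (inner ℝ q.1 q.2 : ℝ)) _ (j x) :=
    hasFDerivAt_fst.inner ℝ hasFDerivAt_snd
  have h2 : HasFDerivAt (fun q : Ambient => (inner ℝ q.2 q.2 : ℝ)) _ (j x) :=
    hasFDerivAt_snd.inner ℝ hasFDerivAt_snd
  have e1 := mfderiv_comp_eq_zero_of_eventually_const (c := 0) (hj.mdifferentiableAt hx)
    h1.differentiableAt (by filter_upwards [hj.mem_nhds hx] with y hy using (hj.mem y hy).1.1) v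
  have e2 := mfderiv_comp_eq_zero_of_eventually_const (c := 1) (hj.mdifferentiableAt hx)
    h2.differentiableAt (by
      filter_upwards [hj.mem_nhds hx] with y hy
      rw [real_inner_self_eq_norm_sq, (hj.mem y hy).1.2, one_pow]) v
  have k1 : ∀ X : Ambient, fderiv ℝ (fun q : Ambient => (inner ℝ q.1 q.2 : ℝ)) (j x) X =
      inner ℝ X.1 (j x).2 + inner ℝ (j x).1 X.2 := fun X => by
    rw [h1.fderiv]; simp [add_comm]
  have k2 : ∀ X : Ambient, fderiv ℝ (fun q : Ambient => (inner ℝ q.2 q.2 : ℝ)) (j x) X =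
      2 * inner ℝ (j x).2 X.2 := fun X => by
    rw [h2.fderiv]
    have := real_inner_comm (j x).2 X.2
    simp; linarith
  exact ⟨(k1 _).symm.trans e1, by have := (k2 _).symm.trans e2; linarith⟩

/-- On the image of the disc bundle the symplectic form is the pullback of the canonical one. -/
theorem IsWeinsteinInverse.form_eq (hj : IsWeinsteinInverse lam i j)
    (hi : IsWeinsteinEmbedding η L lam i) {x : M} (hx : x ∈ i '' openDisc lam)
    (v w : TangentSpace (𝓡 4) x) :
    η x ![v, w] = stdForm (mfderiv (𝓡 4) 𝓘(ℝ, Ambient) j x v)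
      (mfderiv (𝓡 4) 𝓘(ℝ, Ambient) j x w) := by
  have hd := openDisc_subset (hj.mem x hx)
  rw [← hi.symplectic (j x) hd _ _ (hj.isTangentCotangent hx v) (hj.isTangentCotangent hx w)]
  have h1 : HasMFDerivAt (𝓡 4) (𝓡 4) (i ∘ j) x _ :=
    HasMFDerivAt.comp x (((hi.contMDiffAt hd).mdifferentiableAt (by simp)).hasMFDerivAt)
      (hj.mdifferentiableAt hx).hasMFDerivAt
  have h2 : HasMFDerivAt (𝓡 4) (𝓡 4) (i ∘ j) x
      (ContinuousLinearMap.id ℝ (EuclideanSpace ℝ (Fin 4))) :=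
    (hasMFDerivAt_id (I := 𝓡 4) x).congr_of_eventuallyEq
      (by filter_upwards [hj.mem_nhds hx] with y hy using hj.right_inv y hy)
  have h3 := hasMFDerivAt_unique h1 h2
  have h4 : ∀ v : TangentSpace (𝓡 4) x, mfderiv 𝓘(ℝ, Ambient) (𝓡 4) i (j x)
      (mfderiv (𝓡 4) 𝓘(ℝ, Ambient) j x v) = v :=
    fun v => congrArg (fun f : EuclideanSpace ℝ (Fin 4) →L[ℝ] EuclideanSpace ℝ (Fin 4) => f v) h3
  rw [h4, h4]
  exact form_congr η (hj.right_inv x hx).symm v w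

/-- A smooth family of self-maps of the cotangent bundle which preserve the length of cotangent
vectors and are the identity on those of length at least `lam / 2`. -/
structure IsSupportedFamily (lam : ℝ) (F : ℝ → Ambient → Ambient) : Prop where
  smooth : ∀ t, ∀ p ∈ cotangentBundle, ContDiffAt ℝ ∞ (fun q : ℝ × Ambient => F q.1 q.2) (t, p)
  mem : ∀ t, ∀ p ∈ cotangentBundle, F t p ∈ cotangentBundle
  norm_eq : ∀ t, ∀ p ∈ cotangentBundle, ‖(F t p).1‖ = ‖p.1‖
  eq_self : ∀ t, ∀ p ∈ cotangentBundle, lam / 2 ≤ ‖p.1‖ → F t p = p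

open Classical in
/-- The self-map of the manifold which corresponds to a self-map of the cotangent bundle, extended
by the identity. -/
def transplant (lam : ℝ) (i : Ambient → M) (j : M → Ambient) (F : Ambient → Ambient) (x : M) : M :=
  if x ∈ i '' openDisc lam then i (F (j x)) else x

variable {F G : ℝ → Ambient → Ambient}

theorem IsSupportedFamily.mem_openDisc (hF : IsSupportedFamily lam F) (t : ℝ) {p : Ambient}
    (hp : p ∈ openDisc lam) : F t p ∈ openDisc lam :=
  ⟨hF.mem t p hp.1, by rw [hF.norm_eq t p hp.1]; exact hp.2⟩

theorem transplant_of_mem {x : M} (hx : x ∈ i '' openDisc lam) (f : Ambient → Ambient) :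
    transplant lam i j f x = i (f (j x)) := if_pos hx

theorem IsSupportedFamily.transplant_of_notMem (hF : IsSupportedFamily lam F)
    (hj : IsWeinsteinInverse lam i j) {x : M} (hx : x ∉ i '' cotangentDisc (lam / 2)) (t : ℝ) :
    transplant lam i j (F t) x = x := by
  by_cases h : x ∈ i '' openDisc lam
  · rw [transplant_of_mem h, hF.eq_self t _ (hj.mem x h).1, hj.right_inv x h]
    by_contra! hlt
    exact hx ⟨j x, ⟨(hj.mem x h).1.1, (hj.mem x h).1.2, hlt.le⟩, hj.right_inv x h⟩
  · exact if_neg h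

theorem mem_openDisc_image_of_mem {x : M} {c : ℝ} (hc : c < lam)
    (hx : x ∈ i '' cotangentDisc c) : x ∈ i '' openDisc lam := by
  obtain ⟨p, hp, rfl⟩ := hx
  exact ⟨p, ⟨⟨hp.1, hp.2.1⟩, hp.2.2.trans_lt hc⟩, rfl⟩

theorem IsSupportedFamily.contMDiff_transplant (hF : IsSupportedFamily lam F) (hlam : 0 < lam)
    (hi : IsWeinsteinEmbedding η L lam i) (hj : IsWeinsteinInverse lam i j) :
    ContMDiff (𝓘(ℝ, ℝ).prod (𝓡 4)) (𝓡 4) ∞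
      (fun q : ℝ × M => transplant lam i j (F q.1) q.2) := by
  rintro ⟨t, x⟩
  by_cases h : x ∈ i '' openDisc lam
  · have h1 : (fun q : ℝ × M => transplant lam i j (F q.1) q.2) =ᶠ[𝓝 (t, x)]
        fun q => i (F q.1 (j q.2)) := by
      filter_upwards [continuousAt_snd.preimage_mem_nhds (hj.mem_nhds h)] with q hq
      exact transplant_of_mem hq _
    refine ContMDiffAt.congr_of_eventuallyEq ?_ h1
    have h2 : ContMDiffAt (𝓘(ℝ, ℝ).prod (𝓡 4)) 𝓘(ℝ, ℝ × Ambient) ∞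
        (fun q : ℝ × M => (q.1, j q.2)) (t, x) :=
      contMDiffAt_fst.prodMk_space
        (ContMDiffAt.comp (t, x) (g := j) (f := Prod.snd) (hj.smooth x h) contMDiffAt_snd)
    have h3 : ContMDiffAt (𝓘(ℝ, ℝ).prod (𝓡 4)) 𝓘(ℝ, Ambient) ∞
        (fun q : ℝ × M => F q.1 (j q.2)) (t, x) :=
      ContMDiffAt.comp (g := fun q : ℝ × Ambient => F q.1 q.2) (f := fun q : ℝ × M => (q.1, j q.2))
        (t, x) (hF.smooth t _ (hj.mem x h).1).contMDiffAt h2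
    exact ContMDiffAt.comp (g := i) (f := fun q : ℝ × M => F q.1 (j q.2)) (t, x)
      (hi.contMDiffAt (openDisc_subset (hF.mem_openDisc t (hj.mem x h)))) h3
  · have h0 : x ∉ i '' cotangentDisc (lam / 2) := fun hx =>
      h (mem_openDisc_image_of_mem (by linarith) hx)
    have h1 : (fun q : ℝ × M => transplant lam i j (F q.1) q.2) =ᶠ[𝓝 (t, x)] Prod.snd := by
      filter_upwards [continuousAt_snd.preimage_mem_nhds
        ((hi.isClosed_image (by linarith)).isOpen_compl.mem_nhds h0)] with q hq
      exact hF.transplant_of_notMem hj hq q.1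
    exact contMDiffAt_snd.congr_of_eventuallyEq h1

theorem IsSupportedFamily.transplant_transplant (hF : IsSupportedFamily lam F)
    (hj : IsWeinsteinInverse lam i j)
    (hGF : ∀ t, ∀ p ∈ cotangentBundle, G t (F t p) = p) (t : ℝ) (x : M) :
    transplant lam i j (G t) (transplant lam i j (F t) x) = x := by
  by_cases h : x ∈ i '' openDisc lam
  · have h1 := hF.mem_openDisc t (hj.mem x h)
    rw [transplant_of_mem h, transplant_of_mem ⟨_, h1, rfl⟩, hj.left_inv _ h1,
      hGF t _ (hj.mem x h).1, hj.right_inv x h]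
  · rw [transplant, transplant, if_neg h, if_neg h]

/-- The diffeomorphism of the manifold which corresponds to a diffeomorphism of the cotangent
bundle with compact support. -/
def transplantDiffeo (hlam : 0 < lam) (hi : IsWeinsteinEmbedding η L lam i)
    (hj : IsWeinsteinInverse lam i j) (hF : IsSupportedFamily lam F) (hG : IsSupportedFamily lam G)
    (hGF : ∀ t, ∀ p ∈ cotangentBundle, G t (F t p) = p)
    (hFG : ∀ t, ∀ p ∈ cotangentBundle, F t (G t p) = p) (t : ℝ) : Diffeo M where
  toFun := transplant lam i j (F t)
  invFun := transplant lam i j (G t)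
  left_inv := hF.transplant_transplant hj hGF t
  right_inv := hG.transplant_transplant hj hFG t
  contMDiff_toFun := (hF.contMDiff_transplant hlam hi hj).comp
    (f := fun x : M => (t, x)) (contMDiff_const.prodMk contMDiff_id)
  contMDiff_invFun := (hG.contMDiff_transplant hlam hi hj).comp
    (f := fun x : M => (t, x)) (contMDiff_const.prodMk contMDiff_id)

/-- The transplant of a symplectic map is symplectic. -/
theorem IsSupportedFamily.transplant_symplectic (hF : IsSupportedFamily lam F) (hlam : 0 < lam)
    (hi : IsWeinsteinEmbedding η L lam i) (hj : IsWeinsteinInverse lam i j) {s : ℝ} {Ω : TwoForm M}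
    (hΩ : ∀ x ∈ i '' openDisc lam, ‖(j x).1‖ < 3 / 5 * lam → ∀ v w : TangentSpace (𝓡 4) x,
      Ω x ![v, w] = twistedForm s (j x) (mfderiv (𝓡 4) 𝓘(ℝ, Ambient) j x v)
        (mfderiv (𝓡 4) 𝓘(ℝ, Ambient) j x w)) {t : ℝ}
    (hFs : ∀ p ∈ cotangentBundle, ∀ X Y, IsTangentCotangent p X → IsTangentCotangent p Y →
      twistedForm s (F t p) (fderiv ℝ (F t) p X) (fderiv ℝ (F t) p Y) = twistedForm s p X Y)
    (x : M) (v w : TangentSpace (𝓡 4) x) :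
    Ω (transplant lam i j (F t) x) ![mfderiv (𝓡 4) (𝓡 4) (transplant lam i j (F t)) x v,
      mfderiv (𝓡 4) (𝓡 4) (transplant lam i j (F t)) x w] = Ω x ![v, w] := by
  by_cases h : x ∈ i '' openDisc lam ∧ ‖(j x).1‖ < 3 / 5 * lam
  · obtain ⟨h, hn⟩ := h
    have hT := (hj.mem x h).1
    have h1 := hF.mem_openDisc t (hj.mem x h)
    have h2 : ∀ y ∈ i '' openDisc lam, j (transplant lam i j (F t) y) = F t (j y) := fun y hy => by
      rw [transplant_of_mem hy, hj.left_inv _ (hF.mem_openDisc t (hj.mem y hy))]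
    have h3 : transplant lam i j (F t) x ∈ i '' openDisc lam := by
      rw [transplant_of_mem h]; exact ⟨_, h1, rfl⟩
    have hΦ : MDifferentiableAt (𝓡 4) (𝓡 4) (transplant lam i j (F t)) x :=
      (((hF.contMDiff_transplant hlam hi hj).comp
        (f := fun x : M => (t, x)) (contMDiff_const.prodMk contMDiff_id)) x).mdifferentiableAt
          (by simp)
    have hFd : DifferentiableAt ℝ (F t) (j x) := by
      have := (hF.smooth t _ hT).comp (f := fun p : Ambient => (t, p)) (j x)
        (contDiffAt_const.prodMk contDiffAt_id)
      exact this.differentiableAt (by simp)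
    have e1 : HasMFDerivAt (𝓡 4) 𝓘(ℝ, Ambient) (j ∘ transplant lam i j (F t)) x _ :=
      HasMFDerivAt.comp x (hj.mdifferentiableAt h3).hasMFDerivAt hΦ.hasMFDerivAt
    have e2 : HasMFDerivAt (𝓡 4) 𝓘(ℝ, Ambient) (F t ∘ j) x
        ((fderiv ℝ (F t) (j x)).comp (mfderiv (𝓡 4) 𝓘(ℝ, Ambient) j x)) :=
      HasMFDerivAt.comp x hFd.hasFDerivAt.hasMFDerivAt (hj.mdifferentiableAt h).hasMFDerivAt
    have e3 := hasMFDerivAt_unique e1 (e2.congr_of_eventuallyEq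
      (by filter_upwards [hj.mem_nhds h] with y hy using h2 y hy))
    have e4 : ∀ v : TangentSpace (𝓡 4) x, mfderiv (𝓡 4) 𝓘(ℝ, Ambient) j
        (transplant lam i j (F t) x) (mfderiv (𝓡 4) (𝓡 4) (transplant lam i j (F t)) x v) =
        fderiv ℝ (F t) (j x) (mfderiv (𝓡 4) 𝓘(ℝ, Ambient) j x v) :=
      fun v => congrArg (fun f : EuclideanSpace ℝ (Fin 4) →L[ℝ] Ambient => f v) e3
    rw [hΩ _ h3 (by rw [h2 x h, hF.norm_eq t _ hT]; exact hn), e4, e4, h2 x h,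
      hFs _ hT _ _ (hj.isTangentCotangent h v) (hj.isTangentCotangent h w), hΩ x h hn]
  · have h0 : x ∉ i '' cotangentDisc (lam / 2) := fun hx => by
      have hxo := mem_openDisc_image_of_mem (lam := lam) (by linarith) hx
      refine h ⟨hxo, ?_⟩
      obtain ⟨p, hp, rfl⟩ := hx
      have hpo : p ∈ openDisc lam := ⟨⟨hp.1, hp.2.1⟩, by linarith [hp.2.2]⟩
      rw [hj.left_inv p hpo]
      linarith [hp.2.2]
    have e1 : HasMFDerivAt (𝓡 4) (𝓡 4) (transplant lam i j (F t)) x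
        (ContinuousLinearMap.id ℝ (EuclideanSpace ℝ (Fin 4))) :=
      (hasMFDerivAt_id (I := 𝓡 4) x).congr_of_eventuallyEq (by
        filter_upwards [(hi.isClosed_image (c := lam / 2) (by linarith)).isOpen_compl.mem_nhds h0]
          with y hy using hF.transplant_of_notMem hj hy t)
    have e2 : ∀ v : TangentSpace (𝓡 4) x,
        mfderiv (𝓡 4) (𝓡 4) (transplant lam i j (F t)) x v = v := fun v =>
      congrArg (fun f : EuclideanSpace ℝ (Fin 4) →L[ℝ] EuclideanSpace ℝ (Fin 4) => f v) e1.mfderiv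
    rw [e2, e2]
    exact form_congr Ω (hF.transplant_of_notMem hj h0 t) v w

end Transplant

/-! ### The deformed symplectic forms -/

section Deform

set_option linter.unusedSectionVars false

open Filter Topology

/-- A smooth function which vanishes below `a` and equals `x⁻¹` above `b`. -/
theorem exists_cutoff_inv {a b : ℝ} (ha : 0 < a) (hab : a < b) : ∃ g : ℝ → ℝ, ContDiff ℝ ∞ g ∧
    (∀ x < a, g x = 0 ∧ deriv g x = 0) ∧ ∀ x, b < x → g x = x⁻¹ ∧ deriv g x = -(x ^ 2)⁻¹ := by
  let g : ℝ → ℝ := fun x => Real.smoothTransition ((x - a) / (b - a)) * x⁻¹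
  have hba : 0 < b - a := by linarith
  have h0 : ∀ x < a, g x = 0 := fun x hx => by
    simp only [g]
    rw [Real.smoothTransition.zero_of_nonpos (div_nonpos_of_nonpos_of_nonneg (by linarith) hba.le),
      zero_mul]
  have h1 : ∀ x, b < x → g x = x⁻¹ := fun x hx => by
    simp only [g]
    rw [Real.smoothTransition.one_of_one_le ((one_le_div hba).2 (by linarith)), one_mul]
  have e0 : ∀ x < a, g =ᶠ[𝓝 x] fun _ => 0 := fun x hx => by
    filter_upwards [isOpen_Iio.mem_nhds hx] with y hy using h0 y hy
  have e1 : ∀ x, b < x → g =ᶠ[𝓝 x] fun x => x⁻¹ := fun x hx => by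
    filter_upwards [isOpen_Ioi.mem_nhds hx] with y hy using h1 y hy
  refine ⟨g, ?_, fun x hx => ⟨h0 x hx, ?_⟩, fun x hx => ⟨h1 x hx, ?_⟩⟩
  · rw [contDiff_iff_contDiffAt]
    intro x
    by_cases hx : x < a
    · exact contDiffAt_const.congr_of_eventuallyEq (e0 x hx)
    · have hx0 : x ≠ 0 := by linarith
      have h2 : ContDiffAt ℝ ∞ (fun x => Real.smoothTransition ((x - a) / (b - a))) x :=
        Real.smoothTransition.contDiffAt.comp x
          ((contDiffAt_id.sub contDiffAt_const).div_const _)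
      exact h2.mul (contDiffAt_id.inv hx0)
  · rw [(e0 x hx).deriv_eq, deriv_const]
  · rw [(e1 x hx).deriv_eq, deriv_inv]

variable {M : Type*} [TopologicalSpace M] [T2Space M] [CompactSpace M]
  [ChartedSpace (EuclideanSpace ℝ (Fin 4)) M] [IsManifold (𝓡 4) ∞ M]
  {η : TwoForm M} {L : Set M} {lam : ℝ} {i : Ambient → M} {j : M → Ambient} {g : ℝ → ℝ}

open Classical in
/-- The two-form `thomForm g`, transported to the manifold and extended by zero. -/
def thomTwoForm (lam : ℝ) (g : ℝ → ℝ) (i : Ambient → M) (j : M → Ambient) : TwoForm M := fun x =>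
  if x ∈ i '' cotangentDisc (4 / 5 * lam) then
    (thomForm g (j x)).compContinuousLinearMap (mfderiv (𝓡 4) 𝓘(ℝ, Ambient) j x) else 0

/-- The conditions on the cutoff function `g` which make `thomForm g` equal to the base form near
the zero-section, and zero at the boundary of the disc bundle. -/
structure IsThomCutoff (lam : ℝ) (g : ℝ → ℝ) : Prop where
  smooth : ContDiff ℝ ∞ g
  inner : ∀ x < (3 / 5 * lam) ^ 2, g x = 0 ∧ deriv g x = 0
  outer : ∀ x, (7 / 10 * lam) ^ 2 < x → g x = x⁻¹ ∧ deriv g x = -(x ^ 2)⁻¹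

theorem exists_isThomCutoff (hlam : 0 < lam) : ∃ g, IsThomCutoff lam g := by
  obtain ⟨g, h1, h2, h3⟩ := exists_cutoff_inv (a := (3 / 5 * lam) ^ 2) (b := (7 / 10 * lam) ^ 2)
    (by positivity) (by nlinarith)
  exact ⟨g, h1, h2, h3⟩

theorem thomTwoForm_of_mem (hlam : 0 < lam) (hg : IsThomCutoff lam g)
    (hj : IsWeinsteinInverse lam i j) {x : M} (hx : x ∈ i '' openDisc lam)
    (v w : TangentSpace (𝓡 4) x) : thomTwoForm lam g i j x ![v, w] = thomForm g (j x)
      ![mfderiv (𝓡 4) 𝓘(ℝ, Ambient) j x v, mfderiv (𝓡 4) 𝓘(ℝ, Ambient) j x w] := by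
  rw [thomTwoForm]
  split_ifs with h
  · exact compContinuousLinearMap_apply_pair (E := EuclideanSpace ℝ (Fin 4)) (F := Ambient) _ _ v w
  · have hT := hj.mem x hx
    have hn : 4 / 5 * lam < ‖(j x).1‖ := by
      by_contra! hle
      exact h ⟨j x, ⟨hT.1.1, hT.1.2, hle⟩, hj.right_inv x hx⟩
    have h7 : (7 / 10 * lam) ^ 2 < ‖(j x).1‖ ^ 2 := by gcongr; linarith
    have h0 := thomForm_of_eq_inv hg.smooth hT.1
      (norm_pos_iff.1 (by linarith [mul_pos (show (0 : ℝ) < 4 / 5 by norm_num) hlam]))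
      (hg.outer _ h7).1 (hg.outer _ h7).2 (hj.isTangentCotangent hx v) (hj.isTangentCotangent hx w)
    exact h0.symm

/-- Near the zero-section the deformed form is the twisted form on the cotangent bundle. -/
theorem add_thomTwoForm_eq (hlam : 0 < lam) (hg : IsThomCutoff lam g)
    (hi : IsWeinsteinEmbedding η L lam i)
    (hj : IsWeinsteinInverse lam i j) (s : ℝ) {x : M} (hx : x ∈ i '' openDisc lam)
    (hn : ‖(j x).1‖ < 3 / 5 * lam) (v w : TangentSpace (𝓡 4) x) :
    (η x + s • thomTwoForm lam g i j x) ![v, w] =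
      twistedForm s (j x) (mfderiv (𝓡 4) 𝓘(ℝ, Ambient) j x v)
        (mfderiv (𝓡 4) 𝓘(ℝ, Ambient) j x w) := by
  have h1 : (η x + s • thomTwoForm lam g i j x) ![v, w] =
    η x ![v, w] + s * thomTwoForm lam g i j x ![v, w] := rfl
  have h2 : ‖(j x).1‖ ^ 2 < (3 / 5 * lam) ^ 2 := by gcongr
  rw [h1, hj.form_eq hi hx, thomTwoForm_of_mem hlam hg hj hx]
  have h3 := thomForm_of_eq_zero hg.smooth (hg.inner _ h2).1 (hg.inner _ h2).2
    (mfderiv (𝓡 4) 𝓘(ℝ, Ambient) j x v) (mfderiv (𝓡 4) 𝓘(ℝ, Ambient) j x w)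
  exact congrArg (fun a => stdForm _ _ + s * a) h3

theorem inChart_thomTwoForm (hlam : 0 < lam) (hg : IsThomCutoff lam g)
    (hi : IsWeinsteinEmbedding η L lam i) (hj : IsWeinsteinInverse lam i j) (c : M)
    {y : EuclideanSpace ℝ (Fin 4)} (hy : y ∈ (extChartAt (𝓡 4) c).target) :
    ContDiffAt ℝ ∞ (TwoForm.inChart (thomTwoForm lam g i j) c) y ∧
      extDeriv (TwoForm.inChart (thomTwoForm lam g i j) c) y = 0 := by
  have hs := (contMDiffOn_extChartAt_symm (n := ∞) (I := 𝓡 4) c).contMDiffAt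
    ((isOpen_extChartAt_target c).mem_nhds hy)
  by_cases h : (extChartAt (𝓡 4) c).symm y ∈ i '' openDisc lam
  · have hU : ∀ᶠ z in 𝓝 y, z ∈ (extChartAt (𝓡 4) c).target ∧
        (extChartAt (𝓡 4) c).symm z ∈ i '' openDisc lam :=
      ((isOpen_extChartAt_target c).eventually_mem hy).and
        (hs.continuousAt.preimage_mem_nhds (hj.mem_nhds h))
    let k : EuclideanSpace ℝ (Fin 4) → Ambient := fun z => j ((extChartAt (𝓡 4) c).symm z)
    have hk : ContDiffAt ℝ ∞ k y := ((hj.smooth _ h).comp y hs).contDiffAt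
    have hd : ∀ z, z ∈ (extChartAt (𝓡 4) c).target →
        (extChartAt (𝓡 4) c).symm z ∈ i '' openDisc lam → ∀ X, fderiv ℝ k z X =
        mfderiv (𝓡 4) 𝓘(ℝ, Ambient) j ((extChartAt (𝓡 4) c).symm z)
          (mfderiv 𝓘(ℝ, EuclideanSpace ℝ (Fin 4)) (𝓡 4) (extChartAt (𝓡 4) c).symm z X) := by
      intro z hz hzo X
      have h1 : HasMFDerivAt 𝓘(ℝ, EuclideanSpace ℝ (Fin 4)) 𝓘(ℝ, Ambient)
          (j ∘ (extChartAt (𝓡 4) c).symm) z _ :=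
        HasMFDerivAt.comp z (hj.mdifferentiableAt hzo).hasMFDerivAt
          (mdifferentiableAt_extChartAt_symm hz).hasMFDerivAt
      have h2 := h1.mfderiv
      rw [mfderiv_eq_fderiv] at h2
      exact congrArg (fun f : EuclideanSpace ℝ (Fin 4) →L[ℝ] Ambient => f X) h2
    have heq : TwoForm.inChart (thomTwoForm lam g i j) c =ᶠ[𝓝 y]
        fun z => (thomForm g (k z)).compContinuousLinearMap (fderiv ℝ k z) := by
      filter_upwards [hU] with z hz
      refine form_ext fun X Y => ?_
      rw [inChart_apply, thomTwoForm_of_mem hlam hg hj hz.2, compContinuousLinearMap_apply_pair,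
        hd z hz.1 hz.2, hd z hz.1 hz.2]
    have hth := contDiff_thomForm hg.smooth
    refine ⟨(contDiffAt_pullback hth.contDiffAt hk).congr_of_eventuallyEq heq, ?_⟩
    rw [heq.extDeriv_eq (𝕜 := ℝ)]
    have h3 := extDeriv_pullback (r := ∞) (f := k) (x := y)
      (hth.differentiable (by simp) (k y)) hk
      (by rw [minSmoothness_of_isRCLikeNormedField]; exact two_le_infty)
    rw [h3]
    ext v
    rw [ContinuousAlternatingMap.compContinuousLinearMap_apply]
    have h4 : (fderiv ℝ k y ∘ v) =
        ![fderiv ℝ k y (v 0), fderiv ℝ k y (v 1), fderiv ℝ k y (v 2)] := by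
      funext a; fin_cases a <;> rfl
    have h5 : ∀ X, (inner ℝ (k y).2 (fderiv ℝ k y X).2 : ℝ) = 0 := fun X => by
      rw [hd y hy h]; exact (hj.isTangentCotangent h _).2
    rw [h4, extDeriv_thomForm hg.smooth (hj.mem _ h).1.2 (h5 _) (h5 _) (h5 _)]
    rfl
  · have h0 : (extChartAt (𝓡 4) c).symm y ∉ i '' cotangentDisc (4 / 5 * lam) := fun hx =>
      h (mem_openDisc_image_of_mem (by linarith) hx)
    have heq : TwoForm.inChart (thomTwoForm lam g i j) c =ᶠ[𝓝 y] fun _ => 0 := by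
      filter_upwards [hs.continuousAt.preimage_mem_nhds
        ((hi.isClosed_image (by linarith)).isOpen_compl.mem_nhds h0)] with z hz
      refine form_ext fun X Y => ?_
      rw [inChart_apply, thomTwoForm, if_neg hz]
      rfl
    refine ⟨contDiffAt_const.congr_of_eventuallyEq heq, ?_⟩
    rw [heq.extDeriv_eq (𝕜 := ℝ)]
    simp only [extDeriv, fderiv_fun_const, Pi.zero_apply]
    ext v
    simp [ContinuousAlternatingMap.alternatizeUncurryFin_apply]

theorem inChart_add_smul (σ τ : TwoForm M) (s : ℝ) (c : M) (y : EuclideanSpace ℝ (Fin 4)) :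
    TwoForm.inChart (fun x => σ x + s • τ x) c y =
      TwoForm.inChart σ c y + s • TwoForm.inChart τ c y := by
  refine form_ext fun X Y => ?_
  rw [ContinuousAlternatingMap.add_apply, ContinuousAlternatingMap.smul_apply, inChart_apply,
    inChart_apply, inChart_apply]
  rfl

theorem injective_toBilin_iff {E F : Type*} [NormedAddCommGroup E] [NormedSpace ℝ E]
    [NormedAddCommGroup F] [NormedSpace ℝ F] {σ : E [⋀^Fin 2]→L[ℝ] ℝ} {σ' : F [⋀^Fin 2]→L[ℝ] ℝ}
    (D : E ≃L[ℝ] F) (h : ∀ X Y, σ ![X, Y] = σ' ![D X, D Y]) :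
    Function.Injective (toBilin σ) ↔ ∀ v, (∀ w, σ' ![v, w] = 0) → v = 0 := by
  rw [injective_iff_map_eq_zero]
  constructor
  · intro hi v hv
    have := hi (D.symm v) (by
      ext w
      rw [toBilin_apply, h, D.apply_symm_apply, hv]
      rfl)
    have h2 := congrArg D this
    rwa [D.apply_symm_apply, map_zero] at h2
  · intro hi a ha
    have := hi (D a) fun w => by
      have h1 := h a (D.symm w)
      rw [← toBilin_apply, ha, D.apply_symm_apply] at h1
      exact h1.symm
    have h2 := congrArg D.symm this
    rwa [D.symm_apply_apply, map_zero] at h2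

/-- Nondegeneracy at a point can be tested in a chart. -/
theorem injective_inChart_iff (σ : TwoForm M) (c : M) {y : EuclideanSpace ℝ (Fin 4)}
    (hy : y ∈ (extChartAt (𝓡 4) c).target) :
    Function.Injective (toBilin (TwoForm.inChart σ c y)) ↔
      ∀ v : TangentSpace (𝓡 4) ((extChartAt (𝓡 4) c).symm y),
        (∀ w : TangentSpace (𝓡 4) ((extChartAt (𝓡 4) c).symm y),
          σ ((extChartAt (𝓡 4) c).symm y) ![v, w] = 0) → v = 0 := by
  have hinv := isInvertible_mfderivWithin_extChartAt_symm (I := 𝓡 4) (x := c) hy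
  rw [ModelWithCorners.range_eq_univ, mfderivWithin_univ] at hinv
  obtain ⟨D, hD⟩ := hinv
  refine injective_toBilin_iff (E := EuclideanSpace ℝ (Fin 4)) (F := EuclideanSpace ℝ (Fin 4))
    (σ := TwoForm.inChart σ c y) (σ' := σ ((extChartAt (𝓡 4) c).symm y)) D fun X Y => ?_
  rw [inChart_apply, ← hD]
  rfl

/-- A small multiple of a smooth two-form may be added to a symplectic form on a compact manifold
without losing nondegeneracy. -/
theorem eventually_nondegenerate (hη : IsSymplecticForm η) {τ : TwoForm M}
    (hτ : ∀ c : M, ContDiffOn ℝ ∞ (TwoForm.inChart τ c) (extChartAt (𝓡 4) c).target) :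
    ∀ᶠ s in 𝓝 (0 : ℝ), ∀ (x : M) (v : TangentSpace (𝓡 4) x),
      (∀ w : TangentSpace (𝓡 4) x, (η x + s • τ x) ![v, w] = 0) → v = 0 := by
  let P : ℝ → M → Prop := fun s x => ∀ v : TangentSpace (𝓡 4) x,
      (∀ w : TangentSpace (𝓡 4) x, (η x + s • τ x) ![v, w] = 0) → v = 0
  have hloc : ∀ x ∈ (Set.univ : Set M), ∀ᶠ z : ℝ × M in 𝓝 (0, x), P z.1 z.2 := by
    intro c _
    let y := extChartAt (𝓡 4) c c
    have hy : y ∈ (extChartAt (𝓡 4) c).target := mem_extChartAt_target c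
    let B : ℝ × EuclideanSpace ℝ (Fin 4) → EuclideanSpace ℝ (Fin 4) →L[ℝ]
        EuclideanSpace ℝ (Fin 4) →L[ℝ] ℝ := fun q =>
      toBilin (TwoForm.inChart η c q.2 + q.1 • TwoForm.inChart τ c q.2)
    have hB : ContinuousAt B (0, y) := by
      have hnhds := extChartAt_target_mem_nhds (I := 𝓡 4) c
      have h1 : ContinuousAt (TwoForm.inChart η c) y :=
        (hη.smooth c).continuousOn.continuousAt hnhds
      have h2 : ContinuousAt (TwoForm.inChart τ c) y := (hτ c).continuousOn.continuousAt hnhds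
      have h3 : ContinuousAt (fun q : ℝ × EuclideanSpace ℝ (Fin 4) => TwoForm.inChart η c q.2)
        (0, y) := ContinuousAt.comp (g := TwoForm.inChart η c) h1 continuousAt_snd
      have h4 : ContinuousAt (fun q : ℝ × EuclideanSpace ℝ (Fin 4) => TwoForm.inChart τ c q.2)
        (0, y) := ContinuousAt.comp (g := TwoForm.inChart τ c) h2 continuousAt_snd
      exact contDiff_toBilin.continuous.continuousAt.comp (h3.add (continuousAt_fst.smul h4))
    have hB0 : Function.Injective (B (0, y)) := by
      have : B (0, y) = toBilin (TwoForm.inChart η c y) := by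
        simp only [B, zero_smul, add_zero]
      rw [this, injective_inChart_iff η c hy]
      exact hη.nondegenerate _
    have hev := hB.eventually (ContinuousLinearMap.isOpen_injective.mem_nhds hB0)
    have ht : Tendsto (fun z : ℝ × M => (z.1, extChartAt (𝓡 4) c z.2)) (𝓝 (0, c)) (𝓝 (0, y)) := by
      have h1 : ContinuousAt (fun z : ℝ × M => extChartAt (𝓡 4) c z.2) (0, c) :=
        ContinuousAt.comp (g := extChartAt (𝓡 4) c) (continuousAt_extChartAt c) continuousAt_snd
      exact continuousAt_fst.prodMk h1
    filter_upwards [ht.eventually hev, continuousAt_snd.preimage_mem_nhds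
      (extChartAt_source_mem_nhds (I := 𝓡 4) c)] with z hz hzs
    have h1 : Function.Injective (toBilin (TwoForm.inChart (fun x => η x + z.1 • τ x) c
      (extChartAt (𝓡 4) c z.2))) := by rw [inChart_add_smul]; exact hz
    rw [injective_inChart_iff _ c ((extChartAt (𝓡 4) c).map_source hzs)] at h1
    have h2 : P z.1 ((extChartAt (𝓡 4) c).symm (extChartAt (𝓡 4) c z.2)) := h1
    rwa [(extChartAt (𝓡 4) c).left_inv hzs] at h2
  filter_upwards [isCompact_univ.eventually_forall_of_forall_eventually (P := P) hloc] with s hs x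
  exact hs x (Set.mem_univ x)

end Deform

/-! ### Squares of Dehn twists are potentially fragile -/

section Fragile

set_option linter.unusedSectionVars false

open Filter Topology

theorem crossL_smul_self (c : ℝ) (m : R3) : crossL (c • m) m = 0 := by
  rw [map_smul, smul_apply, crossL_self, smul_zero]

/-- The rotation field of a map which commutes with the moment map leaves the moment unchanged. -/
theorem moment_rotPair_smul (s c : ℝ) (p : Ambient) :
    moment s (rotPair (c • moment s p) p) = moment s p := by
  rw [moment_rotPair, rot_of_crossL_eq_zero (crossL_smul_self c _)]

theorem rotPair_neg_rotPair (w : R3) (p : Ambient) : rotPair (-w) (rotPair w p) = p := by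
  simp [rotPair, rot_neg_apply_rot]

/-- A family of rotation fields `a t p • moment (σ t) p`, where the factor `a t p` depends on `p`
through the moment only, gives rise to a supported family. -/
theorem isSupportedFamily_rotPair {lam : ℝ} {σ : ℝ → ℝ} {a : ℝ → R3 → ℝ}
    (hs : ∀ t, ∀ p ∈ cotangentBundle, ContDiffAt ℝ ∞
      (fun q : ℝ × Ambient => a q.1 (moment (σ q.1) q.2) • moment (σ q.1) q.2) (t, p))
    (h1 : ∀ t, ∀ p ∈ cotangentBundle, lam / 2 ≤ ‖moment (σ t) p‖ →
      rotPair (a t (moment (σ t) p) • moment (σ t) p) p = p) :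
    IsSupportedFamily lam fun t p => rotPair (a t (moment (σ t) p) • moment (σ t) p) p where
  smooth t p hp := contDiffAt_rotPair (hs t p hp) contDiffAt_snd
  mem t p hp := rotPair_mem_cotangentBundle hp
  norm_eq t p hp := by simp [rotPair]
  eq_self t p hp h := h1 t p hp (h.trans (norm_le_norm_moment _ hp))

variable {M : Type*} [TopologicalSpace M] [T2Space M] [CompactSpace M]
  [ChartedSpace (EuclideanSpace ℝ (Fin 4)) M] [IsManifold (𝓡 4) ∞ M]
  {η : TwoForm M} {L : Set M} {lam : ℝ} {i : Ambient → M} {j : M → Ambient}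

/-- The diffeomorphisms of the manifold defined by rotation fields along the moment map. -/
theorem exists_diffeo_rotPair (hlam : 0 < lam) (hi : IsWeinsteinEmbedding η L lam i)
    (hj : IsWeinsteinInverse lam i j) {σ : ℝ → ℝ} {a : ℝ → R3 → ℝ}
    (hs : ∀ t, ∀ p ∈ cotangentBundle, ContDiffAt ℝ ∞
      (fun q : ℝ × Ambient => a q.1 (moment (σ q.1) q.2) • moment (σ q.1) q.2) (t, p))
    (h1 : ∀ t, ∀ p ∈ cotangentBundle, lam / 2 ≤ ‖moment (σ t) p‖ →
      rotPair (a t (moment (σ t) p) • moment (σ t) p) p = p) :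
    ∃ Φ : ℝ → Diffeo M, ∀ t x, Φ t x = transplant lam i j
      (fun p => rotPair (a t (moment (σ t) p) • moment (σ t) p) p) x := by
  have hF := isSupportedFamily_rotPair hs h1
  have hG : IsSupportedFamily lam
      fun t p => rotPair (-a t (moment (σ t) p) • moment (σ t) p) p := by
    refine isSupportedFamily_rotPair (a := fun t m => -a t m)
      (fun t p hp => ?_) fun t p hp h => ?_
    · have := (hs t p hp).neg
      simpa only [neg_smul] using this
    · have h2 := rotPair_neg_rotPair (a t (moment (σ t) p) • moment (σ t) p) p
      rw [h1 t p hp h] at h2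
      rw [neg_smul]
      exact h2
  refine ⟨transplantDiffeo hlam hi hj hF hG (fun t p _ => ?_) (fun t p _ => ?_),
    fun t x => rfl⟩
  · simp only [moment_rotPair_smul]
    rw [neg_smul, rotPair_neg_rotPair]
  · simp only [moment_rotPair_smul]
    have := rotPair_neg_rotPair (-a t (moment (σ t) p) • moment (σ t) p) p
    rwa [neg_smul, neg_neg, ← neg_smul] at this

theorem norm_modelTwist {r : ℝ → ℝ} {p : Ambient} (hp : p ∈ cotangentBundle) :
    modelTwist r p ∈ cotangentBundle ∧ ‖(modelTwist r p).1‖ = ‖p.1‖ := by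
  by_cases hu : p.1 = 0
  · have hn : ‖p.2‖ = 1 := hp.2
    rw [modelTwist, if_pos hu]
    exact ⟨⟨by simp, by simpa using hn⟩, by simp [hu]⟩
  · rw [modelTwist, if_neg hu, geodesicFlow_eq_rotPair hp hu]
    exact ⟨rotPair_mem_cotangentBundle hp, by simp [rotPair]⟩

theorem potentiallyFragile_sq (hη : IsSymplecticForm η) {τ : M → M} (hτ : IsDehnTwist η L τ) :
    PotentiallyFragile η (τ ∘ τ) := by
  obtain ⟨lam, i, r, hlam, hi, hr, hτ1, hτ2⟩ := hτ
  obtain ⟨j, hj⟩ := hi.exists_inverse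
  obtain ⟨g, hg⟩ := exists_isThomCutoff hlam
  obtain ⟨k, hk, hke, hkr⟩ := hr.exists_factor
  have hsm : ∀ c : M, ContDiffOn ℝ ∞ (TwoForm.inChart (thomTwoForm lam g i j) c)
      (extChartAt (𝓡 4) c).target := fun c y hy =>
    (inChart_thomTwoForm hlam hg hi hj c hy).1.contDiffWithinAt
  obtain ⟨ε, hε, hnd⟩ := Metric.eventually_nhds_iff.1 (eventually_nondegenerate hη hsm)
  have hlam2 : 0 < lam / 2 := by linarith
  have hm0 : ∀ m : R3, lam / 2 ≤ ‖m‖ → m ≠ 0 := fun m hm => norm_pos_iff.1 (hlam2.trans_le hm)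
  have hsqid : ∀ m p, lam / 2 ≤ ‖m‖ → rotPair (sqField k m) p = p := fun m p hm => by
    rw [rotPair_sqField_eq_isoField hkr (hm0 m hm), isoField_eq_zero hr 1 hm, rotPair_zero]
  -- the family of diffeomorphisms
  obtain ⟨Φ, hΦ⟩ := exists_diffeo_rotPair hlam hi hj (σ := id)
    (a := fun _ m => -(2 * Real.pi * k ‖m‖)) (fun t p _ => by
      have := ((contDiff_sqField hk hke).comp contDiff_moment).contDiffAt (x := (t, p))
      exact this) (fun t p hp h => hsqid _ p h)
  have hsup : IsSupportedFamily lam fun t p => rotPair (sqField k (moment t p)) p :=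
    isSupportedFamily_rotPair (σ := id) (a := fun _ m => -(2 * Real.pi * k ‖m‖)) (fun t p _ => by
      have := ((contDiff_sqField hk hke).comp contDiff_moment).contDiffAt (x := (t, p))
      exact this) (fun t p hp h => hsqid _ p h)
  have hΦ' : ∀ t, ⇑(Φ t) = transplant lam i j fun p => rotPair (sqField k (moment t p)) p :=
    fun t => funext fun x => hΦ t x
  refine ⟨ε, hε, fun s x => η x + s • thomTwoForm lam g i j x, Φ, ?_, ?_, ?_, ?_, ?_, ?_, ?_⟩
  · intro c
    simp only [inChart_add_smul]
    have hsub : Set.MapsTo (Prod.snd : ℝ × EuclideanSpace ℝ (Fin 4) → _)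
        (Set.Ico 0 ε ×ˢ (extChartAt (𝓡 4) c).target) (extChartAt (𝓡 4) c).target :=
      fun q hq => hq.2
    exact ((hη.smooth c).comp contDiffOn_snd hsub).add
      (contDiffOn_fst.smul ((hsm c).comp contDiffOn_snd hsub))
  · intro s hs
    refine ⟨fun c => ?_, fun c y hy => ?_, ?_⟩
    · have h1 : TwoForm.inChart (fun x => η x + s • thomTwoForm lam g i j x) c =
        fun y => TwoForm.inChart η c y + s • TwoForm.inChart (thomTwoForm lam g i j) c y :=
        funext fun y => inChart_add_smul _ _ s c y
      rw [h1]
      exact (hη.smooth c).add ((hsm c).const_smul s)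
    · have h1 : TwoForm.inChart (fun x => η x + s • thomTwoForm lam g i j x) c =
        fun y => TwoForm.inChart η c y + s • TwoForm.inChart (thomTwoForm lam g i j) c y :=
        funext fun y => inChart_add_smul _ _ s c y
      have h2 := inChart_thomTwoForm hlam hg hi hj c hy
      have h3 := h2.1.differentiableAt (by simp)
      have h4 := ((hη.smooth c).contDiffAt
        ((isOpen_extChartAt_target c).mem_nhds hy)).differentiableAt (by simp)
      have h5 := extDeriv_fun_add h4 (h3.const_smul s)
      have h6 := extDeriv_fun_smul s (TwoForm.inChart (thomTwoForm lam g i j) c) (x := y)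
      rw [h1]
      refine h5.trans ?_
      rw [h6, hη.closed c y hy, h2.2, smul_zero, add_zero]
    · refine hnd ?_
      rw [Real.dist_eq, sub_zero, abs_of_nonneg hs.1]
      exact hs.2
  · have h1 : (fun q : ℝ × M => Φ q.1 q.2) = fun q =>
        transplant lam i j (fun p => rotPair (sqField k (moment q.1 p)) p) q.2 :=
      funext fun q => hΦ q.1 q.2
    have h2 := hsup.contMDiff_transplant hlam hi hj
    rw [SmoothDiffeoFamily, h1]
    exact h2.contMDiffOn
  · intro s hs x v w
    rw [hΦ' s]
    refine hsup.transplant_symplectic hlam hi hj (s := s) (t := s)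
      (Ω := fun x => η x + s • thomTwoForm lam g i j x)
      (fun x hx hn v w => add_thomTwoForm_eq hlam hg hi hj s hx hn v w) ?_ x v w
    intro p hp X Y hX hY
    exact twistedForm_rotPair hp (contDiff_sqField hk hke).contDiffAt
      (fun m => crossL_smul_self _ m) (sqField_symmetric hk hke _) hX hY
  · intro x
    simp only [zero_smul, add_zero]
  · intro x
    have hττ : ∀ p ∈ cotangentDisc lam, τ (τ (i p)) = i (rotPair (sqField k (moment 0 p)) p) := by
      intro p hp
      have hpT : p ∈ cotangentBundle := ⟨hp.1, hp.2.1⟩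
      have h1 := norm_modelTwist (r := r) hpT
      rw [hτ1 p hp, hτ1 _ ⟨h1.1.1, h1.1.2, h1.2.trans_le hp.2.2⟩, modelTwist_modelTwist hkr hpT]
    rw [hΦ']
    by_cases h : x ∈ i '' openDisc lam
    · rw [transplant_of_mem h, Function.comp_apply, ← hττ _ (openDisc_subset (hj.mem x h)),
        hj.right_inv x h]
    · rw [transplant, if_neg h, Function.comp_apply]
      by_cases h' : x ∈ i '' cotangentDisc lam
      · obtain ⟨p, hp, rfl⟩ := h'
        have hpT : p ∈ cotangentBundle := ⟨hp.1, hp.2.1⟩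
        have hn : lam ≤ ‖p.1‖ := by
          by_contra! hlt
          exact h ⟨p, ⟨hpT, hlt⟩, rfl⟩
        rw [hττ p hp, hsqid]
        rw [norm_moment_zero hpT]; linarith
      · rw [hτ2 x h', hτ2 x h']
  · intro s hs
    have hs0 : s ≠ 0 := hs.1.ne'
    have hisoS : ∀ t, ∀ p ∈ cotangentBundle, ContDiffAt ℝ ∞
        (fun q : ℝ × Ambient => isoField r q.1 (moment s q.2)) (t, p) := fun t p hp => by
      have h1 : ContDiffAt ℝ ∞ (fun q : ℝ × Ambient => (q.1, moment s q.2)) (t, p) :=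
        contDiffAt_fst.prodMk ((contDiff_moment_right s).contDiffAt.comp (t, p) contDiffAt_snd)
      exact ContDiffAt.comp (g := fun q : ℝ × R3 => isoField r q.1 q.2) (t, p)
        (contDiffAt_isoField hr.smooth t (norm_moment_pos hp (Or.inr hs0))) h1
    have hiso1 : ∀ t, ∀ p ∈ cotangentBundle, lam / 2 ≤ ‖moment s p‖ →
        rotPair (isoField r t (moment s p)) p = p := fun t p hp h => by
      rw [isoField_eq_zero hr t h, rotPair_zero]
    obtain ⟨Ψ, hΨ⟩ := exists_diffeo_rotPair hlam hi hj (σ := fun _ => s)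
      (a := fun t m => -(t * (4 * Real.pi * deriv r ‖m‖ / ‖m‖))) hisoS hiso1
    have hisup : IsSupportedFamily lam fun t p => rotPair (isoField r t (moment s p)) p :=
      isSupportedFamily_rotPair (σ := fun _ => s)
        (a := fun t m => -(t * (4 * Real.pi * deriv r ‖m‖ / ‖m‖))) hisoS hiso1
    have hΨ' : ∀ t, ⇑(Ψ t) = transplant lam i j fun p => rotPair (isoField r t (moment s p)) p :=
      fun t => funext fun x => hΨ t x
    refine ⟨Ψ, ?_, ?_, ?_, ?_⟩
    · have h1 : (fun q : ℝ × M => Ψ q.1 q.2) = fun q =>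
          transplant lam i j (fun p => rotPair (isoField r q.1 (moment s p)) p) q.2 :=
        funext fun q => hΨ q.1 q.2
      have h2 := hisup.contMDiff_transplant hlam hi hj
      rw [SmoothDiffeoFamily, h1]
      exact h2.contMDiffOn
    · intro t _ x v w
      rw [hΨ' t]
      refine hisup.transplant_symplectic hlam hi hj (s := s) (t := t)
        (Ω := fun x => η x + s • thomTwoForm lam g i j x)
        (fun x hx hn v w => add_thomTwoForm_eq hlam hg hi hj s hx hn v w) ?_ x v w
      intro p hp X Y hX hY
      have hm := norm_moment_pos hp (Or.inr hs0)
      have hA : ContDiffAt ℝ ∞ (isoField r t) (moment s p) :=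
        (contDiffAt_isoField hr.smooth t hm).comp (f := fun m : R3 => (t, m)) (moment s p)
          (contDiffAt_const.prodMk contDiffAt_id)
      exact twistedForm_rotPair hp hA (fun m => crossL_smul_self _ m)
        (isoField_symmetric hr.smooth t hm) hX hY
    · intro x
      rw [hΨ']
      by_cases h : x ∈ i '' openDisc lam
      · rw [transplant_of_mem h]
        simp only [isoField, zero_mul, neg_zero, zero_smul, rotPair_zero]
        exact hj.right_inv x h
      · rw [transplant, if_neg h]
    · intro x
      rw [hΨ', hΦ']
      by_cases h : x ∈ i '' openDisc lam
      · rw [transplant_of_mem h, transplant_of_mem h,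
          rotPair_sqField_eq_isoField hkr (norm_moment_pos (hj.mem x h).1 (Or.inr hs0))]
      · rw [transplant, transplant, if_neg h, if_neg h]

end Fragile

/-! ### Extending the parametrization of an embedded sphere -/

section Sphere

set_option linter.unusedSectionVars false

open Filter Topology

/-- The unit sphere of `ℝ³`. -/
abbrev Sph : Type := Metric.sphere (0 : EuclideanSpace ℝ (Fin 3)) 1

theorem norm_normalize {v : R3} (hv : v ≠ 0) : ‖‖v‖⁻¹ • v‖ = 1 := by
  rw [norm_smul, norm_inv, norm_norm, inv_mul_cancel₀ (norm_ne_zero_iff.2 hv)]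

open Classical in
/-- The radial projection onto the unit sphere; its value at the origin is irrelevant. -/
def sphereProj (v : R3) : Sph :=
  if h : v = 0 then ⟨EuclideanSpace.single 0 1, by simp⟩ else ⟨‖v‖⁻¹ • v, by simpa using norm_normalize h⟩

theorem coe_sphereProj {v : R3} (hv : v ≠ 0) : (sphereProj v : R3) = ‖v‖⁻¹ • v := by
  rw [sphereProj, dif_neg hv]

theorem sphereProj_coe (q : Sph) : sphereProj q = q := by
  have hq : ‖(q : R3)‖ = 1 := by simp
  have h0 : (q : R3) ≠ 0 := fun h => by rw [h] at hq; simp at hq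
  ext1
  rw [coe_sphereProj h0, hq]
  simp

theorem sphereProj_smul {t : ℝ} (ht : 0 < t) {v : R3} (hv : v ≠ 0) :
    sphereProj (t • v) = sphereProj v := by
  ext1
  rw [coe_sphereProj hv, coe_sphereProj (smul_ne_zero ht.ne' hv), norm_smul, Real.norm_eq_abs,
    abs_of_pos ht, smul_smul]
  congr 1
  field_simp

theorem contMDiffAt_sphereProj {v : R3} (hv : v ≠ 0) :
    ContMDiffAt 𝓘(ℝ, R3) (𝓡 2) ∞ sphereProj v := by
  let U : TopologicalSpace.Opens R3 := ⟨{w | w ≠ 0}, isOpen_ne⟩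
  have h1 : ContMDiff 𝓘(ℝ, R3) 𝓘(ℝ, R3) ∞ (fun w : U => ‖(w : R3)‖⁻¹ • (w : R3)) := by
    intro w
    have hw : (w : R3) ≠ 0 := w.2
    have h2 : ContDiffAt ℝ ∞ (fun w : R3 => ‖w‖⁻¹ • w) w :=
      ((contDiffAt_id.norm ℝ hw).inv (norm_ne_zero_iff.2 hw)).smul contDiffAt_id
    exact h2.contMDiffAt.comp w (contMDiff_subtype_val w)
  have : Fact (Module.finrank ℝ R3 = 2 + 1) := ⟨finrank_euclideanSpace_fin⟩
  have h3 := h1.codRestrict_sphere (n := 2) (fun w => by simpa using norm_normalize w.2)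
  have h4 := contMDiffAt_subtype_iff (I := 𝓘(ℝ, R3)) (I' := 𝓡 2) (n := ∞) (U := U)
    (f := sphereProj) (x := ⟨v, hv⟩)
  refine h4.1 ((h3 ⟨v, hv⟩).congr_of_eventuallyEq (Eventually.of_forall fun w => ?_))
  ext1
  exact coe_sphereProj w.2

variable {M : Type*} [TopologicalSpace M] [T2Space M] [CompactSpace M]
  [ChartedSpace (EuclideanSpace ℝ (Fin 4)) M] [IsManifold (𝓡 4) ∞ M]
  {η : TwoForm M} {f : Sph → M}

/-- The radially constant extension of a map defined on the sphere. -/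
def radialExt (f : Sph → M) (v : R3) : M := f (sphereProj v)

theorem contMDiffAt_radialExt (hf : ContMDiff (𝓡 2) (𝓡 4) ∞ f) {v : R3} (hv : v ≠ 0) :
    ContMDiffAt 𝓘(ℝ, R3) (𝓡 4) ∞ (radialExt f) v :=
  (hf (sphereProj v)).comp v (contMDiffAt_sphereProj hv)

theorem radialExt_coe (q : Sph) : radialExt f q = f q := by rw [radialExt, sphereProj_coe]

theorem radialExt_lagrangian (hf : ContMDiff (𝓡 2) (𝓡 4) ∞ f)
    (hl : ∀ (q : Sph) (a b : TangentSpace (𝓡 2) q),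
      η (f q) ![mfderiv (𝓡 2) (𝓡 4) f q a, mfderiv (𝓡 2) (𝓡 4) f q b] = 0)
    {v : R3} (hv : v ≠ 0) (a b : R3) :
    η (radialExt f v) ![mfderiv 𝓘(ℝ, R3) (𝓡 4) (radialExt f) v a,
      mfderiv 𝓘(ℝ, R3) (𝓡 4) (radialExt f) v b] = 0 := by
  have h1 : HasMFDerivAt 𝓘(ℝ, R3) (𝓡 4) (radialExt f) v
      ((mfderiv (𝓡 2) (𝓡 4) f (sphereProj v)).comp (mfderiv 𝓘(ℝ, R3) (𝓡 2) sphereProj v)) :=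
    HasMFDerivAt.comp v ((hf (sphereProj v)).mdifferentiableAt (by simp)).hasMFDerivAt
      ((contMDiffAt_sphereProj hv).mdifferentiableAt (by simp)).hasMFDerivAt
  rw [h1.mfderiv]
  exact hl _ _ _

/-- In charts in which `f` is a linear inclusion, the inverse of `f` extends to a smooth map. -/
theorem exists_local_leftInverse {F : Type*} [NormedAddCommGroup F] [NormedSpace ℝ F]
    (e : (EuclideanSpace ℝ (Fin 2) × F) ≃L[ℝ] EuclideanSpace ℝ (Fin 4))
    {D : OpenPartialHomeomorph Sph (EuclideanSpace ℝ (Fin 2))}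
    {C : OpenPartialHomeomorph M (EuclideanSpace ℝ (Fin 4))}
    (hD : D ∈ IsManifold.maximalAtlas (𝓡 2) ∞ Sph) (hC : C ∈ IsManifold.maximalAtlas (𝓡 4) ∞ M)
    {q₀ : Sph} (hq₀ : q₀ ∈ D.source) (hfq₀ : f q₀ ∈ C.source)
    (he : Set.EqOn (C.extend (𝓡 4) ∘ f ∘ (D.extend (𝓡 2)).symm) (e ∘ (·, 0))
      (D.extend (𝓡 2)).target) :
    ∃ U ∈ 𝓝 (f q₀), ∃ g : M → R3, ContMDiffOn (𝓡 4) 𝓘(ℝ, R3) ∞ g U ∧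
      ∀ q ∈ D.source, g (f q) = q := by
  have hc : ContMDiffOn (𝓡 4) 𝓘(ℝ, EuclideanSpace ℝ (Fin 4)) ∞ (C.extend (𝓡 4)) C.source :=
    OpenPartialHomeomorph.contMDiffOn_extend hC
  have hd : ContMDiffOn 𝓘(ℝ, EuclideanSpace ℝ (Fin 2)) (𝓡 2) ∞
      (D.extend (𝓡 2)).symm (D.extend (𝓡 2)).target := by
    have := contMDiffOn_extend_symm hD
    rwa [← OpenPartialHomeomorph.extend_target'] at this
  have hs : (D.extend (𝓡 2)).source = D.source := D.extend_source
  have ho : IsOpen (D.extend (𝓡 2)).target := D.isOpen_extend_target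
  generalize D.extend (𝓡 2) = D' at *
  generalize (C.extend (𝓡 4) : M → EuclideanSpace ℝ (Fin 4)) = C' at *
  have hk : ContMDiffOn (𝓡 4) 𝓘(ℝ, EuclideanSpace ℝ (Fin 2)) ∞ (fun y => (e.symm (C' y)).1)
      C.source := by
    have h1 : ContDiff ℝ ∞ (fun z => (e.symm z).1) := contDiff_fst.comp e.symm.contDiff
    exact h1.contMDiff.comp_contMDiffOn hc
  have hkq : ∀ q ∈ D.source, (e.symm (C' (f q))).1 = D' q := by
    intro q hq
    rw [← hs] at hq
    have h1 := he (D'.map_source hq)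
    simp only [Function.comp_apply] at h1
    rw [D'.left_inv hq] at h1
    rw [h1, ContinuousLinearEquiv.symm_apply_apply]
  generalize hkd : (fun y => (e.symm (C' y)).1) = k at hk
  replace hkq : ∀ q ∈ D.source, k (f q) = D' q := fun q hq => by rw [← hkd]; exact hkq q hq
  have hkm : k ⁻¹' D'.target ∈ 𝓝 (f q₀) := by
    have h1 : ContinuousAt k (f q₀) :=
      (hk.contMDiffAt (C.open_source.mem_nhds hfq₀)).continuousAt
    refine h1.preimage_mem_nhds (ho.mem_nhds ?_)
    rw [hkq q₀ hq₀]
    exact D'.map_source (by rwa [hs])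
  refine ⟨k ⁻¹' D'.target ∩ C.source, inter_mem hkm (C.open_source.mem_nhds hfq₀),
    fun y => (D'.symm (k y) : Sph), ?_, fun q hq => ?_⟩
  · have : Fact (Module.finrank ℝ R3 = 2 + 1) := ⟨finrank_euclideanSpace_fin⟩
    have h1 : ContMDiffOn (𝓡 4) (𝓡 2) ∞ (D'.symm ∘ k) (k ⁻¹' D'.target ∩ C.source) :=
      hd.comp (hk.mono fun y hy => hy.2) (fun y hy => hy.1)
    exact (contMDiff_coe_sphere (n := 2) (E := R3) (m := ∞)).comp_contMDiffOn h1
  · change ((D'.symm (k (f q)) : Sph) : R3) = q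
    rw [hkq q hq, D'.left_inv (by rwa [hs])]

/-- The inverse of a smooth embedding of the sphere extends to a smooth function on the
manifold. -/
theorem exists_leftInverse (hf : Manifold.IsSmoothEmbedding (𝓡 2) (𝓡 4) ∞ f) :
    ∃ V : M → R3, ContMDiff (𝓡 4) 𝓘(ℝ, R3) ∞ V ∧ ∀ q : Sph, V (f q) = q := by
  have hcl : IsClosed (Set.range f) := (isCompact_range hf.isEmbedding.continuous).isClosed
  suffices h : ∀ x : M, ∃ U ∈ 𝓝 x, ∃ g : M → R3, ContMDiffOn (𝓡 4) 𝓘(ℝ, R3) ∞ g U ∧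
      ∀ y ∈ U, ∀ q : Sph, f q = y → g y = q by
    obtain ⟨V, hV⟩ := exists_contMDiffMap_forall_mem_convex_of_local (𝓡 4) (n := ⊤) (F := R3)
      (t := fun x : M => {v : R3 | ∀ q : Sph, f q = x → v = q}) (fun x v hv w hw a b _ _ hab q hq =>
        by rw [hv q hq, hw q hq, ← add_smul, hab, one_smul]) h
    exact ⟨V, V.contMDiff, fun q => hV (f q) q rfl⟩
  intro x
  by_cases hx : x ∈ Set.range f
  · obtain ⟨q₀, rfl⟩ := hx
    have h := hf.isImmersion.isImmersionAt q₀
    obtain ⟨W, hW, hWs⟩ := (hf.isEmbedding.isInducing.nhds_eq_comap q₀ ▸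
      h.domChart.open_source.mem_nhds h.mem_domChart_source :
        h.domChart.source ∈ comap f (𝓝 (f q₀)))
    obtain ⟨U, hU, g, hg, hgq⟩ := exists_local_leftInverse h.equiv h.domChart_mem_maximalAtlas
      h.codChart_mem_maximalAtlas h.mem_domChart_source h.mem_codChart_source h.writtenInCharts
    refine ⟨U ∩ W, inter_mem hU hW, g, hg.mono Set.inter_subset_left, ?_⟩
    rintro _ hy q rfl
    exact hgq q (hWs hy.2)
  · exact ⟨(Set.range f)ᶜ, hcl.isOpen_compl.mem_nhds hx, fun _ => 0, contMDiffOn_const,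
      fun y hy q hq => (hy ⟨q, hq⟩).elim⟩

end Sphere

/-! ### Normal coordinates along a Lagrangian sphere -/

section Normal

set_option linter.unusedSectionVars false

open Filter Topology

variable {M : Type*} [TopologicalSpace M] [T2Space M] [CompactSpace M]
  [ChartedSpace (EuclideanSpace ℝ (Fin 4)) M] [IsManifold (𝓡 4) ∞ M]
  {η : TwoForm M} {f : Sph → M}

/-- The model space of the four-manifold. -/
abbrev E4 : Type := EuclideanSpace ℝ (Fin 4)

/-- The value of a two-form at a point, as a form on the model space. -/
def formAt (η : TwoForm M) (x : M) : E4 [⋀^Fin 2]→L[ℝ] ℝ := η x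

/-- The derivative of a map from a normed space to the manifold, with values in the model space. -/
def derivInto {E : Type*} [NormedAddCommGroup E] [NormedSpace ℝ E] (κ : E → M) (y : E) :
    E →L[ℝ] E4 := mfderiv 𝓘(ℝ, E) (𝓡 4) κ y

/-- The derivative of the preferred chart around `c` at the point `x`. -/
def chartDeriv (c x : M) : E4 →L[ℝ] E4 := mfderiv (𝓡 4) 𝓘(ℝ, E4) (extChartAt (𝓡 4) c) x

theorem hasFDerivAt_extChartAt_comp {E : Type*} [NormedAddCommGroup E] [NormedSpace ℝ E]
    {κ : E → M} {y₀ : E} {c : M} (hκ : MDifferentiableAt 𝓘(ℝ, E) (𝓡 4) κ y₀)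
    (hc : κ y₀ ∈ (extChartAt (𝓡 4) c).source) :
    HasFDerivAt (fun y => extChartAt (𝓡 4) c (κ y))
      ((chartDeriv c (κ y₀)).comp (derivInto κ y₀)) y₀ := by
  have h1 := (contMDiffAt_extChartAt' (n := ∞) (I := 𝓡 4) (x := c) (x' := κ y₀)
      (by simpa using hc)).mdifferentiableAt (by simp)
  have h2 : HasMFDerivAt 𝓘(ℝ, E) 𝓘(ℝ, E4) (extChartAt (𝓡 4) c ∘ κ) y₀ _ :=
    HasMFDerivAt.comp y₀ h1.hasMFDerivAt hκ.hasMFDerivAt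
  exact hasMFDerivAt_iff_hasFDerivAt.1 h2

theorem inChart_chartDeriv (η : TwoForm M) {c x : M} (hx : x ∈ (extChartAt (𝓡 4) c).source)
    (a b : E4) : TwoForm.inChart η c (extChartAt (𝓡 4) c x) ![chartDeriv c x a, chartDeriv c x b] =
      formAt η x ![a, b] := by
  have h1 := (contMDiffAt_extChartAt' (n := ∞) (I := 𝓡 4) (x := c) (x' := x)
      (by simpa using hx)).mdifferentiableAt (by simp)
  have h2 : HasMFDerivAt (𝓡 4) (𝓡 4) ((extChartAt (𝓡 4) c).symm ∘ extChartAt (𝓡 4) c) x _ :=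
    HasMFDerivAt.comp x (mdifferentiableAt_extChartAt_symm
      ((extChartAt (𝓡 4) c).map_source hx)).hasMFDerivAt h1.hasMFDerivAt
  have h3 : HasMFDerivAt (𝓡 4) (𝓡 4) ((extChartAt (𝓡 4) c).symm ∘ extChartAt (𝓡 4) c) x
      (ContinuousLinearMap.id ℝ E4) :=
    (hasMFDerivAt_id (I := 𝓡 4) x).congr_of_eventuallyEq (by
      filter_upwards [extChartAt_source_mem_nhds' (I := 𝓡 4) hx] with y hy
        using (extChartAt (𝓡 4) c).left_inv hy)
  have h4 := hasMFDerivAt_unique h2 h3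
  have h5 : ∀ a : E4, mfderiv 𝓘(ℝ, E4) (𝓡 4) (extChartAt (𝓡 4) c).symm
        (extChartAt (𝓡 4) c x) (chartDeriv c x a) = a :=
    fun a => congrArg (fun f : E4 →L[ℝ] E4 => f a) h4
  rw [inChart_apply, h5, h5]
  exact form_congr η ((extChartAt (𝓡 4) c).left_inv hx) a b

/-- In the chart around `c`, the functional-valued function with prescribed derivative along the
sphere: a point is displaced from its projection to the sphere by a vector, which the symplectic
form pairs with the tangent vectors of the sphere. -/
def normalCoord (η : TwoForm M) (f : Sph → M) (V : M → R3) (c : M) (x : M) : R3 →L[ℝ] ℝ :=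
  (toBilin (TwoForm.inChart η c (extChartAt (𝓡 4) c (radialExt f (V x))))
    (extChartAt (𝓡 4) c x - extChartAt (𝓡 4) c (radialExt f (V x)))).comp
      (fderiv ℝ (fun v => extChartAt (𝓡 4) c (radialExt f v)) (V x))

/-- The domain on which `normalCoord` is meaningful. -/
def normalDomain (f : Sph → M) (V : M → R3) (c : M) : Set M :=
  {x | x ∈ (extChartAt (𝓡 4) c).source ∧ V x ≠ 0 ∧
    radialExt f (V x) ∈ (extChartAt (𝓡 4) c).source}

section

variable (hη : IsSymplecticForm η) (hf : ContMDiff (𝓡 2) (𝓡 4) ∞ f)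
  {V : M → R3} (hV : ContMDiff (𝓡 4) 𝓘(ℝ, R3) ∞ V)
include hη hf hV

theorem contMDiffAt_radialExt_comp {x : M} (hx : V x ≠ 0) :
    ContMDiffAt (𝓡 4) (𝓡 4) ∞ (fun x => radialExt f (V x)) x :=
  (contMDiffAt_radialExt hf hx).comp x (hV x)

theorem isOpen_normalDomain (c : M) : IsOpen (normalDomain f V c) := by
  rw [isOpen_iff_mem_nhds]
  rintro x ⟨h1, h2, h3⟩
  have h4 := (contMDiffAt_radialExt_comp hη hf hV h2).continuousAt
  exact inter_mem ((isOpen_extChartAt_source c).mem_nhds h1)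
    (inter_mem ((hV x).continuousAt.preimage_mem_nhds (isOpen_ne.mem_nhds h2))
      (h4.preimage_mem_nhds ((isOpen_extChartAt_source c).mem_nhds h3)))

theorem contMDiffAt_normalCoord {c x : M} (hx : x ∈ normalDomain f V c) :
    ContMDiffAt (𝓡 4) 𝓘(ℝ, R3 →L[ℝ] ℝ) ∞ (normalCoord η f V c) x := by
  obtain ⟨h1, h2, h3⟩ := hx
  have hr := contMDiffAt_radialExt_comp hη hf hV h2
  have hc1 := contMDiffAt_extChartAt' (n := ∞) (I := 𝓡 4) (x := c) (x' := x) (by simpa using h1)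
  have hc2 := contMDiffAt_extChartAt' (n := ∞) (I := 𝓡 4) (x := c) (x' := radialExt f (V x))
    (by simpa using h3)
  have hcr : ContMDiffAt (𝓡 4) 𝓘(ℝ, E4) ∞
      (fun x => extChartAt (𝓡 4) c (radialExt f (V x))) x := hc2.comp x hr
  have hh : ContDiffAt ℝ ∞ (fun v => extChartAt (𝓡 4) c (radialExt f v)) (V x) :=
    (hc2.comp (V x) (contMDiffAt_radialExt hf h2)).contDiffAt
  have hD : ContMDiffAt (𝓡 4) 𝓘(ℝ, R3 →L[ℝ] E4) ∞
      (fun x => fderiv ℝ (fun v => extChartAt (𝓡 4) c (radialExt f v)) (V x)) x :=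
    (hh.fderiv_right (m := ∞) (by simp)).contMDiffAt.comp x (hV x)
  have hB : ContDiffAt ℝ ∞ (fun y => toBilin (TwoForm.inChart η c y))
      (extChartAt (𝓡 4) c (radialExt f (V x))) :=
    contDiff_toBilin.contDiffAt.comp _ ((hη.smooth c).contDiffAt
      ((isOpen_extChartAt_target c).mem_nhds ((extChartAt (𝓡 4) c).map_source h3)))
  have hB' : ContMDiffAt (𝓡 4) 𝓘(ℝ, E4 →L[ℝ]
      E4 →L[ℝ] ℝ) ∞
      (fun x => toBilin (TwoForm.inChart η c (extChartAt (𝓡 4) c (radialExt f (V x))))) x :=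
    ContMDiffAt.comp (g := fun y => toBilin (TwoForm.inChart η c y)) x hB.contMDiffAt hcr
  have h4 := hB'.clm_apply (hc1.sub hcr)
  exact h4.clm_comp hD

variable (hl : ∀ (q : Sph) (a b : TangentSpace (𝓡 2) q),
      η (f q) ![mfderiv (𝓡 2) (𝓡 4) f q a, mfderiv (𝓡 2) (𝓡 4) f q b] = 0)
  (hVf : ∀ q : Sph, V (f q) = q)
include hl hVf

theorem coe_sph_ne_zero (q : Sph) : (q : R3) ≠ 0 := fun h => by
  have hq : ‖(q : R3)‖ = 1 := by simp
  rw [h] at hq; simp at hq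

theorem hasFDerivAt_normalCoord {E : Type} [NormedAddCommGroup E] [NormedSpace ℝ E] {κ : E → M}
    {y₀ : E} (hκ : ContMDiffAt 𝓘(ℝ, E) (𝓡 4) ∞ κ y₀) {q : Sph} (hq : κ y₀ = f q) {c : M}
    (hx : f q ∈ normalDomain f V c) (a : R3) :
    ∃ D : E →L[ℝ] ℝ, HasFDerivAt (fun y => normalCoord η f V c (κ y) a) D y₀ ∧
      ∀ w, D w = formAt η (f q) ![derivInto κ y₀ w, derivInto (radialExt f) q a] := by
  obtain ⟨h1, h2, h3⟩ := hx
  rw [hVf] at h2 h3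
  have hVκ : V (κ y₀) = q := by rw [hq, hVf]
  have hrq : radialExt f q = f q := radialExt_coe q
  have hVκd : ContDiffAt ℝ ∞ (fun y => V (κ y)) y₀ := ((hV (κ y₀)).comp y₀ hκ).contDiffAt
  have hre := contMDiffAt_radialExt hf h2
  have hrd := hre.mdifferentiableAt (by simp)
  have hκd := hκ.mdifferentiableAt (by simp)
  -- the three factors
  have hd1 := hasFDerivAt_extChartAt_comp hκd (c := c) (by rwa [hq])
  have hd2 := hasFDerivAt_extChartAt_comp hrd (c := c) h3
  have hd3 : HasFDerivAt (fun y => extChartAt (𝓡 4) c (radialExt f (V (κ y)))) _ y₀ :=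
    HasFDerivAt.comp (g := fun v => extChartAt (𝓡 4) c (radialExt f v)) (f := fun y => V (κ y)) y₀
      (by rw [hVκ]; exact hd2) (hVκd.differentiableAt (by simp)).hasFDerivAt
  have hh : ContDiffAt ℝ ∞ (fun v => extChartAt (𝓡 4) c (radialExt f v)) q :=
    ((contMDiffAt_extChartAt' (n := ∞) (I := 𝓡 4) (x := c) (x' := radialExt f q)
      (by simpa using h3)).comp (q : R3) hre).contDiffAt
  have hm : DifferentiableAt ℝ
      (fun y => fderiv ℝ (fun v => extChartAt (𝓡 4) c (radialExt f v)) (V (κ y)) a) y₀ := by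
    have e1 : ContDiffAt ℝ ∞ (fun y => fderiv ℝ (fun v => extChartAt (𝓡 4) c (radialExt f v))
        (V (κ y))) y₀ := by
      refine ContDiffAt.comp (g := fderiv ℝ (fun v => extChartAt (𝓡 4) c (radialExt f v)))
        (f := fun y => V (κ y)) y₀ ?_ hVκd
      rw [hVκ]
      exact hh.fderiv_right (m := ∞) (by simp)
    exact (e1.clm_apply contDiffAt_const).differentiableAt (by simp)
  have hA : DifferentiableAt ℝ (fun y => toBilin (TwoForm.inChart η c
      (extChartAt (𝓡 4) c (radialExt f (V (κ y)))))) y₀ := by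
    have e1 : ContDiffAt ℝ ∞ (fun y => toBilin (TwoForm.inChart η c y))
        (extChartAt (𝓡 4) c (radialExt f q)) :=
      contDiff_toBilin.contDiffAt.comp _ ((hη.smooth c).contDiffAt
        ((isOpen_extChartAt_target c).mem_nhds ((extChartAt (𝓡 4) c).map_source h3)))
    refine DifferentiableAt.comp (g := fun y => toBilin (TwoForm.inChart η c y))
      (f := fun y => extChartAt (𝓡 4) c (radialExt f (V (κ y)))) y₀ ?_ hd3.differentiableAt
    rw [hVκ]
    exact e1.differentiableAt (by simp)
  have hk := hd1.sub hd3
  have hprod := (hA.hasFDerivAt.clm_apply hk).clm_apply hm.hasFDerivAt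
  refine ⟨_, hprod, fun w => ?_⟩
  have hk0 : extChartAt (𝓡 4) c (κ y₀) - extChartAt (𝓡 4) c (radialExt f (V (κ y₀))) = 0 := by
    rw [hVκ, hrq, hq, sub_self]
  simp only [Pi.sub_apply, hk0, map_zero, add_apply, ContinuousLinearMap.comp_apply,
    ContinuousLinearMap.flip_apply, zero_apply, zero_add, add_zero]
  rw [hVκ, hd2.fderiv]
  have e2 : ∀ a b : E4, toBilin (TwoForm.inChart η c (extChartAt (𝓡 4) c (radialExt f q)))
      (chartDeriv c (κ y₀) a) (chartDeriv c (radialExt f q) b) = formAt η (f q) ![a, b] := by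
    intro a b
    rw [toBilin_apply, hq, hrq]
    exact inChart_chartDeriv η (by rwa [hrq] at h3) a b
  have e3 : ∀ b : R3, formAt η (f q) ![derivInto (radialExt f) q b,
      derivInto (radialExt f) q a] = 0 := fun b => by
    have := radialExt_lagrangian hf hl h2 b a
    have e4 : formAt η (radialExt f q) ![derivInto (radialExt f) q b,
      derivInto (radialExt f) q a] = 0 := this
    rwa [hrq] at e4
  have e5 : ∀ b : R3, toBilin (TwoForm.inChart η c (extChartAt (𝓡 4) c (radialExt f q)))
      (chartDeriv c (radialExt f q) (derivInto (radialExt f) q b))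
      (chartDeriv c (radialExt f q) (derivInto (radialExt f) q a)) = 0 := by
    intro b
    have := e2 (derivInto (radialExt f) q b) (derivInto (radialExt f) q a)
    rw [hq, ← hrq] at this
    rw [this, hrq]
    exact e3 b
  rw [sub_apply, map_sub, sub_apply, ContinuousLinearMap.comp_apply, ContinuousLinearMap.comp_apply,
    e2, ContinuousLinearMap.comp_apply, ContinuousLinearMap.comp_apply, e5, sub_zero]

/-- The vector which represents a functional on `ℝ³`. -/
def rieszL : (R3 →L[ℝ] ℝ) →L[ℝ] R3 :=
  ∑ k : Fin 3, (ContinuousLinearMap.apply ℝ ℝ (EuclideanSpace.single k (1 : ℝ) : R3)).smulRight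
    (EuclideanSpace.single k (1 : ℝ) : R3)

omit hη hf hV hl hVf in
theorem inner_rieszL (φ : R3 →L[ℝ] ℝ) (a : R3) : inner ℝ (rieszL φ) a = φ a := by
  have ha : a = ∑ k, a k • (EuclideanSpace.single k (1 : ℝ) : R3) := by
    ext i
    fin_cases i <;> simp [Fin.sum_univ_three]
  conv_rhs => rw [ha]
  simp only [rieszL, sum_apply, ContinuousLinearMap.smulRight_apply,
    ContinuousLinearMap.apply_apply, sum_inner, inner_smul_left, map_sum, map_smul]
  refine Finset.sum_congr rfl fun k _ => ?_
  rw [EuclideanSpace.inner_single_left]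
  simp [mul_comm]

/-- A smooth function which vanishes along the Lagrangian sphere, and whose derivative there
identifies normal vectors with cotangent vectors by means of the symplectic form. -/
theorem exists_normal_function : ∃ U : M → R3, ContMDiff (𝓡 4) 𝓘(ℝ, R3) ∞ U ∧
    (∀ q : Sph, U (f q) = 0) ∧
    ∀ {E : Type} [NormedAddCommGroup E] [NormedSpace ℝ E] {κ : E → M} {y₀ : E} {q : Sph},
      ContMDiffAt 𝓘(ℝ, E) (𝓡 4) ∞ κ y₀ → κ y₀ = f q → ∀ w a,
        (inner ℝ (fderiv ℝ (fun y => U (κ y)) y₀ w) a : ℝ) =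
          formAt η (f q) ![derivInto κ y₀ w, derivInto (radialExt f) q a] := by
  have hcomp : IsCompact (Set.range f) := isCompact_range hf.continuous
  have hmem : ∀ q, f q ∈ normalDomain f V (f q) := fun q => by
    refine ⟨mem_extChartAt_source (f q), ?_, ?_⟩
    · rw [hVf]; exact coe_sph_ne_zero hη hf hV hl hVf q
    · rw [hVf, radialExt_coe]; exact mem_extChartAt_source (f q)
  obtain ⟨t, ht⟩ := hcomp.elim_finite_subcover (fun c : M => normalDomain f V c)
    (isOpen_normalDomain hη hf hV) (by
      rintro _ ⟨q, rfl⟩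
      exact Set.mem_iUnion.2 ⟨f q, hmem q⟩)
  obtain ⟨χ, hχ⟩ := SmoothPartitionOfUnity.exists_isSubordinate (𝓡 4) hcomp.isClosed
    (fun c : t => normalDomain f V (c : M)) (fun c => isOpen_normalDomain hη hf hV _)
    (by
      intro x hx
      obtain ⟨c, hc, hxc⟩ := Set.mem_iUnion₂.1 (ht hx)
      exact Set.mem_iUnion.2 ⟨⟨c, hc⟩, hxc⟩)
  have hsmooth := χ.contMDiff_finsum_smul (n := ⊤) (F := R3 →L[ℝ] ℝ)
    (g := fun c : t => normalCoord η f V (c : M))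
    (fun c x hx => contMDiffAt_normalCoord hη hf hV (hχ c hx))
  simp only [finsum_eq_sum_of_fintype] at hsmooth
  have hzero : ∀ (c : M) (q : Sph), normalCoord η f V c (f q) = 0 := fun c q => by
    ext a
    simp [normalCoord, hVf, radialExt_coe]
  refine ⟨fun x => rieszL (∑ c : t, χ c x • normalCoord η f V (c : M) x),
    rieszL.contDiff.contMDiff.comp hsmooth, fun q => by simp [hzero], ?_⟩
  intro E _ _ κ y₀ q hκ hq w a
  have hUd : DifferentiableAt ℝ
      (fun y => rieszL (∑ c : t, χ c (κ y) • normalCoord η f V (c : M) (κ y))) y₀ := by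
    have h1 := (rieszL.contDiff.contMDiff.comp hsmooth) (κ y₀)
    have h2 := h1.comp y₀ hκ
    exact h2.contDiffAt.differentiableAt (by simp)
  have h1 : (inner ℝ (fderiv ℝ
      (fun y => rieszL (∑ c : t, χ c (κ y) • normalCoord η f V (c : M) (κ y))) y₀ w) a : ℝ) =
      fderiv ℝ (fun y => ∑ c : t, χ c (κ y) * normalCoord η f V (c : M) (κ y) a) y₀ w := by
    have h2 := (hUd.hasFDerivAt.inner ℝ (hasFDerivAt_const a y₀)).fderiv
    have h3 : (fun y => (inner ℝ (rieszL (∑ c : t, χ c (κ y) • normalCoord η f V (c : M) (κ y)))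
        a : ℝ)) = fun y => ∑ c : t, χ c (κ y) * normalCoord η f V (c : M) (κ y) a := by
      funext y
      rw [inner_rieszL]
      simp [sum_apply]
    rw [← h3, h2]
    simp
  rw [h1]
  have h4 : ∀ c : t, HasFDerivAt (fun y => χ c (κ y) * normalCoord η f V (c : M) (κ y) a)
      (χ c (f q) • (toBilin (formAt η (f q))).flip (derivInto (radialExt f) q a) ∘L
        derivInto κ y₀) y₀ := by
    intro c
    by_cases hc : f q ∈ normalDomain f V (c : M)
    · obtain ⟨D, hD, hDw⟩ := hasFDerivAt_normalCoord hη hf hV hl hVf hκ hq hc a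
      have h5 : DifferentiableAt ℝ (fun y => χ c (κ y)) y₀ :=
        (((χ c).contMDiff (κ y₀)).comp y₀ hκ).contDiffAt.differentiableAt (by simp)
      have h6 := h5.hasFDerivAt.mul hD
      refine h6.congr_fderiv ?_
      ext w
      simp [hq, hzero, hDw, toBilin_apply]
    · have h5 : f q ∉ tsupport (χ c) := fun h => hc (hχ c h)
      have h6 : χ c =ᶠ[𝓝 (κ y₀)] 0 := by
        rw [hq]; exact notMem_tsupport_iff_eventuallyEq.1 h5
      have h7 : χ c (f q) = 0 := image_eq_zero_of_notMem_tsupport h5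
      rw [h7, zero_smul]
      refine (hasFDerivAt_const (0 : ℝ) y₀).congr_of_eventuallyEq ?_
      filter_upwards [hκ.continuousAt.eventually h6] with y hy
      rw [hy]; simp
  have h5 := HasFDerivAt.fun_sum (u := Finset.univ) fun c _ => h4 c
  rw [h5.fderiv]
  have h6 : ∑ c : t, χ c (f q) = 1 := by
    rw [← finsum_eq_sum_of_fintype]
    exact χ.sum_eq_one ⟨q, rfl⟩
  simp only [sum_apply, smul_apply, ContinuousLinearMap.comp_apply,
    ContinuousLinearMap.flip_apply, toBilin_apply]
  rw [← Finset.sum_smul, h6, one_smul]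

end

end Normal

/-! ### A tubular parametrization of a neighbourhood of the Lagrangian sphere -/

section Tubular

set_option linter.unusedSectionVars false

open Filter Topology

/-- The inverse function theorem, with smoothness of the local inverse near the base point. -/
theorem exists_smooth_local_inverse {E F : Type*} [NormedAddCommGroup E] [NormedSpace ℝ E]
    [NormedAddCommGroup F] [NormedSpace ℝ F] [FiniteDimensional ℝ E] [FiniteDimensional ℝ F]
    {G : E → F} {p : E} (hG : ∀ᶠ x in 𝓝 p, ContDiffAt ℝ ∞ G x)
    (hinj : ∀ X, fderiv ℝ G p X = 0 → X = 0)
    (hdim : Module.finrank ℝ E = Module.finrank ℝ F) :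
    ∃ H : F → E, (∀ᶠ y in 𝓝 (G p), ContDiffAt ℝ ∞ H y) ∧ H (G p) = p ∧
      (∀ᶠ y in 𝓝 (G p), G (H y) = y) ∧ ∀ᶠ x in 𝓝 p, H (G x) = x := by
  have := FiniteDimensional.complete ℝ E
  have hGp := hG.self_of_nhds
  let e : E ≃L[ℝ] F := (LinearMap.linearEquivOfInjective (fderiv ℝ G p).toLinearMap
    ((injective_iff_map_eq_zero _).2 hinj) hdim).toContinuousLinearEquiv
  have he : (e : E →L[ℝ] F) = fderiv ℝ G p := by ext x; rfl
  have hd : HasFDerivAt G (e : E →L[ℝ] F) p := by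
    rw [he]; exact (hGp.differentiableAt (by simp)).hasFDerivAt
  have hs : HasStrictFDerivAt G (e : E →L[ℝ] F) p := hGp.hasStrictFDerivAt' hd (by simp)
  set Φ := hs.toOpenPartialHomeomorph G with hΦ
  have hmem : G p ∈ Φ.target := hs.image_mem_toOpenPartialHomeomorph_target
  have hinvp : Φ.symm (G p) = p := hs.localInverse_apply_image
  have hcont : ContinuousAt Φ.symm (G p) := Φ.continuousAt_symm hmem
  have hev : ∀ᶠ x in 𝓝 p, ContDiffAt ℝ ∞ G x ∧ ∃ e' : E ≃L[ℝ] F, (e' : E →L[ℝ] F) = fderiv ℝ G x := by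
    have h1 : ContinuousAt (fderiv ℝ G) p :=
      (hGp.fderiv_right (m := ∞) (by simp)).continuousAt
    have h2 := h1.eventually (p := fun L => L ∈ Set.range ((↑) : (E ≃L[ℝ] F) → E →L[ℝ] F))
      (by rw [← he]; exact e.nhds)
    exact hG.and h2
  have hev' : ∀ᶠ y in 𝓝 (G p), ContDiffAt ℝ ∞ G (Φ.symm y) ∧
      ∃ e' : E ≃L[ℝ] F, (e' : E →L[ℝ] F) = fderiv ℝ G (Φ.symm y) := by
    have := hcont.tendsto
    rw [hinvp] at this
    exact this.eventually hev
  refine ⟨Φ.symm, ?_, hinvp, hs.eventually_right_inverse, hs.eventually_left_inverse⟩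
  filter_upwards [hev', Φ.open_target.mem_nhds hmem] with y hy hyt
  obtain ⟨h1, e', he'⟩ := hy
  refine Φ.contDiffAt_symm (f₀' := e') hyt ?_ h1
  rw [he']
  exact (h1.differentiableAt (by simp)).hasFDerivAt

/-- The derivative of the radial projection at a point of the unit sphere. -/
theorem hasFDerivAt_normalize {q : R3} (hq : ‖q‖ = 1) : HasFDerivAt (fun v : R3 => ‖v‖⁻¹ • v)
    (ContinuousLinearMap.id ℝ R3 - (innerSL ℝ q).smulRight q) q := by
  have hsq : HasFDerivAt (fun v : R3 => ‖v‖ ^ 2) _ q := (hasFDerivAt_id q).norm_sq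
  have h1 := (hasDerivAt_inv (x := √(‖q‖ ^ 2)) (by simp [hq])).comp_hasFDerivAt q
    (hsq.sqrt (by simp [hq]))
  have h2 : HasFDerivAt (fun v : R3 => ‖v‖⁻¹) _ q := h1.congr_of_eventuallyEq
    (Eventually.of_forall fun v => by simp)
  have h3 : HasFDerivAt (fun v : R3 => ‖v‖⁻¹ • v) _ q := h2.smul (hasFDerivAt_id q)
  refine h3.congr_fderiv ?_
  ext1 a
  simp [hq, sub_eq_add_neg]

/-- The derivative of the retraction onto the cotangent bundle at a point of the zero-section is
the orthogonal projection in both components. -/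
theorem fderiv_cotangentRetraction_zero {q : R3} (hq : ‖q‖ = 1) (X : Ambient) :
    HasFDerivAt cotangentRetraction (fderiv ℝ cotangentRetraction (0, q)) (0, q) ∧
    fderiv ℝ cotangentRetraction (0, q) X =
      (X.1 - (inner ℝ q X.1 : ℝ) • q, X.2 - (inner ℝ q X.2 : ℝ) • q) := by
  have h1 : HasFDerivAt (fun p : Ambient => ‖p.2‖⁻¹ • p.2) _ ((0, q) : Ambient) :=
    HasFDerivAt.comp (g := fun v : R3 => ‖v‖⁻¹ • v) (f := Prod.snd) ((0, q) : Ambient)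
      (hasFDerivAt_normalize hq) hasFDerivAt_snd
  have h4 : HasFDerivAt cotangentRetraction _ ((0, q) : Ambient) :=
    (hasFDerivAt_fst.sub ((hasFDerivAt_fst.inner ℝ h1).smul h1)).prodMk h1
  refine ⟨h4.differentiableAt.hasFDerivAt, ?_⟩
  rw [h4.fderiv]
  ext1 <;> simp [hq, real_inner_comm]

/-- A vector orthogonal to a Lagrangian plane lies in it. Here the plane is the image of `A`, and
`B` is a left inverse of `A` on the complement of the kernel `ℝ q`. -/
theorem eq_zero_of_orthogonal_lagrangian {σ : E4 [⋀^Fin 2]→L[ℝ] ℝ}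
    (hσ : ∀ x, (∀ y, σ ![x, y] = 0) → x = 0) {A : R3 →L[ℝ] E4} {B : E4 →L[ℝ] R3} {q : R3}
    (hq : ‖q‖ = 1) (hA : A q = 0) (hl : ∀ a b, σ ![A a, A b] = 0)
    (hBA : ∀ a, B (A a) = a - (inner ℝ q a : ℝ) • q) {x : E4} (hx : ∀ a, σ ![x, A a] = 0) {c : ℝ}
    (hB : B x = c • q) : x = 0 := by
  have hq0 : q ≠ 0 := fun h => by rw [h] at hq; simp at hq
  let β : LinearMap.BilinForm ℝ E4 :=
    LinearMap.mk₂ ℝ (fun x y => toBilin σ x y) (by simp) (by simp) (by simp) (by simp)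
  have hβ : ∀ x y, β x y = σ ![x, y] := fun x y => toBilin_apply σ x y
  have halt : ∀ x y, β x y = 0 → β y x = 0 := fun x y h => by
    rw [hβ] at h ⊢; rw [form_swap, h, neg_zero]
  have hrefl : β.IsRefl := halt
  have hnd : β.Nondegenerate :=
    ⟨fun x h => hσ x fun y => (hβ x y).symm.trans (h y),
      fun x h => hσ x fun y => (hβ x y).symm.trans (halt _ _ (h y))⟩
  let W := LinearMap.range A.toLinearMap
  have hker : LinearMap.ker A.toLinearMap = Submodule.span ℝ {q} := by
    ext a
    rw [LinearMap.mem_ker, Submodule.mem_span_singleton]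
    constructor
    · intro h
      have h' : A a = 0 := h
      have h2 := hBA a
      rw [h', map_zero] at h2
      exact ⟨inner ℝ q a, (sub_eq_zero.1 h2.symm).symm⟩
    · rintro ⟨t, rfl⟩
      exact (map_smul A t q).trans (by rw [hA, smul_zero])
  have hdim : Module.finrank ℝ W = 2 := by
    have h1 := LinearMap.finrank_range_add_finrank_ker A.toLinearMap
    rw [hker, finrank_span_singleton hq0, finrank_euclideanSpace_fin] at h1
    change Module.finrank ℝ W + 1 = 3 at h1
    omega
  have hdim' := LinearMap.BilinForm.finrank_orthogonal hnd W
  rw [hdim, finrank_euclideanSpace_fin] at hdim'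
  have hle : W ≤ β.orthogonal W := by
    rintro _ ⟨a, rfl⟩ _ ⟨b, rfl⟩
    exact (hβ _ _).trans (hl b a)
  have heq : W = β.orthogonal W := Submodule.eq_of_le_of_finrank_eq hle (by rw [hdim, hdim'])
  have hxW : x ∈ W := by
    rw [heq]
    rintro _ ⟨a, rfl⟩
    exact halt _ _ ((hβ _ _).trans (hx a))
  obtain ⟨a, rfl⟩ := hxW
  have h1 : B (A a) = c • q := hB
  rw [hBA] at h1
  have h2 : a = (c + inner ℝ q a) • q := by rw [add_smul, ← h1, sub_add_cancel]
  change A a = 0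
  rw [h2, map_smul, hA, smul_zero]

variable {M : Type*} [TopologicalSpace M] [T2Space M] [CompactSpace M]
  [ChartedSpace (EuclideanSpace ℝ (Fin 4)) M] [IsManifold (𝓡 4) ∞ M]
  {η : TwoForm M} {f : Sph → M}

theorem derivInto_radialExt_self (hf : ContMDiff (𝓡 2) (𝓡 4) ∞ f) (q : Sph) :
    derivInto (radialExt f) q (q : R3) = 0 := by
  have hq : ‖(q : R3)‖ = 1 := by simp
  have hq0 : (q : R3) ≠ 0 := fun h => by rw [h] at hq; simp at hq
  have h1 : HasMFDerivAt 𝓘(ℝ, R3) (𝓡 4) (radialExt f) (‖(q : R3)‖⁻¹ • (q : R3))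
      (derivInto (radialExt f) q) := by
    have := ((contMDiffAt_radialExt hf hq0).mdifferentiableAt (by simp)).hasMFDerivAt
    have e : ‖(q : R3)‖⁻¹ • (q : R3) = q := by rw [hq]; simp
    rw [e]
    exact this
  have h2 : HasMFDerivAt 𝓘(ℝ, R3) (𝓡 4) (radialExt f ∘ fun v : R3 => ‖v‖⁻¹ • v) (q : R3) _ :=
    HasMFDerivAt.comp (q : R3) h1 (hasFDerivAt_normalize hq).hasMFDerivAt
  have h3 : HasMFDerivAt 𝓘(ℝ, R3) (𝓡 4) (radialExt f) (q : R3) _ :=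
    h2.congr_of_eventuallyEq (by
      filter_upwards [isOpen_ne.mem_nhds hq0] with v hv
      have h4 : sphereProj (‖v‖⁻¹ • v) = sphereProj v :=
        sphereProj_smul (inv_pos.2 (norm_pos_iff.2 hv)) hv
      exact congrArg f h4.symm)
  have h4 := h3.mfderiv
  have h5 : derivInto (radialExt f) q = (derivInto (radialExt f) q).comp
    (ContinuousLinearMap.id ℝ R3 - (innerSL ℝ (q : R3)).smulRight (q : R3)) := h4
  rw [h5]
  simp

/-- The chain rule for a function on the manifold along a map from a normed space. -/
theorem hasFDerivAt_comp_derivInto {V : M → R3}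
    (hV : ContMDiff (𝓡 4) 𝓘(ℝ, R3) ∞ V) {x : M} :
    ∃ B : E4 →L[ℝ] R3, ∀ {E : Type} [NormedAddCommGroup E] [NormedSpace ℝ E] {κ : E → M} {y : E},
      κ y = x → ContMDiffAt 𝓘(ℝ, E) (𝓡 4) ∞ κ y →
      HasFDerivAt (fun y => V (κ y)) (B.comp (derivInto κ y)) y := by
  refine ⟨mfderiv (𝓡 4) 𝓘(ℝ, R3) V x, ?_⟩
  rintro E _ _ κ y rfl hκ
  have h2 : HasMFDerivAt 𝓘(ℝ, E) 𝓘(ℝ, R3) (V ∘ κ) y _ :=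
    HasMFDerivAt.comp y ((hV (κ y)).mdifferentiableAt (by simp)).hasMFDerivAt
      (hκ.mdifferentiableAt (by simp)).hasMFDerivAt
  exact hasMFDerivAt_iff_hasFDerivAt.1 h2

theorem fderiv_derivInto_chart (c : M) {x : E4}
    (hx : derivInto (extChartAt (𝓡 4) c).symm (extChartAt (𝓡 4) c c) x = 0) : x = 0 := by
  have hc := mem_extChartAt_target (I := 𝓡 4) c
  have hs := mem_extChartAt_source (I := 𝓡 4) c
  have h1 := hasFDerivAt_extChartAt_comp (c := c) (mdifferentiableAt_extChartAt_symm hc)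
    ((extChartAt (𝓡 4) c).map_target hc)
  have h2 : HasFDerivAt (fun y => extChartAt (𝓡 4) c ((extChartAt (𝓡 4) c).symm y))
      (ContinuousLinearMap.id ℝ E4) (extChartAt (𝓡 4) c c) :=
    (hasFDerivAt_id _).congr_of_eventuallyEq (by
      filter_upwards [(isOpen_extChartAt_target c).mem_nhds hc] with y hy
        using (extChartAt (𝓡 4) c).right_inv hy)
  have h3 := congrArg (fun L : E4 →L[ℝ] E4 => L x) (h1.unique h2)
  have h4 : chartDeriv c _ (derivInto (extChartAt (𝓡 4) c).symm (extChartAt (𝓡 4) c c) x) = x := h3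
  rw [← h4, hx, map_zero]

section

variable (hη : IsSymplecticForm η) (hf : ContMDiff (𝓡 2) (𝓡 4) ∞ f)
  (hl : ∀ (q : Sph) (a b : TangentSpace (𝓡 2) q),
      η (f q) ![mfderiv (𝓡 2) (𝓡 4) f q a, mfderiv (𝓡 2) (𝓡 4) f q b] = 0)
  {U V : M → R3} (hU : ContMDiff (𝓡 4) 𝓘(ℝ, R3) ∞ U) (hV : ContMDiff (𝓡 4) 𝓘(ℝ, R3) ∞ V)
  (hUf : ∀ q : Sph, U (f q) = 0) (hVf : ∀ q : Sph, V (f q) = q)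
  (hUd : ∀ {E : Type} [NormedAddCommGroup E] [NormedSpace ℝ E] {κ : E → M} {y₀ : E} {q : Sph},
      ContMDiffAt 𝓘(ℝ, E) (𝓡 4) ∞ κ y₀ → κ y₀ = f q → ∀ w a,
        (inner ℝ (fderiv ℝ (fun y => U (κ y)) y₀ w) a : ℝ) =
          formAt η (f q) ![derivInto κ y₀ w, derivInto (radialExt f) q a])

include hη hf hl hU hV hUf hVf hUd

/-- The map `(U, V)`, followed by the retraction onto the cotangent bundle, is immersive along the
sphere. -/
theorem eq_zero_of_tubular_deriv {q : Sph} {x : E4}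
    (h1 : ∀ a : R3, (inner ℝ (fderiv ℝ (fun y => U ((extChartAt (𝓡 4) (f q)).symm y))
      (extChartAt (𝓡 4) (f q) (f q)) x) a : ℝ) = 0) {c : ℝ}
    (h2 : fderiv ℝ (fun y => V ((extChartAt (𝓡 4) (f q)).symm y))
      (extChartAt (𝓡 4) (f q) (f q)) x = c • (q : R3)) : x = 0 := by
  have hq : ‖(q : R3)‖ = 1 := by simp
  have hq0 : (q : R3) ≠ 0 := fun h => by rw [h] at hq; simp at hq
  have hc := mem_extChartAt_target (I := 𝓡 4) (f q)
  have hκ0 : (extChartAt (𝓡 4) (f q)).symm (extChartAt (𝓡 4) (f q) (f q)) = f q :=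
    (extChartAt (𝓡 4) (f q)).left_inv (mem_extChartAt_source (f q))
  have hκ : ContMDiffAt 𝓘(ℝ, E4) (𝓡 4) ∞ (extChartAt (𝓡 4) (f q)).symm
      (extChartAt (𝓡 4) (f q) (f q)) :=
    (contMDiffOn_extChartAt_symm (n := ∞) (f q)).contMDiffAt
      ((isOpen_extChartAt_target (f q)).mem_nhds hc)
  obtain ⟨B, hB⟩ := hasFDerivAt_comp_derivInto hV (x := f q)
  refine fderiv_derivInto_chart (f q) (eq_zero_of_orthogonal_lagrangian (σ := formAt η (f q))
    (A := derivInto (radialExt f) q) (B := B) (c := c)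
    (fun x h => hη.nondegenerate (f q) x h) hq (derivInto_radialExt_self hf q) ?_ ?_ ?_ ?_)
  · intro a b
    have := radialExt_lagrangian hf hl hq0 a b
    have e : formAt η (radialExt f q) ![derivInto (radialExt f) q a,
      derivInto (radialExt f) q b] = 0 := this
    rwa [radialExt_coe] at e
  · intro a
    have h3 := hB (radialExt_coe (f := f) q) (contMDiffAt_radialExt hf hq0)
    have h4 : HasFDerivAt (fun v => V (radialExt f v)) _ (q : R3) :=
      (hasFDerivAt_normalize hq).congr_of_eventuallyEq (by
        filter_upwards [isOpen_ne.mem_nhds hq0] with v hv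
        rw [radialExt, hVf, coe_sphereProj hv])
    have h5 := congrArg (fun L : R3 →L[ℝ] R3 => L a) (h3.unique h4)
    simpa using h5
  · intro a
    rw [← hUd hκ hκ0]
    exact h1 a
  · have h3 := (hB hκ0 hκ).fderiv
    rw [h3] at h2
    exact h2

end

end Tubular

section TubularInverse

set_option linter.unusedSectionVars false

open Filter Topology

/-- The zero-section of the cotangent bundle. -/
def zeroSection : Set Ambient := {p | p.1 = 0 ∧ ‖p.2‖ = 1}

theorem zeroSection_subset : zeroSection ⊆ cotangentBundle := fun p hp =>
  ⟨by rw [hp.1]; simp, hp.2⟩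

theorem isCompact_zeroSection : IsCompact zeroSection := by
  have : zeroSection = {0} ×ˢ Metric.sphere (0 : R3) 1 := by
    ext p; simp [zeroSection]
  rw [this]
  exact isCompact_singleton.prod (isCompact_sphere _ _)

/-- Coordinates around the cotangent bundle: a scaling of the base vector, and a component of the
fibre vector along the base vector. -/
def coneMap (x : Ambient × (ℝ × ℝ)) : Ambient :=
  (x.1.1 + x.2.1 • x.1.2, (1 + x.2.2) • x.1.2)

theorem contDiff_coneMap : ContDiff ℝ ∞ coneMap := by
  unfold coneMap; fun_prop

theorem cotangentRetraction_coneMap {p : Ambient} (hp : p ∈ cotangentBundle) {a b : ℝ}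
    (hb : -1 < b) : cotangentRetraction (coneMap (p, a, b)) = p := by
  obtain ⟨u, v⟩ := p
  have h1 : (inner ℝ u v : ℝ) = 0 := hp.1
  have h2 : ‖v‖ = 1 := hp.2
  have h3 : 0 < 1 + b := by linarith
  have h4 : ‖(1 + b) • v‖⁻¹ • (1 + b) • v = v := by
    rw [norm_smul, h2, Real.norm_eq_abs, abs_of_pos h3, smul_smul, mul_one, inv_mul_cancel₀ h3.ne',
      one_smul]
  simp only [cotangentRetraction, coneMap, h4]
  rw [inner_add_left, inner_smul_left, h1, real_inner_self_eq_norm_sq, h2]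
  simp

variable {M : Type*} [TopologicalSpace M] [T2Space M] [CompactSpace M]
  [ChartedSpace (EuclideanSpace ℝ (Fin 4)) M] [IsManifold (𝓡 4) ∞ M]
  {η : TwoForm M} {f : Sph → M}

variable (hη : IsSymplecticForm η) (hf : ContMDiff (𝓡 2) (𝓡 4) ∞ f)
  (hl : ∀ (q : Sph) (a b : TangentSpace (𝓡 2) q),
      η (f q) ![mfderiv (𝓡 2) (𝓡 4) f q a, mfderiv (𝓡 2) (𝓡 4) f q b] = 0)
  {U V : M → R3} (hU : ContMDiff (𝓡 4) 𝓘(ℝ, R3) ∞ U) (hV : ContMDiff (𝓡 4) 𝓘(ℝ, R3) ∞ V)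
  (hUf : ∀ q : Sph, U (f q) = 0) (hVf : ∀ q : Sph, V (f q) = q)
  (hUd : ∀ {E : Type} [NormedAddCommGroup E] [NormedSpace ℝ E] {κ : E → M} {y₀ : E} {q : Sph},
      ContMDiffAt 𝓘(ℝ, E) (𝓡 4) ∞ κ y₀ → κ y₀ = f q → ∀ w a,
        (inner ℝ (fderiv ℝ (fun y => U (κ y)) y₀ w) a : ℝ) =
          formAt η (f q) ![derivInto κ y₀ w, derivInto (radialExt f) q a])

include hη hf hl hU hV hUf hVf hUd

/-- The map `(U, V)`, followed by the retraction onto the cotangent bundle, is injective near each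
point of the sphere, and has a smooth right inverse there. -/
theorem exists_local_tubular_inverse (q : Sph) : ∃ k : Ambient → M,
    (∀ᶠ p in 𝓝 ((0, (q : R3)) : Ambient), ContMDiffAt 𝓘(ℝ, Ambient) (𝓡 4) ∞ k p ∧
      cotangentRetraction (U (k p), V (k p)) = cotangentRetraction p) ∧ k (0, q) = f q ∧
    ∃ u ∈ 𝓝 (f q), Set.InjOn (fun x => cotangentRetraction (U x, V x)) u := by
  have hq : ‖(q : R3)‖ = 1 := by simp
  have hq0 : (q : R3) ≠ 0 := fun h => by rw [h] at hq; simp at hq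
  have hc := mem_extChartAt_target (I := 𝓡 4) (f q)
  have htgt : ∀ᶠ y in 𝓝 (extChartAt (𝓡 4) (f q) (f q)), y ∈ (extChartAt (𝓡 4) (f q)).target :=
    (isOpen_extChartAt_target (I := 𝓡 4) (f q)).mem_nhds hc
  have hκ0 : (extChartAt (𝓡 4) (f q)).symm (extChartAt (𝓡 4) (f q) (f q)) = f q :=
    (extChartAt (𝓡 4) (f q)).left_inv (mem_extChartAt_source (f q))
  have hκ : ∀ y ∈ (extChartAt (𝓡 4) (f q)).target,
      ContMDiffAt 𝓘(ℝ, E4) (𝓡 4) ∞ (extChartAt (𝓡 4) (f q)).symm y := fun y hy =>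
    (contMDiffOn_extChartAt_symm (n := ∞) (f q)).contMDiffAt
      ((isOpen_extChartAt_target (f q)).mem_nhds hy)
  have himm := fun x => eq_zero_of_tubular_deriv hη hf hl hU hV hUf hVf hUd (q := q) (x := x)
  have hUx := hUd (hκ _ hc) hκ0
  set y₀ : E4 := extChartAt (𝓡 4) (f q) (f q) with hy₀
  set κ : E4 → M := ⇑(extChartAt (𝓡 4) (f q)).symm with hκdef
  have hz : ∀ y ∈ (extChartAt (𝓡 4) (f q)).target, ContDiffAt ℝ ∞ (fun y => (U (κ y), V (κ y))) y :=
    fun y hy => ContDiffAt.prodMk ((hU _).comp y (hκ y hy)).contDiffAt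
      ((hV _).comp y (hκ y hy)).contDiffAt
  have hVne : ∀ᶠ y in 𝓝 y₀, V (κ y) ≠ 0 := by
    refine (hz y₀ hc).continuousAt.snd.eventually (p := fun v => v ≠ 0) (isOpen_ne.mem_nhds ?_)
    change V (κ y₀) ≠ 0
    rw [hκ0, hVf]; exact hq0
  let G : E4 × (ℝ × ℝ) → Ambient := fun x =>
    coneMap (cotangentRetraction (U (κ x.1), V (κ x.1)), x.2)
  have hzy : (U (κ y₀), V (κ y₀)) = ((0, (q : R3)) : Ambient) := by rw [hκ0, hUf, hVf]
  have hmem0 : ((0, (q : R3)) : Ambient) ∈ cotangentBundle := zeroSection_subset ⟨rfl, hq⟩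
  have hGp : G (y₀, 0, 0) = (0, (q : R3)) := by
    simp only [G]
    rw [hzy, cotangentRetraction_of_mem hmem0]
    simp [coneMap]
  have hGs : ∀ᶠ x in 𝓝 ((y₀, 0, 0) : E4 × (ℝ × ℝ)), ContDiffAt ℝ ∞ G x := by
    have h1 : ∀ᶠ x in 𝓝 ((y₀, 0, 0) : E4 × (ℝ × ℝ)),
        x.1 ∈ (extChartAt (𝓡 4) (f q)).target ∧ V (κ x.1) ≠ 0 :=
      (continuousAt_fst (p := ((y₀, 0, 0) : E4 × (ℝ × ℝ)))).eventually (htgt.and hVne)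
    filter_upwards [h1] with x hx
    have h2 : ContDiffAt ℝ ∞ (fun y => cotangentRetraction (U (κ y), V (κ y))) x.1 :=
      ContDiffAt.comp (g := cotangentRetraction) x.1 (contDiffAt_cotangentRetraction hx.2)
        (hz x.1 hx.1)
    exact contDiff_coneMap.contDiffAt.comp x ((h2.comp x contDiffAt_fst).prodMk contDiffAt_snd)
  have hGd : ∀ X, fderiv ℝ G (y₀, 0, 0) X = 0 → X = 0 := by
    rintro ⟨ξ, α, β⟩ hX
    obtain ⟨hr1, -⟩ := fderiv_cotangentRetraction_zero hq 0
    have hd1 : HasFDerivAt (fun y => cotangentRetraction (U (κ y), V (κ y))) _ y₀ :=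
      HasFDerivAt.comp (g := cotangentRetraction) y₀ (by rw [hzy]; exact hr1)
        ((hz y₀ hc).differentiableAt (by simp)).hasFDerivAt
    have hP : HasFDerivAt (fun x : E4 × (ℝ × ℝ) => cotangentRetraction (U (κ x.1), V (κ x.1))) _
        (y₀, 0, 0) :=
      HasFDerivAt.comp (g := fun y => cotangentRetraction (U (κ y), V (κ y))) (f := Prod.fst)
        ((y₀, 0, 0) : E4 × (ℝ × ℝ)) hd1 hasFDerivAt_fst
    have hA : HasFDerivAt (fun x : E4 × (ℝ × ℝ) => x.2.1) _ (y₀, 0, 0) :=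
      (hasFDerivAt_snd (𝕜 := ℝ) (E := E4) (F := ℝ × ℝ) (p := ((y₀, 0, 0) : E4 × (ℝ × ℝ)))).fst
    have hB : HasFDerivAt (fun x : E4 × (ℝ × ℝ) => x.2.2) _ (y₀, 0, 0) :=
      (hasFDerivAt_snd (𝕜 := ℝ) (E := E4) (F := ℝ × ℝ) (p := ((y₀, 0, 0) : E4 × (ℝ × ℝ)))).snd
    have hd2 : HasFDerivAt G _ (y₀, 0, 0) :=
      (hP.fst.add (hA.smul hP.snd)).prodMk ((hB.const_add 1).smul hP.snd)
    have hpair : fderiv ℝ (fun y => (U (κ y), V (κ y))) y₀ ξ =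
        (fderiv ℝ (fun y => U (κ y)) y₀ ξ, fderiv ℝ (fun y => V (κ y)) y₀ ξ) := by
      rw [DifferentiableAt.fderiv_prodMk
        ((hz y₀ hc).differentiableAt (by simp)).fst ((hz y₀ hc).differentiableAt (by simp)).snd]
      rfl
    have hπ := cotangentRetraction_of_mem hmem0
    rw [hd2.fderiv] at hX
    simp only [hzy, hπ, ContinuousLinearMap.prod_apply, add_apply, ContinuousLinearMap.comp_apply,
      smul_apply, ContinuousLinearMap.smulRight_apply, ContinuousLinearMap.coe_fst',
      ContinuousLinearMap.coe_snd', hpair, (fderiv_cotangentRetraction_zero hq _).2] at hX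
    have e1 := congrArg Prod.fst hX
    have e2 := congrArg Prod.snd hX
    simp at e1 e2
    set A := fderiv ℝ (fun y => U (κ y)) y₀ ξ with hAdef
    set C := fderiv ℝ (fun y => V (κ y)) y₀ ξ with hCdef
    have hqq : (inner ℝ (q : R3) (q : R3) : ℝ) = 1 := by
      rw [real_inner_self_eq_norm_sq, hq]; norm_num
    have hAq : (inner ℝ (q : R3) A : ℝ) = 0 := by
      rw [real_inner_comm, hAdef, hUx, derivInto_radialExt_self hf]
      exact ContinuousAlternatingMap.map_coord_zero _ 1 rfl
    rw [hAq] at e1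
    have hα : α = 0 := by
      have := congrArg (fun z => (inner ℝ (q : R3) z : ℝ)) e1
      simpa [inner_add_right, inner_smul_right, hAq, hqq] using this
    have hβ : β = 0 := by
      have := congrArg (fun z => (inner ℝ (q : R3) z : ℝ)) e2
      simpa [inner_add_right, inner_sub_right, inner_smul_right, hqq] using this
    have hA0 : A = 0 := by simpa [hα] using e1
    have hC : C = (inner ℝ (q : R3) C : ℝ) • (q : R3) := by
      simpa [hβ, sub_eq_zero] using e2
    have hξ : ξ = 0 := himm ξ (fun a => by
      change (inner ℝ A a : ℝ) = 0
      rw [hA0, inner_zero_left]) hC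
    rw [hξ, hα, hβ]; rfl
  obtain ⟨H, hHs, hHp, hGH, hHG⟩ := exists_smooth_local_inverse hGs hGd (by simp)
  rw [hGp] at hHs hHp hGH
  have hHc : ContinuousAt H (0, (q : R3)) := hHs.self_of_nhds.continuousAt
  refine ⟨fun p => κ (H p).1, ?_, by change κ (H (0, (q : R3))).1 = f q; rw [hHp, hκ0], ?_⟩
  · have ev : ∀ᶠ p in 𝓝 ((0, (q : R3)) : Ambient),
        ((H p).1 ∈ (extChartAt (𝓡 4) (f q)).target ∧ V (κ (H p).1) ≠ 0) ∧ -1 < (H p).2.2 := by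
      have h1 : ∀ᶠ x in 𝓝 ((y₀, 0, 0) : E4 × (ℝ × ℝ)),
          (x.1 ∈ (extChartAt (𝓡 4) (f q)).target ∧ V (κ x.1) ≠ 0) ∧ -1 < x.2.2 :=
        ((continuousAt_fst (p := ((y₀, 0, 0) : E4 × (ℝ × ℝ)))).eventually (htgt.and hVne)).and
          ((continuousAt_snd (p := ((y₀, 0, 0) : E4 × (ℝ × ℝ)))).snd.eventually
            (p := fun b => -1 < b) (isOpen_Ioi.mem_nhds (by simp)))
      have h2 := hHc.tendsto
      rw [hHp] at h2
      exact h2.eventually h1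
    filter_upwards [ev, hGH, hHs] with p h1 h2 h3
    refine ⟨ContMDiffAt.comp (g := κ) p (hκ _ h1.1.1) h3.fst.contMDiffAt, ?_⟩
    conv_rhs => rw [← h2]
    exact (cotangentRetraction_coneMap (cotangentRetraction_mem h1.1.2) h1.2).symm
  · have hcont : ContinuousAt (fun x => ((extChartAt (𝓡 4) (f q) x, 0, 0) : E4 × (ℝ × ℝ))) (f q) :=
      (continuousAt_extChartAt (I := 𝓡 4) (f q)).prodMk continuousAt_const
    refine ⟨{x | x ∈ (extChartAt (𝓡 4) (f q)).source ∧
      H (G (extChartAt (𝓡 4) (f q) x, 0, 0)) = (extChartAt (𝓡 4) (f q) x, 0, 0)},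
      Filter.inter_mem (extChartAt_source_mem_nhds (I := 𝓡 4) (f q)) (hcont.eventually hHG), ?_⟩
    rintro x ⟨hx1, hx2⟩ y ⟨hy1, hy2⟩ hxy
    have e1 : ∀ z ∈ (extChartAt (𝓡 4) (f q)).source,
        G (extChartAt (𝓡 4) (f q) z, 0, 0) = coneMap (cotangentRetraction (U z, V z), 0, 0) := by
      intro z hz
      have : κ (extChartAt (𝓡 4) (f q) z) = z := (extChartAt (𝓡 4) (f q)).left_inv hz
      simp only [G]
      rw [this]
    have hxy' : cotangentRetraction (U x, V x) = cotangentRetraction (U y, V y) := hxy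
    rw [e1 x hx1, hxy', ← e1 y hy1, hy2] at hx2
    exact (extChartAt (𝓡 4) (f q)).injOn hx1 hy1 (congrArg Prod.fst hx2).symm

end TubularInverse

section TubularMap

set_option linter.unusedSectionVars false

open Filter Topology

theorem cotangentRetraction_add {p : Ambient} (hp : p.2 ≠ 0) (c : ℝ) {e : ℝ} (he : 0 < e) :
    cotangentRetraction (p.1 + c • p.2, e • p.2) = cotangentRetraction p := by
  obtain ⟨u, v⟩ := p
  have hv : ‖v‖ ≠ 0 := norm_ne_zero_iff.2 hp
  have h4 : ‖e • v‖⁻¹ • e • v = ‖v‖⁻¹ • v := by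
    rw [norm_smul, Real.norm_eq_abs, abs_of_pos he, smul_smul]
    congr 1
    field_simp
  simp only [cotangentRetraction, h4]
  rw [inner_add_left, inner_smul_left v _ c, inner_smul_right v v, real_inner_self_eq_norm_sq]
  simp only [smul_smul, conj_trivial]
  have : c * (‖v‖⁻¹ * ‖v‖ ^ 2) * ‖v‖⁻¹ = c := by field_simp
  rw [add_mul, add_smul, this, add_sub_add_right_eq_sub]

/-- The derivative of the retraction onto the cotangent bundle vanishes in the two radial
directions. -/
theorem fderiv_cotangentRetraction_radial {p : Ambient} (hp : p.2 ≠ 0) (c e : ℝ) :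
    fderiv ℝ cotangentRetraction p (c • p.2, e • p.2) = 0 := by
  have h1 := ((contDiffAt_cotangentRetraction hp).differentiableAt (by simp)).hasFDerivAt
  have h2 : HasDerivAt (fun t : ℝ => p + t • ((c • p.2, e • p.2) : Ambient)) (c • p.2, e • p.2) 0 := by
    simpa using ((hasDerivAt_id (0 : ℝ)).smul_const ((c • p.2, e • p.2) : Ambient)).const_add p
  have h3 : HasDerivAt (fun t : ℝ => cotangentRetraction (p + t • ((c • p.2, e • p.2) : Ambient))) _ 0 :=
    HasFDerivAt.comp_hasDerivAt (l := cotangentRetraction) (0 : ℝ) (by simpa using h1) h2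
  have h4 : HasDerivAt (fun t : ℝ => cotangentRetraction (p + t • ((c • p.2, e • p.2) : Ambient))) 0 0 := by
    refine (hasDerivAt_const (0 : ℝ) (cotangentRetraction p)).congr_of_eventuallyEq ?_
    have : ∀ᶠ t : ℝ in 𝓝 0, 0 < 1 + t * e :=
      (isOpen_Ioi.preimage (f := fun t : ℝ => 1 + t * e) (by fun_prop)).mem_nhds (by simp)
    filter_upwards [this] with t ht
    rw [← cotangentRetraction_add hp (t * c) ht]
    congr 1
    ext1 <;> simp [smul_smul, add_smul]
  exact h3.unique h4

variable {M : Type*} [TopologicalSpace M] [T2Space M] [CompactSpace M]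
  [ChartedSpace (EuclideanSpace ℝ (Fin 4)) M] [IsManifold (𝓡 4) ∞ M]
  {η : TwoForm M} {f : Sph → M}

/-- A smooth parametrization `i` of a neighbourhood of the Lagrangian sphere by the cotangent
bundle, extended to a neighbourhood in `ℝ³ × ℝ³` by means of the retraction, with inverse `j`. It
is the given embedding on the zero-section, and the cotangent directions are normalized
by the symplectic form there. -/
structure IsTubularMap (η : TwoForm M) (f : Sph → M) (i : Ambient → M) (j : M → Ambient) :
    Prop where
  smooth : ∀ p ∈ zeroSection, ∀ᶠ p' in 𝓝 p, ContMDiffAt 𝓘(ℝ, Ambient) (𝓡 4) ∞ i p' ∧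
    j (i p') = cotangentRetraction p'
  retract : ∀ p, p.2 ≠ 0 → i (cotangentRetraction p) = i p
  zero : ∀ v, v ≠ 0 → i (0, v) = radialExt f v
  pairing : ∀ (q : Sph) (X : Ambient) (a : R3), pullForm η i (0, (q : R3)) ![X, (0, a)] =
    inner ℝ X.1 a - inner ℝ (q : R3) X.1 * inner ℝ (q : R3) a

theorem derivInto_zero_prod {i : Ambient → M} {v : R3} (hv : v ≠ 0)
    (hi : ContMDiffAt 𝓘(ℝ, Ambient) (𝓡 4) ∞ i (0, v))
    (hz : ∀ v, v ≠ 0 → i (0, v) = radialExt f v) (a : R3) :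
    derivInto i (0, v) (0, a) = derivInto (radialExt f) v a := by
  have h1 : HasFDerivAt (fun v : R3 => ((0, v) : Ambient)) (ContinuousLinearMap.inr ℝ R3 R3) v :=
    (ContinuousLinearMap.inr ℝ R3 R3).hasFDerivAt
  have h2 : HasMFDerivAt 𝓘(ℝ, R3) (𝓡 4) (i ∘ fun v : R3 => ((0, v) : Ambient)) v _ :=
    HasMFDerivAt.comp v (hi.mdifferentiableAt (by simp)).hasMFDerivAt h1.hasMFDerivAt
  have h3 : HasMFDerivAt 𝓘(ℝ, R3) (𝓡 4) (radialExt f) v _ :=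
    h2.congr_of_eventuallyEq (by
      filter_upwards [isOpen_ne.mem_nhds hv] with w hw
      exact (hz w hw).symm)
  have h4 := h3.mfderiv
  have h5 : derivInto (radialExt f) v =
    (derivInto i (0, v)).comp (ContinuousLinearMap.inr ℝ R3 R3) := h4
  rw [h5]
  rfl

theorem exists_tubularMap (hη : IsSymplecticForm η) (hfe : Manifold.IsSmoothEmbedding (𝓡 2) (𝓡 4) ∞ f)
    (hl : ∀ (q : Sph) (a b : TangentSpace (𝓡 2) q),
      η (f q) ![mfderiv (𝓡 2) (𝓡 4) f q a, mfderiv (𝓡 2) (𝓡 4) f q b] = 0) :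
    ∃ i j, IsTubularMap η f i j := by
  have hf : ContMDiff (𝓡 2) (𝓡 4) ∞ f := hfe.contMDiff
  obtain ⟨V, hV, hVf⟩ := exists_leftInverse hfe
  obtain ⟨U, hU, hUf, hUd⟩ := exists_normal_function hη hf hV hl hVf
  have hloc := exists_local_tubular_inverse hη hf hl hU hV hUf hVf hUd
  obtain ⟨j, hj⟩ : ∃ j : M → Ambient, j = fun x => cotangentRetraction (U x, V x) := ⟨_, rfl⟩
  have hjx : ∀ x, cotangentRetraction (U x, V x) = j x := fun x => by rw [hj]
  rw [← hj] at hloc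
  simp only [hjx] at hloc
  have hsph : ∀ q : Sph, ‖(q : R3)‖ = 1 := fun q => by simp
  have hq0 : ∀ q : Sph, (q : R3) ≠ 0 := fun q h => by
    have := hsph q
    rw [h] at this; simp at this
  have hjf : ∀ q : Sph, j (f q) = (0, (q : R3)) := fun q => by
    have h : ((0, (q : R3)) : Ambient) ∈ cotangentBundle := zeroSection_subset ⟨rfl, hsph q⟩
    rw [← hjx, hUf, hVf, cotangentRetraction_of_mem h]
  have hjc : ∀ q : Sph, ContinuousAt j (f q) := fun q => by
    have h0 : ((U (f q), V (f q)) : Ambient).2 ≠ 0 := by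
      change V (f q) ≠ 0
      rw [hVf]; exact hq0 q
    have h1 : ContinuousAt cotangentRetraction (U (f q), V (f q)) :=
      (contDiffAt_cotangentRetraction h0).continuousAt
    rw [hj]
    exact ContinuousAt.comp (g := cotangentRetraction) (f := fun x => ((U x, V x) : Ambient)) h1
      ((hU (f q)).continuousAt.prodMk (hV (f q)).continuousAt)
  obtain ⟨N, hN, hinj⟩ := Set.InjOn.exists_mem_nhdsSet (f := j) (s := Set.range f)
    (by
      rintro _ ⟨q, rfl⟩ _ ⟨q', rfl⟩ h
      rw [hjf, hjf] at h
      rw [Subtype.ext (congrArg Prod.snd h)])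
    (isCompact_range hf.continuous) (by rintro _ ⟨q, rfl⟩; exact hjc q)
    (by
      rintro _ ⟨q, rfl⟩
      obtain ⟨_, _, _, h⟩ := hloc q
      exact h)
  have hNf : ∀ q : Sph, N ∈ 𝓝 (f q) := fun q => mem_nhdsSet_iff_forall.1 hN _ ⟨q, rfl⟩
  set i : Ambient → M := fun p => @Function.invFunOn M Ambient ⟨f (sphereProj 0)⟩ j N (cotangentRetraction p) with hi
  have hinv : ∀ x ∈ N, ∀ p, j x = cotangentRetraction p → i p = x := fun x hx p hp => by
    have : Nonempty M := ⟨x⟩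
    simp only [hi]
    rw [← hp]
    exact hinj.leftInvOn_invFunOn hx
  have hloc' : ∀ q : Sph, ∃ k : Ambient → M, k (0, (q : R3)) = f q ∧
      ∀ᶠ p in 𝓝 ((0, (q : R3)) : Ambient), ContMDiffAt 𝓘(ℝ, Ambient) (𝓡 4) ∞ k p ∧
        j (k p) = cotangentRetraction p ∧ i p = k p := by
    intro q
    obtain ⟨k, hk, hkq, -⟩ := hloc q
    have hkc : ContinuousAt k (0, (q : R3)) := hk.self_of_nhds.1.continuousAt
    have h1 : ∀ᶠ p in 𝓝 ((0, (q : R3)) : Ambient), k p ∈ N :=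
      hkc.preimage_mem_nhds (by rw [hkq]; exact hNf q)
    refine ⟨k, hkq, ?_⟩
    filter_upwards [hk, h1] with p hp hpN using ⟨hp.1, hp.2, hinv _ hpN _ hp.2⟩
  have hsmooth : ∀ p ∈ zeroSection, ∀ᶠ p' in 𝓝 p, ContMDiffAt 𝓘(ℝ, Ambient) (𝓡 4) ∞ i p' ∧
      j (i p') = cotangentRetraction p' := by
    rintro ⟨u, v⟩ ⟨hu, hv⟩
    obtain rfl : u = 0 := hu
    obtain ⟨k, -, hk⟩ := hloc' ⟨v, by simpa using hv⟩
    filter_upwards [hk.eventually_nhds] with p hp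
    obtain ⟨h1, h2, h3⟩ := hp.self_of_nhds
    refine ⟨h1.congr_of_eventuallyEq (hp.mono fun _ h => h.2.2), by rw [h3, h2]⟩
  have hzero : ∀ v, v ≠ 0 → i (0, v) = radialExt f v := by
    intro v hv
    refine hinv _ (mem_of_mem_nhds (hNf _)) _ ?_
    rw [hjf, coe_sphereProj hv]
    simp [cotangentRetraction]
  refine ⟨i, j, hsmooth, ?_, hzero, ?_⟩
  · intro p hp
    simp only [hi]
    rw [cotangentRetraction_of_mem (cotangentRetraction_mem hp)]
  · intro q X a
    have hev := hsmooth (0, (q : R3)) ⟨rfl, hsph q⟩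
    have hiq := hev.self_of_nhds.1
    have hif : i (0, (q : R3)) = f q := by rw [hzero _ (hq0 q), radialExt_coe]
    have e1 : pullForm η i (0, (q : R3)) ![X, (0, a)] = formAt η (i (0, (q : R3)))
      ![derivInto i (0, (q : R3)) X, derivInto i (0, (q : R3)) (0, a)] := pullForm_apply _ _ _ _ _
    rw [e1, derivInto_zero_prod (hq0 q) hiq hzero, hif, ← hUd hiq hif]
    have hd1 : DifferentiableAt ℝ (fun y => U (i y)) (0, (q : R3)) :=
      ((hU _).comp _ hiq).contDiffAt.differentiableAt (by simp)
    have hd2 : DifferentiableAt ℝ (fun y => V (i y)) (0, (q : R3)) :=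
      ((hV _).comp _ hiq).contDiffAt.differentiableAt (by simp)
    have hr := fun X => fderiv_cotangentRetraction_zero (hsph q) X
    have hUVq : (U (i (0, (q : R3))), V (i (0, (q : R3)))) = ((0, (q : R3)) : Ambient) := by
      rw [hif, hUf, hVf]
    have h1 : HasFDerivAt (fun y => cotangentRetraction (U (i y), V (i y))) _ ((0, (q : R3)) : Ambient) :=
      HasFDerivAt.comp (g := cotangentRetraction) ((0, (q : R3)) : Ambient)
        (by rw [hUVq]; exact (hr 0).1) (hd1.hasFDerivAt.prodMk hd2.hasFDerivAt)
    have h2 : HasFDerivAt (fun y => cotangentRetraction (U (i y), V (i y))) _ ((0, (q : R3)) : Ambient) :=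
      (hr 0).1.congr_of_eventuallyEq (hev.mono fun _ h => (hjx _).trans h.2)
    have h3 := congrArg (fun L : Ambient →L[ℝ] Ambient => L X) (h1.unique h2)
    simp only [ContinuousLinearMap.comp_apply, ContinuousLinearMap.prod_apply] at h3
    rw [(hr _).2, (hr _).2] at h3
    have h4 := congrArg Prod.fst h3
    have h5 : (inner ℝ (q : R3) (fderiv ℝ (fun y => U (i y)) (0, (q : R3)) X) : ℝ) = 0 := by
      rw [real_inner_comm, hUd hiq hif, derivInto_radialExt_self hf]
      exact ContinuousAlternatingMap.map_coord_zero _ 1 rfl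
    simp only [h5, zero_smul, sub_zero] at h4
    rw [h4, inner_sub_left, inner_smul_left]
    simp

end TubularMap

/-! ### Closed two-forms near the zero-section, and their primitives -/

section Primitive

set_option linter.unusedSectionVars false

open Filter Topology

/-- A function which is smooth near a compact set coincides near that set with a compactly
supported smooth function. -/
theorem exists_contDiff_extension {E F : Type} [NormedAddCommGroup E] [NormedSpace ℝ E]
    [FiniteDimensional ℝ E] [NormedAddCommGroup F] [NormedSpace ℝ F] {K : Set E} (hK : IsCompact K)
    {g : E → F} (hg : ∀ p ∈ K, ∀ᶠ p' in 𝓝 p, ContDiffAt ℝ ∞ g p') :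
    ∃ g' : E → F, ContDiff ℝ ∞ g' ∧ HasCompactSupport g' ∧ ∀ p ∈ K, ∀ᶠ p' in 𝓝 p, g' p' = g p' := by
  obtain ⟨L, hL, hKL, hLU⟩ := exists_compact_between (K := K)
    (U := interior {p | ContDiffAt ℝ ∞ g p}) hK isOpen_interior
    (fun p hp => mem_interior_iff_mem_nhds.2 (hg p hp))
  obtain ⟨χ, h1, h0, -⟩ := exists_contMDiffMap_one_nhds_of_subset_interior 𝓘(ℝ, E) (n := ⊤)
    hK.isClosed hKL
  have hχ : ContDiff ℝ ∞ χ := χ.contMDiff.contDiff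
  refine ⟨fun p => χ p • g p, contDiff_iff_contDiffAt.2 fun p => ?_, ?_, fun p hp => ?_⟩
  · by_cases hp : p ∈ L
    · exact hχ.contDiffAt.smul (interior_subset (hLU hp))
    · refine contDiffAt_const (c := (0 : F)).congr_of_eventuallyEq ?_
      filter_upwards [hL.isClosed.isOpen_compl.mem_nhds hp] with q hq
      rw [h0 q hq, zero_smul]
  · exact HasCompactSupport.intro hL fun p hp => by rw [h0 p hp, zero_smul]
  · filter_upwards [eventually_nhdsSet_iff_forall.1 h1 p hp] with q hq
    rw [hq, one_smul]

/-- A two-form on `ℝ³ × ℝ³` which, near the zero-section, is smooth, closed, pulled back from the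
cotangent bundle by the retraction (so that it is killed by the radial vectors), and for which the
zero-section is Lagrangian. -/
def IsBasicClosed (σ : Ambient → Ambient [⋀^Fin 2]→L[ℝ] ℝ) : Prop :=
  ∀ p ∈ zeroSection, ∀ᶠ p' in 𝓝 p, ContDiffAt ℝ ∞ σ p' ∧ extDeriv σ p' = 0 ∧
    (∀ (X : Ambient) (c e : ℝ), σ p' ![X, (c • p'.2, e • p'.2)] = 0) ∧
    ∀ a b : R3, σ (0, p'.2) ![(0, a), (0, b)] = 0

theorem tendsto_zero_snd {p : Ambient} (hp : p ∈ zeroSection) :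
    Tendsto (fun p' : Ambient => ((0, p'.2) : Ambient)) (𝓝 p) (𝓝 p) := by
  have h : ContinuousAt (fun p' : Ambient => ((0, p'.2) : Ambient)) p := by fun_prop
  have e : ((0, p.2) : Ambient) = p := Prod.ext hp.1.symm rfl
  have := h.tendsto
  rwa [e] at this

theorem IsBasicClosed.congr {σ τ : Ambient → Ambient [⋀^Fin 2]→L[ℝ] ℝ} (h : IsBasicClosed σ)
    (hτ : ∀ p ∈ zeroSection, ∀ᶠ p' in 𝓝 p, τ p' = σ p') : IsBasicClosed τ := fun p hp => by
  filter_upwards [h p hp, (hτ p hp).eventually_nhds, (tendsto_zero_snd hp).eventually (hτ p hp)]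
    with p' h1 h2 h3
  have h4 : τ =ᶠ[𝓝 p'] σ := h2
  refine ⟨h1.1.congr_of_eventuallyEq h4, ?_, fun X c e => ?_, fun a b => ?_⟩
  · rw [h4.extDeriv_eq (𝕜 := ℝ), h1.2.1]
  · rw [h4.self_of_nhds, h1.2.2.1]
  · rw [h3, h1.2.2.2]

theorem IsBasicClosed.sub {σ τ : Ambient → Ambient [⋀^Fin 2]→L[ℝ] ℝ} (hσ : IsBasicClosed σ)
    (hτ : IsBasicClosed τ) : IsBasicClosed (fun p => σ p - τ p) := fun p hp => by
  filter_upwards [hσ p hp, hτ p hp] with p' h1 h2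
  refine ⟨h1.1.sub h2.1, ?_, fun X c e => ?_, fun a b => ?_⟩
  · have h3 : (fun p => σ p - τ p) = σ + (-1 : ℝ) • τ := by
      funext p
      exact (sub_eq_add_neg _ _).trans (congrArg _ (neg_one_smul ℝ (τ p)).symm)
    rw [h3, extDeriv_add (h1.1.differentiableAt (by simp))
      ((h2.1.differentiableAt (by simp)).const_smul _), extDeriv_smul, h1.2.1, h2.2.1]
    simp
  · rw [ContinuousAlternatingMap.sub_apply, h1.2.2.1, h2.2.2.1, sub_zero]
  · rw [ContinuousAlternatingMap.sub_apply, h1.2.2.2, h2.2.2.2, sub_zero]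

/-- Closedness of a two-form, in terms of the derivative of the underlying bilinear form. -/
theorem fderiv_toBilin_of_closed {E : Type*} [NormedAddCommGroup E] [NormedSpace ℝ E]
    {σ : E → E [⋀^Fin 2]→L[ℝ] ℝ} {p : E}
    (h : DifferentiableAt ℝ σ p) (hc : extDeriv σ p = 0) (a b c : E) :
    fderiv ℝ (fun q => toBilin (σ q)) p a b c =
      fderiv ℝ (fun q => toBilin (σ q)) p b a c - fderiv ℝ (fun q => toBilin (σ q)) p c a b := by
  have h1 := extDeriv_two_apply h a b c
  have h2 : DifferentiableAt ℝ (fun q => toBilin (σ q)) p :=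
    (contDiff_toBilin.contDiffAt.differentiableAt (by simp)).comp p h
  have h3 : ∀ x y z : E, fderiv ℝ (fun q => σ q ![y, z]) p x =
      fderiv ℝ (fun q => toBilin (σ q)) p x y z := by
    intro x y z
    have h4 := ((h2.hasFDerivAt.clm_apply (hasFDerivAt_const y p)).clm_apply
      (hasFDerivAt_const z p)).fderiv
    simp only [toBilin_apply] at h4
    rw [h4]
    simp
  rw [hc, h3, h3, h3] at h1
  have h5 : (0 : E [⋀^Fin 3]→L[ℝ] ℝ) ![a, b, c] = 0 := rfl
  have h6 := h1.symm.trans h5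
  linarith

/-- The scaling of the fibres of the cotangent bundle. -/
def fibreScale (s : ℝ) : Ambient →L[ℝ] Ambient :=
  s • (ContinuousLinearMap.inl ℝ R3 R3).comp (ContinuousLinearMap.fst ℝ R3 R3) +
    (ContinuousLinearMap.inr ℝ R3 R3).comp (ContinuousLinearMap.snd ℝ R3 R3)

@[simp] theorem fibreScale_apply (s : ℝ) (X : Ambient) : fibreScale s X = (s • X.1, X.2) := by
  simp [fibreScale]

theorem contDiff_fibreScale : ContDiff ℝ ∞ fibreScale := by
  unfold fibreScale; fun_prop

/-- The integrand of the fibrewise Poincaré primitive. -/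
def primitiveIntegrand (τ : Ambient → Ambient [⋀^Fin 2]→L[ℝ] ℝ) (x : ℝ × Ambient) : Ambient →L[ℝ] ℝ :=
  (toBilin (τ (fibreScale x.1 x.2)) (x.2.1, 0)).comp (fibreScale x.1)

/-- The primitive of a closed two-form which is obtained by contracting the fibres of the cotangent
bundle. -/
def fibrePrimitive (τ : Ambient → Ambient [⋀^Fin 2]→L[ℝ] ℝ) (p : Ambient) : Ambient →L[ℝ] ℝ :=
  ∫ s in (0 : ℝ)..1, primitiveIntegrand τ (s, p)

section

variable {τ : Ambient → Ambient [⋀^Fin 2]→L[ℝ] ℝ} (hτ : ContDiff ℝ ∞ τ)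
include hτ

theorem contDiff_primitiveIntegrand : ContDiff ℝ ∞ (primitiveIntegrand τ) := by
  have h1 : ContDiff ℝ ∞ (fun x : ℝ × Ambient => fibreScale x.1 x.2) :=
    (contDiff_fibreScale.comp contDiff_fst).clm_apply contDiff_snd
  have h2 : ContDiff ℝ ∞ (fun x : ℝ × Ambient => toBilin (τ (fibreScale x.1 x.2))) :=
    contDiff_toBilin.comp (hτ.comp h1)
  have h3 : ContDiff ℝ ∞ (fun x : ℝ × Ambient => ((x.2.1, 0) : Ambient)) := by fun_prop
  exact (h2.clm_apply h3).clm_comp (contDiff_fibreScale.comp contDiff_fst)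

theorem contDiff_fibrePrimitive : ContDiff ℝ ∞ (fibrePrimitive τ) :=
  (contDiff_unitIntegral (contDiff_primitiveIntegrand hτ)).1

theorem fibrePrimitive_apply (p X : Ambient) : fibrePrimitive τ p X =
    ∫ s in (0 : ℝ)..1, primitiveIntegrand τ (s, p) X := by
  refine ContinuousLinearMap.intervalIntegral_apply (Continuous.intervalIntegrable ?_ _ _) X
  exact (contDiff_primitiveIntegrand hτ).continuous.comp (by fun_prop)

theorem fibrePrimitive_zero {p : Ambient} (hp : p.1 = 0) : fibrePrimitive τ p = 0 := by
  refine ContinuousLinearMap.ext fun X => ?_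
  rw [fibrePrimitive_apply hτ]
  have h : ((p.1, 0) : Ambient) = 0 := by rw [hp]; rfl
  simp [primitiveIntegrand, h]

theorem eventually_segment {P : Ambient → Prop} {p : Ambient} (hp : p ∈ zeroSection)
    (h : ∀ᶠ p' in 𝓝 p, P p') :
    ∀ᶠ p' in 𝓝 p, ∀ s ∈ Set.Icc (0 : ℝ) 1, P (fibreScale s p') := by
  obtain ⟨r, hr, hP⟩ := Metric.eventually_nhds_iff.1 h
  refine Metric.eventually_nhds_iff.2 ⟨r, hr, fun p' hp' s hs => hP ?_⟩
  rw [Prod.dist_eq] at hp' ⊢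
  refine lt_of_le_of_lt (max_le_max ?_ (by simp)) hp'
  rw [hp.1, dist_zero_right, dist_zero_right, fibreScale_apply]
  change ‖s • p'.1‖ ≤ ‖p'.1‖
  rw [norm_smul, Real.norm_eq_abs, abs_of_nonneg hs.1]
  exact mul_le_of_le_one_left (norm_nonneg _) hs.2

theorem fibrePrimitive_radial (hb : IsBasicClosed τ) {p : Ambient} (hp : p ∈ zeroSection) :
    ∀ᶠ p' in 𝓝 p, ∀ c e : ℝ, fibrePrimitive τ p' (c • p'.2, e • p'.2) = 0 := by
  filter_upwards [eventually_segment hτ hp (hb p hp)] with p' h c e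
  rw [fibrePrimitive_apply hτ]
  refine (intervalIntegral.integral_congr (g := fun _ => (0 : ℝ)) fun s hs => ?_).trans (by simp)
  rw [Set.uIcc_of_le zero_le_one] at hs
  have h1 := (h s hs).2.2.1 (p'.1, 0) (s * c) e
  simp only [primitiveIntegrand, ContinuousLinearMap.comp_apply, toBilin_apply]
  simpa [smul_smul] using h1

theorem extDerivOne_fibrePrimitive (hb : IsBasicClosed τ) {p : Ambient} (hp : p ∈ zeroSection) :
    ∀ᶠ p' in 𝓝 p, extDerivOne (fibrePrimitive τ) p' = τ p' := by
  filter_upwards [eventually_segment hτ hp (hb p hp)] with p' h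
  refine form_ext fun X Y => ?_
  rw [extDerivOne_apply ((contDiff_fibrePrimitive hτ).differentiable (by simp) p')]
  set T : Ambient → Ambient →L[ℝ] Ambient →L[ℝ] ℝ := fun q => toBilin (τ q) with hT
  have hTd : ContDiff ℝ ∞ T := contDiff_toBilin.comp hτ
  have hscale : ∀ (s : ℝ) (q : Ambient), HasFDerivAt (fun x : ℝ × Ambient => fibreScale x.1 x.2)
      ((ContinuousLinearMap.fst ℝ ℝ Ambient).smulRight ((q.1, 0) : Ambient) +
        (fibreScale s).comp (ContinuousLinearMap.snd ℝ ℝ Ambient)) (s, q) := by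
    intro s q
    simp only [fibreScale_apply]
    have h1 : HasFDerivAt (fun x : ℝ × Ambient => x.1 • x.2.1) _ (s, q) :=
      (hasFDerivAt_fst (𝕜 := ℝ) (E := ℝ) (F := Ambient) (p := (s, q))).smul
        (hasFDerivAt_snd (𝕜 := ℝ) (E := ℝ) (F := Ambient) (p := (s, q))).fst
    have h2 := h1.prodMk (hasFDerivAt_snd (𝕜 := ℝ) (E := ℝ) (F := Ambient) (p := (s, q))).snd
    refine h2.congr_fderiv ?_
    refine ContinuousLinearMap.ext fun x => ?_
    ext1 <;> simp [add_comm]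
  have hint : ∀ Z : Ambient, ContDiff ℝ ∞ (fun x : ℝ × Ambient => primitiveIntegrand τ x Z) :=
    fun Z => (contDiff_primitiveIntegrand hτ).clm_apply contDiff_const
  have hfd : ∀ (Z W : Ambient) (s : ℝ),
      fderiv ℝ (fun x : ℝ × Ambient => primitiveIntegrand τ x Z) (s, p') (0, W) =
        fderiv ℝ T (fibreScale s p') (fibreScale s W) (p'.1, 0) (fibreScale s Z) +
          T (fibreScale s p') (W.1, 0) (fibreScale s Z) := by
    intro Z W s
    have e1 : HasFDerivAt (fun x : ℝ × Ambient => T (fibreScale x.1 x.2)) _ (s, p') :=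
      HasFDerivAt.comp (g := T) (f := fun x : ℝ × Ambient => fibreScale x.1 x.2) (s, p')
        (hTd.differentiable (by simp) _).hasFDerivAt (hscale s p')
    have e2 : HasFDerivAt (fun x : ℝ × Ambient => ((x.2.1, 0) : Ambient))
        ((ContinuousLinearMap.inl ℝ R3 R3).comp ((ContinuousLinearMap.fst ℝ R3 R3).comp
          (ContinuousLinearMap.snd ℝ ℝ Ambient))) (s, p') :=
      ((ContinuousLinearMap.inl ℝ R3 R3).comp ((ContinuousLinearMap.fst ℝ R3 R3).comp
          (ContinuousLinearMap.snd ℝ ℝ Ambient))).hasFDerivAt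
    have e3 : HasFDerivAt (fun x : ℝ × Ambient => fibreScale x.1 Z)
        ((ContinuousLinearMap.fst ℝ ℝ Ambient).smulRight ((Z.1, 0) : Ambient)) (s, p') := by
      have h1 := (hscale s Z).comp (s, p') ((hasFDerivAt_fst (𝕜 := ℝ) (E := ℝ) (F := Ambient)
        (p := (s, p'))).prodMk (hasFDerivAt_const Z (s, p')))
      refine h1.congr_fderiv ?_
      refine ContinuousLinearMap.ext fun x => ?_
      simp
    have e4 := ((e1.clm_apply e2).clm_apply e3).fderiv
    have e5 : (fun x : ℝ × Ambient => primitiveIntegrand τ x Z) =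
        fun x : ℝ × Ambient => T (fibreScale x.1 x.2) (x.2.1, 0) (fibreScale x.1 Z) := rfl
    rw [e5, e4]
    simp only [add_apply, ContinuousLinearMap.comp_apply, ContinuousLinearMap.flip_apply,
      ContinuousLinearMap.smulRight_apply, ContinuousLinearMap.coe_fst',
      ContinuousLinearMap.coe_snd', zero_smul, zero_add, ContinuousLinearMap.inl_apply, map_zero]
    exact add_comm _ _
  have hcont : ∀ Z W : Ambient, Continuous
      (fun s : ℝ => fderiv ℝ (fun x : ℝ × Ambient => primitiveIntegrand τ x Z) (s, p') (0, W)) := by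
    intro Z W
    have h1 := (hint Z).continuous_fderiv (by simp)
    exact (h1.comp (Continuous.prodMk continuous_id continuous_const)).clm_apply continuous_const
  simp only [fibrePrimitive_apply hτ]
  rw [(contDiff_unitIntegral (hint Y)).2, (contDiff_unitIntegral (hint X)).2,
    ← intervalIntegral.integral_sub ((hcont Y X).intervalIntegrable _ _)
      ((hcont X Y).intervalIntegrable _ _)]
  have hder : ∀ s ∈ Set.uIcc (0 : ℝ) 1,
        HasDerivAt (fun s => T (fibreScale s p') (fibreScale s X) (fibreScale s Y))
        (fderiv ℝ (fun x : ℝ × Ambient => primitiveIntegrand τ x Y) (s, p') (0, X) -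
          fderiv ℝ (fun x : ℝ × Ambient => primitiveIntegrand τ x X) (s, p') (0, Y)) s := by
      intro s hs
      rw [Set.uIcc_of_le zero_le_one] at hs
      have hd : ∀ Z : Ambient, HasDerivAt (fun s => fibreScale s Z) (Z.1, 0) s := by
        intro Z
        have := (hscale s Z).comp_hasDerivAt s ((hasDerivAt_id s).prodMk (hasDerivAt_const s Z))
        refine this.congr_deriv ?_
        simp
      have d1 : HasDerivAt (fun s => T (fibreScale s p')) _ s :=
        HasFDerivAt.comp_hasDerivAt (l := T) (f := fun s => fibreScale s p') s
          (hTd.differentiable (by simp) _).hasFDerivAt (hd p')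
      refine ((d1.clm_apply (hd X)).clm_apply (hd Y)).congr_deriv ?_
      have hcl := fderiv_toBilin_of_closed ((h s hs).1.differentiableAt (by simp)) (h s hs).2.1
        ((p'.1, 0) : Ambient) (fibreScale s X) (fibreScale s Y)
      have hsw : T (fibreScale s p') (fibreScale s X) (Y.1, 0) =
          - T (fibreScale s p') (Y.1, 0) (fibreScale s X) := by
        simp only [hT, toBilin_apply]; rw [form_swap]
      change fderiv ℝ T _ _ _ _ = fderiv ℝ T _ _ _ _ - fderiv ℝ T _ _ _ _ at hcl
      rw [hfd, hfd, add_apply, hcl, hsw]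
      ring
  rw [intervalIntegral.integral_eq_sub_of_hasDerivAt hder
    (((hcont Y X).sub (hcont X Y)).intervalIntegrable _ _)]
  have h0 := (h 0 ⟨le_rfl, zero_le_one⟩).2.2.2 X.2 Y.2
  have e0 : T (fibreScale 0 p') (fibreScale 0 X) (fibreScale 0 Y) = 0 := by
    simp only [hT, toBilin_apply]
    simpa using h0
  rw [e0, sub_zero]
  simp [hT, toBilin_apply]

end

end Primitive

/-! ### The two symplectic structures near the zero-section -/

section BasicForms

set_option linter.unusedSectionVars false

open Filter Topology

/-- The two-form `du ∧ dv` on `ℝ³ × ℝ³`. -/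
def stdTwoForm : Ambient [⋀^Fin 2]→L[ℝ] ℝ :=
  altForm ((isBoundedBilinearMap_inner (𝕜 := ℝ) (E := R3)).toContinuousLinearMap.bilinearComp
    (ContinuousLinearMap.fst ℝ R3 R3) (ContinuousLinearMap.snd ℝ R3 R3))

theorem stdTwoForm_apply (X Y : Ambient) : stdTwoForm ![X, Y] = stdForm X Y := by
  rw [stdTwoForm, altForm_apply]
  rfl

/-- The pullback of `du ∧ dv` under the retraction onto the cotangent bundle. -/
def retractedStdForm (p : Ambient) : Ambient [⋀^Fin 2]→L[ℝ] ℝ :=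
  stdTwoForm.compContinuousLinearMap (fderiv ℝ cotangentRetraction p)

theorem retractedStdForm_apply (p X Y : Ambient) : retractedStdForm p ![X, Y] =
    stdForm (fderiv ℝ cotangentRetraction p X) (fderiv ℝ cotangentRetraction p Y) := by
  rw [retractedStdForm, compContinuousLinearMap_apply_pair, stdTwoForm_apply]

/-- The derivative of `⟨u, v⟩`. -/
def derivPairing (p : Ambient) : Ambient →L[ℝ] ℝ :=
  (innerSL ℝ p.2).comp (ContinuousLinearMap.fst ℝ R3 R3) +
    (innerSL ℝ p.1).comp (ContinuousLinearMap.snd ℝ R3 R3)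

/-- The derivative of `‖v‖² / 2`. -/
def derivHalfSq (p : Ambient) : Ambient →L[ℝ] ℝ :=
  (innerSL ℝ p.2).comp (ContinuousLinearMap.snd ℝ R3 R3)

@[simp] theorem derivPairing_apply (p X : Ambient) :
    derivPairing p X = inner ℝ p.2 X.1 + inner ℝ p.1 X.2 := rfl

@[simp] theorem derivHalfSq_apply (p X : Ambient) : derivHalfSq p X = inner ℝ p.2 X.2 := rfl

theorem contDiff_derivPairing : ContDiff ℝ ∞ derivPairing := by
  rw [contDiff_clm_apply_iff]
  intro X
  simp only [derivPairing_apply]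
  exact (contDiff_snd.inner ℝ contDiff_const).add (contDiff_fst.inner ℝ contDiff_const)

theorem contDiff_derivHalfSq : ContDiff ℝ ∞ derivHalfSq := by
  rw [contDiff_clm_apply_iff]
  intro X
  simp only [derivHalfSq_apply]
  exact contDiff_snd.inner ℝ contDiff_const

/-- The two-form which completes the symplectic form of the cotangent bundle to one of
`ℝ³ × ℝ³`. -/
def normalForm (p : Ambient) : Ambient [⋀^Fin 2]→L[ℝ] ℝ :=
  altForm ((derivPairing p).smulRight (derivHalfSq p))

theorem normalForm_apply (p X Y : Ambient) : normalForm p ![X, Y] =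
    derivPairing p X * derivHalfSq p Y - derivPairing p Y * derivHalfSq p X := by
  rw [normalForm, altForm_apply]
  simp

theorem contDiff_normalForm : ContDiff ℝ ∞ normalForm :=
  contDiff_iff_contDiffAt.2 fun p => contDiffAt_form fun X Y => by
    simp only [normalForm_apply]
    have h1 := fun X => (contDiff_derivPairing.clm_apply (contDiff_const (c := X))).contDiffAt (x := p)
    have h2 := fun X => (contDiff_derivHalfSq.clm_apply (contDiff_const (c := X))).contDiffAt (x := p)
    exact ((h1 X).mul (h2 Y)).sub ((h1 Y).mul (h2 X))

theorem snd_ne_zero_of_mem_zeroSection {p : Ambient} (hp : p ∈ zeroSection) : p.2 ≠ 0 :=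
  ne_zero_of_mem_cotangentBundle (zeroSection_subset hp)

theorem eventually_snd_ne_zero {p : Ambient} (hp : p ∈ zeroSection) : ∀ᶠ p' in 𝓝 p, p'.2 ≠ 0 :=
  continuousAt_snd.preimage_mem_nhds (isOpen_ne.mem_nhds (snd_ne_zero_of_mem_zeroSection hp))

theorem retractedStdForm_add_normalForm {p : Ambient} (hp : p ∈ zeroSection) (X Y : Ambient) :
    retractedStdForm p ![X, Y] + normalForm p ![X, Y] = stdForm X Y := by
  obtain ⟨u, v⟩ := p
  obtain rfl : u = 0 := hp.1
  have hv : ‖v‖ = 1 := hp.2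
  have hvv : (inner ℝ v v : ℝ) = 1 := by rw [real_inner_self_eq_norm_sq, hv]; norm_num
  rw [retractedStdForm_apply, normalForm_apply, (fderiv_cotangentRetraction_zero hv X).2,
    (fderiv_cotangentRetraction_zero hv Y).2]
  simp only [stdForm, derivPairing_apply, derivHalfSq_apply, inner_sub_left, inner_sub_right,
    inner_smul_left, inner_smul_right, hvv, inner_zero_left, conj_trivial,
    real_inner_comm v X.1, real_inner_comm v Y.1]
  ring

theorem isBasicClosed_retractedStdForm : IsBasicClosed retractedStdForm := fun p hp => by
  filter_upwards [eventually_snd_ne_zero hp] with p' hp'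
  have hπ := contDiffAt_cotangentRetraction hp'
  refine ⟨?_, ?_, fun X c e => ?_, fun a b => ?_⟩
  · exact contDiffAt_pullback (τ := fun _ => stdTwoForm) contDiffAt_const hπ
  · have h := extDeriv_pullback (r := ∞) (f := cotangentRetraction) (x := p')
      (differentiableAt_const stdTwoForm : DifferentiableAt ℝ (fun _ : Ambient => stdTwoForm) _) hπ
      (by rw [minSmoothness_of_isRCLikeNormedField]; exact two_le_infty)
    have h2 : extDeriv retractedStdForm p' = _ := h
    rw [h2]
    have h3 : extDeriv (fun _ : Ambient => stdTwoForm) (cotangentRetraction p') = 0 := by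
      rw [extDeriv, fderiv_fun_const]
      exact map_zero (ContinuousAlternatingMap.alternatizeUncurryFinCLM ℝ Ambient ℝ)
    rw [h3]
    rfl
  · rw [retractedStdForm_apply, fderiv_cotangentRetraction_radial hp']
    simp [stdForm]
  · have h2 : ∀ a : R3, (fderiv ℝ cotangentRetraction (0, p'.2) (0, a)).1 = 0 := by
      intro a
      have h3 : HasFDerivAt cotangentRetraction _ ((0, p'.2) : Ambient) :=
        ((contDiffAt_cotangentRetraction (p := (0, p'.2)) hp').differentiableAt (by simp)).hasFDerivAt
      have h4 : HasFDerivAt (fun v : R3 => ((0, v) : Ambient)) (ContinuousLinearMap.inr ℝ R3 R3)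
        p'.2 := (ContinuousLinearMap.inr ℝ R3 R3).hasFDerivAt
      have h5 : HasFDerivAt (fun v : R3 => (cotangentRetraction (0, v)).1) _ p'.2 :=
        (HasFDerivAt.comp (g := cotangentRetraction) p'.2 h3 h4).fst
      have h6 : (fun v : R3 => (cotangentRetraction (0, v)).1) = fun _ => 0 := by
        funext v; simp [cotangentRetraction]
      rw [h6] at h5
      exact congrArg (fun L : R3 →L[ℝ] R3 => L a) (h5.unique (hasFDerivAt_const _ _))
    rw [retractedStdForm_apply, stdForm, h2, h2]
    simp

variable {M : Type*} [TopologicalSpace M] [T2Space M] [CompactSpace M]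
  [ChartedSpace (EuclideanSpace ℝ (Fin 4)) M] [IsManifold (𝓡 4) ∞ M]
  {η : TwoForm M} {f : Sph → M} {i : Ambient → M} {j : M → Ambient}

theorem derivInto_retract {p : Ambient} (hp : p.2 ≠ 0)
    (hi : ContMDiffAt 𝓘(ℝ, Ambient) (𝓡 4) ∞ i (cotangentRetraction p))
    (hr : ∀ p, p.2 ≠ 0 → i (cotangentRetraction p) = i p) :
    derivInto i p = (derivInto i (cotangentRetraction p)).comp (fderiv ℝ cotangentRetraction p) := by
  have h1 : HasMFDerivAt 𝓘(ℝ, Ambient) (𝓡 4) (i ∘ cotangentRetraction) p _ :=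
    HasMFDerivAt.comp p (hi.mdifferentiableAt (by simp)).hasMFDerivAt
      ((contDiffAt_cotangentRetraction hp).differentiableAt (by simp)).hasFDerivAt.hasMFDerivAt
  have h2 : HasMFDerivAt 𝓘(ℝ, Ambient) (𝓡 4) i p _ := h1.congr_of_eventuallyEq (by
    filter_upwards [continuousAt_snd.preimage_mem_nhds (isOpen_ne.mem_nhds hp)] with q hq
    exact (hr q hq).symm)
  exact h2.mfderiv

theorem tendsto_cotangentRetraction {p : Ambient} (hp : p ∈ zeroSection) :
    Tendsto cotangentRetraction (𝓝 p) (𝓝 p) := by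
  have h := (contDiffAt_cotangentRetraction (snd_ne_zero_of_mem_zeroSection hp)).continuousAt.tendsto
  rwa [cotangentRetraction_of_mem (zeroSection_subset hp)] at h

theorem IsTubularMap.isBasicClosed (hη : IsSymplecticForm η) (hf : ContMDiff (𝓡 2) (𝓡 4) ∞ f)
    (hl : ∀ (q : Sph) (a b : TangentSpace (𝓡 2) q),
      η (f q) ![mfderiv (𝓡 2) (𝓡 4) f q a, mfderiv (𝓡 2) (𝓡 4) f q b] = 0)
    (hi : IsTubularMap η f i j) : IsBasicClosed (pullForm η i) := fun p hp => by
  filter_upwards [hi.smooth p hp, eventually_snd_ne_zero hp,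
    (tendsto_cotangentRetraction hp).eventually (hi.smooth p hp),
    (tendsto_zero_snd hp).eventually (hi.smooth p hp)] with p' h1 h2 h3 h4
  refine ⟨contDiffAt_pullForm hη h1.1, extDeriv_pullForm hη h1.1, fun X c e => ?_, fun a b => ?_⟩
  · have e1 : pullForm η i p' ![X, (c • p'.2, e • p'.2)] = formAt η (i p')
      ![derivInto i p' X, derivInto i p' (c • p'.2, e • p'.2)] := pullForm_apply _ _ _ _ _
    rw [e1, derivInto_retract h2 h3.1 hi.retract, ContinuousLinearMap.comp_apply,
      ContinuousLinearMap.comp_apply, fderiv_cotangentRetraction_radial h2, map_zero]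
    exact ContinuousAlternatingMap.map_coord_zero _ 1 rfl
  · have e1 : pullForm η i (0, p'.2) ![(0, a), (0, b)] = formAt η (i (0, p'.2))
      ![derivInto i (0, p'.2) (0, a), derivInto i (0, p'.2) (0, b)] := pullForm_apply _ _ _ _ _
    rw [e1, derivInto_zero_prod h2 h4.1 hi.zero, derivInto_zero_prod h2 h4.1 hi.zero, hi.zero _ h2]
    exact radialExt_lagrangian hf hl h2 a b

theorem IsTubularMap.pullForm_vertical (hi : IsTubularMap η f i j) {p : Ambient}
    (hp : p ∈ zeroSection) (X : Ambient) (a : R3) :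
    pullForm η i p ![X, (0, a)] = retractedStdForm p ![X, (0, a)] := by
  obtain ⟨u, v⟩ := p
  obtain rfl : u = 0 := hp.1
  have hv : ‖v‖ = 1 := hp.2
  have hvv : (inner ℝ v v : ℝ) = 1 := by rw [real_inner_self_eq_norm_sq, hv]; norm_num
  have h1 := hi.pairing ⟨v, by simpa using hv⟩ X a
  refine h1.trans ?_
  rw [retractedStdForm_apply, (fderiv_cotangentRetraction_zero hv X).2,
    (fderiv_cotangentRetraction_zero hv _).2]
  simp only [stdForm, inner_sub_left, inner_sub_right, inner_smul_left, inner_smul_right, hvv,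
    inner_zero_left, inner_zero_right, conj_trivial, real_inner_comm v X.1]
  ring

end BasicForms

/-! ### Quantities preserved by a flow -/

section FlowInvariance

set_option linter.unusedSectionVars false

open Filter Topology unitInterval

variable {E : Type} [NormedAddCommGroup E] [NormedSpace ℝ E]

/-- The Lie derivative of a closed two-form along a vector field in its kernel vanishes. -/
theorem lieDeriv_eq_zero {S : E → E [⋀^Fin 2]→L[ℝ] ℝ} {W : E → E} {y : E}
    (hS : DifferentiableAt ℝ S y) (hc : extDeriv S y = 0) (hW : DifferentiableAt ℝ W y)
    (hk : ∀ᶠ x in 𝓝 y, ∀ Y, S x ![W x, Y] = 0) (a b : E) :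
    fderiv ℝ (fun x => toBilin (S x)) y (W y) a b + toBilin (S y) (fderiv ℝ W y a) b +
      toBilin (S y) a (fderiv ℝ W y b) = 0 := by
  have hT : DifferentiableAt ℝ (fun x => toBilin (S x)) y :=
    (contDiff_toBilin.contDiffAt.differentiableAt (by simp)).comp y hS
  have hz : ∀ c d : E, fderiv ℝ (fun x => toBilin (S x)) y c (W y) d +
      toBilin (S y) (fderiv ℝ W y c) d = 0 := by
    intro c d
    have h1 := (hT.hasFDerivAt.clm_apply hW.hasFDerivAt).clm_apply (hasFDerivAt_const d y)
    have h2 : HasFDerivAt (fun x => toBilin (S x) (W x) d) (0 : E →L[ℝ] ℝ) y :=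
      (hasFDerivAt_const (0 : ℝ) y).congr_of_eventuallyEq (by
        filter_upwards [hk] with x hx
        rw [toBilin_apply, hx])
    have h3 := congrArg (fun L : E →L[ℝ] ℝ => L c) (h1.unique h2)
    simp at h3
    linarith
  have h4 := fderiv_toBilin_of_closed hS hc (W y) a b
  have h5 : toBilin (S y) a (fderiv ℝ W y b) = - toBilin (S y) (fderiv ℝ W y b) a := by
    rw [toBilin_apply, toBilin_apply, form_swap]
  have h6 := hz a b
  have h7 := hz b a
  linarith

section

variable [CompleteSpace E] {W : E → E} (hW : ContDiff ℝ ∞ W) {γ : C(I, E)} {x : E}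
  (hγ : ∀ t, γ t = x + primitive (superpose W hW.continuous γ) t)
include hγ

/-- A function which grows at a constant rate along the vector field. -/
theorem eq_add_of_fderiv_along {h : E → ℝ} {c : ℝ}
    (hh : ∀ t, DifferentiableAt ℝ h (γ t) ∧ fderiv ℝ h (γ t) (W (γ t)) = c) : h (γ 1) = h (γ 0) + c := by
  have hv : ∀ t ∈ Set.Icc (0 : ℝ) 1, DifferentiableAt ℝ h (extendPath γ t) ∧
      fderiv ℝ h (extendPath γ t) (W (extendPath γ t)) = c := fun t _ => hh _
  have key := eq_of_hasDerivWithinAt_zero (f := fun t => h (extendPath γ t) - t * c)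
    (by
      intro t ht
      have h1 : ContinuousAt (fun t => h (extendPath γ t)) t :=
        ContinuousAt.comp (g := h) (hv t ht).1.continuousAt (continuous_extendPath γ).continuousAt
      exact (h1.sub (by fun_prop)).continuousWithinAt)
    (by
      intro t ht
      have ht' : t ∈ Set.Icc (0 : ℝ) 1 := ⟨ht.1, ht.2.le⟩
      have h1 := hasDerivWithinAt_extendPath hγ ht
      have h2 : HasDerivWithinAt (fun t => h (extendPath γ t)) _ (Set.Ici t) t :=
        (hv t ht').1.hasFDerivAt.comp_hasDerivWithinAt t h1
      have h3 := h2.sub (((hasDerivAt_id t).mul_const c).hasDerivWithinAt (s := Set.Ici t))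
      refine h3.congr_deriv ?_
      have h4 : extendPath (superpose W hW.continuous γ) t = W (extendPath γ t) := rfl
      rw [h4, (hv t ht').2]
      simp) 1 ⟨zero_le_one, le_rfl⟩
  have e1 : extendPath γ 1 = γ 1 := extendPath_coe γ 1
  have e0 : extendPath γ 0 = γ 0 := extendPath_coe γ 0
  simp only [e1, e0] at key
  linarith

theorem form_eq_along {S : E → E [⋀^Fin 2]→L[ℝ] ℝ} {ξ ζ : C(I, E)} {X Y : E}
    (hξ : ∀ t, ξ t = X + primitive (pointwiseApply (superpose (fderiv ℝ W)
        (hW.continuous_fderiv (by simp)) γ) ξ) t)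
    (hζ : ∀ t, ζ t = Y + primitive (pointwiseApply (superpose (fderiv ℝ W)
        (hW.continuous_fderiv (by simp)) γ) ζ) t)
    (hS : ∀ t, DifferentiableAt ℝ S (γ t) ∧ extDeriv S (γ t) = 0 ∧
      ∀ᶠ y in 𝓝 (γ t), ∀ Z, S y ![W y, Z] = 0) :
    S (γ 1) ![ξ 1, ζ 1] = S (γ 0) ![ξ 0, ζ 0] := by
  set T : E → E →L[ℝ] E →L[ℝ] ℝ := fun x => toBilin (S x) with hT
  have hTd : ∀ t, DifferentiableAt ℝ T (extendPath γ t) := fun t =>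
    (contDiff_toBilin.contDiffAt.differentiableAt (by simp)).comp _ (hS _).1
  have key := eq_of_hasDerivWithinAt_zero
    (f := fun t => T (extendPath γ t) (extendPath ξ t) (extendPath ζ t))
    (by
      intro t ht
      have h1 : ContinuousAt (fun t => T (extendPath γ t)) t :=
        ContinuousAt.comp (g := T) (hTd t).continuousAt (continuous_extendPath γ).continuousAt
      exact ((h1.clm_apply (continuous_extendPath ξ).continuousAt).clm_apply
        (continuous_extendPath ζ).continuousAt).continuousWithinAt)
    (by
      intro t ht
      have h1 : HasDerivWithinAt (fun t => T (extendPath γ t)) _ (Set.Ici t) t :=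
        HasFDerivAt.comp_hasDerivWithinAt (l := T) (f := extendPath γ) t (hTd t).hasFDerivAt
          (hasDerivWithinAt_extendPath hγ ht)
      have h3 := (h1.clm_apply (hasDerivWithinAt_extendPath hξ ht)).clm_apply
        (hasDerivWithinAt_extendPath hζ ht)
      refine h3.congr_deriv ?_
      have h4 := lieDeriv_eq_zero (hS (Set.projIcc 0 1 zero_le_one t)).1
        (hS (Set.projIcc 0 1 zero_le_one t)).2.1 (hW.differentiable (by simp) _)
        (hS (Set.projIcc 0 1 zero_le_one t)).2.2 (extendPath ξ t) (extendPath ζ t)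
      exact h4) 1 ⟨zero_le_one, le_rfl⟩
  have e : ∀ (δ : C(I, E)), extendPath δ 1 = δ 1 ∧ extendPath δ 0 = δ 0 :=
    fun δ => ⟨extendPath_coe δ 1, extendPath_coe δ 0⟩
  simp only [(e _).1, (e _).2, hT, toBilin_apply] at key
  exact key

end

/-- `G` moves the points `z` of `Z` by the vector `w`, and near `Z` it behaves like the time-one map
of the flow of `W`: functions that grow at the constant rate `c` along `W` grow by `c`, and closed
two-forms with `W` in the kernel are preserved, provided that these conditions hold near the
segments from `z` to `z + w`. -/
structure IsFlowMap (W G : E → E) (w : E) (Z : Set E) : Prop where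
  smooth : ContDiff ℝ ∞ G
  apply : ∀ z ∈ Z, G z = z + w
  function : ∀ z ∈ Z, ∀ (h : E → ℝ) (c : ℝ), (∀ s ∈ Set.Icc (0 : ℝ) 1, ∀ᶠ y in 𝓝 (z + s • w),
    DifferentiableAt ℝ h y ∧ fderiv ℝ h y (W y) = c) → ∀ᶠ x in 𝓝 z, h (G x) = h x + c
  form : ∀ z ∈ Z, ∀ S : E → E [⋀^Fin 2]→L[ℝ] ℝ, (∀ s ∈ Set.Icc (0 : ℝ) 1, ∀ᶠ y in 𝓝 (z + s • w),
    DifferentiableAt ℝ S y ∧ extDeriv S y = 0 ∧ ∀ Y, S y ![W y, Y] = 0) →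
    ∀ᶠ x in 𝓝 z, ∀ X Y, S (G x) ![fderiv ℝ G x X, fderiv ℝ G x Y] = S x ![X, Y]

theorem exists_flowMap_of_lipschitz [CompleteSpace E] {W : E → E} (hW : ContDiff ℝ ∞ W)
    {k : NNReal} (hk : LipschitzWith k W) (hk1 : k < 1) {w : E} {Z : Set E}
    (hZ : ∀ z ∈ Z, ∀ s ∈ Set.Icc (0 : ℝ) 1, W (z + s • w) = w) : ∃ G, IsFlowMap W G w Z := by
  obtain ⟨Γ, hΓ, hode, huniq, -, hvar⟩ := exists_smooth_flow hW hk hk1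
  have hstraight : ∀ z ∈ Z, ∀ t : I, Γ z t = z + (t : ℝ) • w := by
    intro z hz
    have h1 := huniq z ⟨fun t => z + (t : ℝ) • w, by fun_prop⟩ (fun t => by
      rw [primitive_apply]
      have h2 : ∫ s in (0 : ℝ)..t, extendPath (superpose W hW.continuous
          (⟨fun t => z + (t : ℝ) • w, by fun_prop⟩ : C(I, E))) s = ∫ s in (0 : ℝ)..t, w := by
        refine intervalIntegral.integral_congr fun s _ => ?_
        exact hZ z hz _ (Set.projIcc 0 1 zero_le_one s).2
      rw [h2]
      simp)
    intro t
    rw [← h1]; rfl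
  have h0 : ∀ x, Γ x 0 = x := fun x => by
    rw [hode, primitive_apply]; simp
  have hnear : ∀ z ∈ Z, ∀ P : E → Prop, (∀ s ∈ Set.Icc (0 : ℝ) 1, ∀ᶠ y in 𝓝 (z + s • w), P y) →
      ∀ᶠ x in 𝓝 z, ∀ t, ∀ᶠ y in 𝓝 (Γ x t), P y := by
    intro z hz P hP
    have hO : IsOpen {y | ∀ᶠ y' in 𝓝 y, P y'} := isOpen_setOfPred_eventually_nhds
    have h1 := ContinuousMap.isOpen_setOfPred_mapsTo (X := I) (Y := E) isCompact_univ hO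
    have h2 : {γ : C(I, E) | Set.MapsTo γ Set.univ {y | ∀ᶠ y' in 𝓝 y, P y'}} ∈ 𝓝 (Γ z) :=
      h1.mem_nhds fun t _ => by
        change ∀ᶠ y' in 𝓝 (Γ z t), P y'
        rw [hstraight z hz]
        exact hP _ t.2
    filter_upwards [hΓ.continuous.continuousAt.preimage_mem_nhds h2] with x hx t
    exact hx (Set.mem_univ t)
  have hev : ∀ (x X : E) (t : I), fderiv ℝ (fun x => Γ x t) x X = fderiv ℝ Γ x X t := by
    intro x X t
    have h1 : HasFDerivAt (fun x => Γ x t) _ x :=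
      (ContinuousMap.evalCLM ℝ t : C(I, E) →L[ℝ] E).hasFDerivAt.comp x
        (hΓ.differentiable (by simp) x).hasFDerivAt
    rw [h1.fderiv]; rfl
  refine ⟨fun x => Γ x 1, (ContinuousMap.evalCLM ℝ (1 : I) : C(I, E) →L[ℝ] E).contDiff.comp hΓ,
    fun z hz => by rw [hstraight z hz]; simp, fun z hz h c hh => ?_, fun z hz S hS => ?_⟩
  · filter_upwards [hnear z hz _ hh] with x hx
    have := eq_add_of_fderiv_along hW (hode x) (fun t => (hx t).self_of_nhds)
    rwa [h0] at this
  · filter_upwards [hnear z hz _ hS] with x hx X Y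
    have := form_eq_along hW (hode x) (hvar x X) (hvar x Y) (fun t =>
      ⟨(hx t).self_of_nhds.1, (hx t).self_of_nhds.2.1, (hx t).mono fun _ h => h.2.2⟩)
    have e0 : ∀ X, fderiv ℝ Γ x X 0 = X := fun X => by
      rw [← hev]
      simp only [h0]
      simp
    rw [e0, e0, h0] at this
    rw [hev, hev]
    exact this

/-- A vector field with an arbitrary Lipschitz constant is divided by a large integer, and the
resulting flow map is iterated. -/
theorem exists_flowMap [CompleteSpace E] {W : E → E} (hW : ContDiff ℝ ∞ W)
    {k : NNReal} (hk : LipschitzWith k W) {w : E} {Z : Set E}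
    (hZ : ∀ z ∈ Z, ∀ s ∈ Set.Icc (0 : ℝ) 1, W (z + s • w) = w) : ∃ G, IsFlowMap W G w Z := by
  obtain ⟨N, hN⟩ := exists_nat_gt (k : ℝ)
  have hN0 : (0 : ℝ) < N := lt_of_le_of_lt k.2 hN
  set W' : E → E := fun x => (N : ℝ)⁻¹ • W x with hW'
  have hlip : LipschitzWith (‖(N : ℝ)⁻¹‖₊ * k) W' :=
    (lipschitzWith_smul ((N : ℝ)⁻¹)).comp hk
  have hlt : ‖(N : ℝ)⁻¹‖₊ * k < 1 := by
    rw [← NNReal.coe_lt_coe]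
    push_cast
    rw [norm_inv, Real.norm_of_nonneg hN0.le, inv_mul_lt_one₀ hN0]
    exact hN
  set Z' : Set E := {y | ∀ s ∈ Set.Icc (0 : ℝ) 1, W' (y + s • (N : ℝ)⁻¹ • w) = (N : ℝ)⁻¹ • w}
  obtain ⟨G, hG⟩ := exists_flowMap_of_lipschitz (W := W') (contDiff_const.smul hW) hlip hlt
    (w := (N : ℝ)⁻¹ • w) (Z := Z') (fun z hz => hz)
  have hfrac : ∀ m : ℕ, m < N → ∀ s ∈ Set.Icc (0 : ℝ) 1, (m + s) * (N : ℝ)⁻¹ ∈ Set.Icc (0 : ℝ) 1 := by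
    intro m hm s hs
    have hm' : (m : ℝ) + 1 ≤ N := by exact_mod_cast hm
    refine ⟨mul_nonneg (by linarith [hs.1, (Nat.cast_nonneg m : (0 : ℝ) ≤ m)]) (by positivity), ?_⟩
    rw [← div_eq_mul_inv, div_le_one hN0]
    linarith [hs.2]
  have hpt : ∀ (m : ℕ) (s : ℝ) (z : E), z + ((m : ℝ) * (N : ℝ)⁻¹) • w + s • (N : ℝ)⁻¹ • w =
      z + ((m + s) * (N : ℝ)⁻¹) • w := fun m s z => by
    rw [add_assoc, smul_smul, ← add_smul, ← add_mul]
  have hmem : ∀ z ∈ Z, ∀ m : ℕ, m < N → z + ((m : ℝ) * (N : ℝ)⁻¹) • w ∈ Z' := by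
    intro z hz m hm s hs
    simp only [hW']
    rw [hpt, hZ z hz _ (hfrac m hm s hs)]
  have key : ∀ m : ℕ, m ≤ N → ContDiff ℝ ∞ (G^[m]) ∧
      (∀ z ∈ Z, G^[m] z = z + ((m : ℝ) * (N : ℝ)⁻¹) • w) ∧
      (∀ z ∈ Z, ∀ (h : E → ℝ) (c : ℝ), (∀ s ∈ Set.Icc (0 : ℝ) 1, ∀ᶠ y in 𝓝 (z + s • w),
        DifferentiableAt ℝ h y ∧ fderiv ℝ h y (W y) = c) →
          ∀ᶠ x in 𝓝 z, h (G^[m] x) = h x + (m * (N : ℝ)⁻¹) * c) ∧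
      (∀ z ∈ Z, ∀ S : E → E [⋀^Fin 2]→L[ℝ] ℝ, (∀ s ∈ Set.Icc (0 : ℝ) 1, ∀ᶠ y in 𝓝 (z + s • w),
        DifferentiableAt ℝ S y ∧ extDeriv S y = 0 ∧ ∀ Y, S y ![W y, Y] = 0) →
        ∀ᶠ x in 𝓝 z, ∀ X Y, S (G^[m] x) ![fderiv ℝ (G^[m]) x X, fderiv ℝ (G^[m]) x Y] =
          S x ![X, Y]) := by
    intro m
    induction m with
    | zero => intro _; exact ⟨contDiff_id, by simp, by simp, by simp⟩
    | succ m ih =>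
      intro hm
      obtain ⟨h1, h2, h3, h4⟩ := ih (Nat.le_of_succ_le hm)
      have hcont : ∀ z ∈ Z, Tendsto (G^[m]) (𝓝 z) (𝓝 (z + ((m : ℝ) * (N : ℝ)⁻¹) • w)) := by
        intro z hz
        rw [← h2 z hz]
        exact h1.continuous.tendsto z
      rw [Function.iterate_succ']
      refine ⟨hG.smooth.comp h1, fun z hz => ?_, fun z hz h c hh => ?_, fun z hz S hS => ?_⟩
      · rw [Function.comp_apply, h2 z hz, hG.apply _ (hmem z hz m hm), add_assoc, ← add_smul]
        push_cast
        rw [add_mul, one_mul]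
      · have e1 := hG.function _ (hmem z hz m hm) h ((N : ℝ)⁻¹ * c) (fun s hs => by
          rw [hpt]
          filter_upwards [hh _ (hfrac m hm s hs)] with y hy
          refine ⟨hy.1, ?_⟩
          simp only [hW']
          rw [map_smul, hy.2, smul_eq_mul])
        filter_upwards [h3 z hz h c hh, (hcont z hz).eventually e1] with x hx1 hx2
        rw [Function.comp_apply, hx2, hx1]
        push_cast
        ring
      · have e1 := hG.form _ (hmem z hz m hm) S (fun s hs => by
          rw [hpt]
          filter_upwards [hS _ (hfrac m hm s hs)] with y hy
          refine ⟨hy.1, hy.2.1, fun Y => ?_⟩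
          simp only [hW']
          rw [← toBilin_apply, map_smul, smul_apply, toBilin_apply, hy.2.2, smul_zero])
        filter_upwards [h4 z hz S hS, (hcont z hz).eventually e1] with x hx1 hx2 X Y
        have hd : fderiv ℝ (G ∘ G^[m]) x = (fderiv ℝ G (G^[m] x)).comp (fderiv ℝ (G^[m]) x) :=
          fderiv_comp x (hG.smooth.differentiable (by simp) _) (h1.differentiable (by simp) _)
        rw [hd]
        exact (hx2 _ _).trans (hx1 X Y)
  obtain ⟨h1, h2, h3, h4⟩ := key N le_rfl
  have hNN : (N : ℝ) * (N : ℝ)⁻¹ = 1 := mul_inv_cancel₀ hN0.ne'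
  rw [hNN] at h2 h3
  simp only [one_smul, one_mul] at h2 h3
  exact ⟨G^[N], h1, h2, h3, h4⟩

end FlowInvariance

/-! ### The Moser isotopy along the zero-section -/

section Moser

set_option linter.unusedSectionVars false

open Filter Topology

theorem finrank_continuousDual {E : Type*} [NormedAddCommGroup E] [NormedSpace ℝ E]
    [FiniteDimensional ℝ E] : Module.finrank ℝ E = Module.finrank ℝ (E →L[ℝ] ℝ) := by
  rw [← (LinearMap.toContinuousLinearMap : (E →ₗ[ℝ] ℝ) ≃ₗ[ℝ] (E →L[ℝ] ℝ)).finrank_eq]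
  exact (Subspace.dual_finrank_eq (K := ℝ) (V := E)).symm

/-- The solution `V` of `B V = -α` is smooth where `B` is invertible. -/
theorem contDiffAt_solve {P E F : Type} [NormedAddCommGroup P] [NormedSpace ℝ P]
    [NormedAddCommGroup E] [NormedSpace ℝ E] [FiniteDimensional ℝ E]
    [NormedAddCommGroup F] [NormedSpace ℝ F] [FiniteDimensional ℝ F]
    (hdim : Module.finrank ℝ E = Module.finrank ℝ F) {B : P → E →L[ℝ] F} {α : P → F} {x : P}
    (hB : ∀ᶠ y in 𝓝 x, ContDiffAt ℝ ∞ B y) (hα : ContDiff ℝ ∞ α)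
    (hinj : ∀ X, B x X = 0 → X = 0) :
    ∀ᶠ y in 𝓝 x, ContDiffAt ℝ ∞ (fun y => -(B y).inverse (α y)) y ∧
      B y (-(B y).inverse (α y)) = -α y := by
  have := FiniteDimensional.complete ℝ E
  let e : E ≃L[ℝ] F := (LinearMap.linearEquivOfInjective (B x).toLinearMap
    ((injective_iff_map_eq_zero _).2 hinj) hdim).toContinuousLinearEquiv
  have he : (e : E →L[ℝ] F) = B x := by ext X; rfl
  have h1 : ∀ᶠ y in 𝓝 x, B y ∈ Set.range ((↑) : (E ≃L[ℝ] F) → E →L[ℝ] F) :=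
    hB.self_of_nhds.continuousAt.preimage_mem_nhds (by rw [← he]; exact e.nhds)
  filter_upwards [hB, h1] with y hy ⟨e', he'⟩
  constructor
  · have h2 : ContDiffAt ℝ ∞ (fun y => (B y).inverse) y :=
      ContDiffAt.comp (g := ContinuousLinearMap.inverse) y
        (by rw [← he']; exact contDiffAt_map_inverse e') hy
    exact (h2.clm_apply hα.contDiffAt).neg
  · rw [← he', ContinuousLinearMap.inverse_equiv, map_neg]
    simp

/-- The form `σ + d(t α)` on the product of the time axis and `ℝ³ × ℝ³`. -/
def spaceTimeForm (σ : Ambient → Ambient [⋀^Fin 2]→L[ℝ] ℝ) (α : Ambient → Ambient →L[ℝ] ℝ)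
    (x : ℝ × Ambient) : (ℝ × Ambient) [⋀^Fin 2]→L[ℝ] ℝ :=
  (σ x.2).compContinuousLinearMap (ContinuousLinearMap.snd ℝ ℝ Ambient) +
    extDerivOne (fun x : ℝ × Ambient => x.1 • (α x.2).comp (ContinuousLinearMap.snd ℝ ℝ Ambient)) x

section

variable {σ : Ambient → Ambient [⋀^Fin 2]→L[ℝ] ℝ} {α : Ambient → Ambient →L[ℝ] ℝ}
  (hα : ContDiff ℝ ∞ α)
include hα

theorem contDiff_smul_comp_snd : ContDiff ℝ ∞
    (fun x : ℝ × Ambient => x.1 • (α x.2).comp (ContinuousLinearMap.snd ℝ ℝ Ambient)) :=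
  contDiff_fst.smul ((hα.comp contDiff_snd).clm_comp contDiff_const)

theorem spaceTimeForm_apply (x X Y : ℝ × Ambient) : spaceTimeForm σ α x ![X, Y] =
    σ x.2 ![X.2, Y.2] + (X.1 * α x.2 Y.2 - Y.1 * α x.2 X.2 +
      x.1 * extDerivOne α x.2 ![X.2, Y.2]) := by
  have hd : ∀ Y X : ℝ × Ambient, fderiv ℝ (fun x : ℝ × Ambient =>
      (x.1 • (α x.2).comp (ContinuousLinearMap.snd ℝ ℝ Ambient)) Y) x X =
      X.1 * α x.2 Y.2 + x.1 * fderiv ℝ (fun p => α p Y.2) x.2 X.2 := by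
    intro Y X
    have h1 : HasFDerivAt (fun p => α p Y.2) _ x.2 :=
      ((hα.clm_apply contDiff_const).differentiable (by simp) x.2).hasFDerivAt
    have h2 : HasFDerivAt (fun x : ℝ × Ambient => α x.2 Y.2) _ x :=
      HasFDerivAt.comp (g := fun p => α p Y.2) (f := Prod.snd) x h1 hasFDerivAt_snd
    have h3 : HasFDerivAt (fun x : ℝ × Ambient => x.1 * α x.2 Y.2) _ x := hasFDerivAt_fst.mul h2
    have h4 : (fun x : ℝ × Ambient =>
      (x.1 • (α x.2).comp (ContinuousLinearMap.snd ℝ ℝ Ambient)) Y) = fun x => x.1 * α x.2 Y.2 := rfl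
    rw [h4, h3.fderiv]
    simp [add_comm, mul_comm]
  rw [spaceTimeForm, ContinuousAlternatingMap.add_apply, compContinuousLinearMap_apply_pair,
    extDerivOne_apply ((contDiff_smul_comp_snd hα).differentiable (by simp) x), hd, hd,
    extDerivOne_apply (hα.differentiable (by simp) _)]
  simp only [ContinuousLinearMap.coe_snd']
  ring

theorem differentiableAt_spaceTimeForm {x : ℝ × Ambient} (hσ : DifferentiableAt ℝ σ x.2)
    (hc : extDeriv σ x.2 = 0) :
    DifferentiableAt ℝ (spaceTimeForm σ α) x ∧ extDeriv (spaceTimeForm σ α) x = 0 := by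
  have hsnd : ContDiff ℝ ∞ (Prod.snd : ℝ × Ambient → Ambient) := contDiff_snd
  have hfd : ∀ x, fderiv ℝ (Prod.snd : ℝ × Ambient → Ambient) x =
    ContinuousLinearMap.snd ℝ ℝ Ambient := fun x => fderiv_snd
  have h1 : DifferentiableAt ℝ (fun x : ℝ × Ambient =>
      (σ x.2).compContinuousLinearMap (ContinuousLinearMap.snd ℝ ℝ Ambient)) x :=
    (ContinuousAlternatingMap.compContinuousLinearMapCLM (F := ℝ) (ι := Fin 2)
      (ContinuousLinearMap.snd ℝ ℝ Ambient)).differentiableAt.comp x (hσ.comp x differentiableAt_snd)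
  have h2 := contDiff_extDerivOne (contDiff_smul_comp_snd hα)
  have h3 := extDeriv_pullback (r := ∞) (f := (Prod.snd : ℝ × Ambient → Ambient)) (x := x) hσ
    hsnd.contDiffAt (by rw [minSmoothness_of_isRCLikeNormedField]; exact two_le_infty)
  simp only [hfd] at h3
  refine ⟨h1.add (h2.differentiable (by simp) x), ?_⟩
  have h4 := extDeriv_fun_add h1 (h2.differentiable (by simp) x)
  have h5 : extDeriv (spaceTimeForm σ α) x = _ := h4
  rw [h5, h3, hc, extDeriv_extDerivOne (contDiff_smul_comp_snd hα).contDiffAt, add_zero]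
  rfl

end

/-- A basic closed form which completes the canonical form on vertical vectors along the zero-section
is carried to the canonical form by a diffeomorphism near the zero-section, which fixes the
zero-section and preserves the cotangent bundle. -/
theorem exists_moser_map {σ₁ : Ambient → Ambient [⋀^Fin 2]→L[ℝ] ℝ} (hσ₁ : IsBasicClosed σ₁)
    (hvert : ∀ p ∈ zeroSection, ∀ (X : Ambient) (a : R3),
      σ₁ p ![X, (0, a)] = retractedStdForm p ![X, (0, a)]) :
    ∃ ψ : Ambient → Ambient, ContDiff ℝ ∞ ψ ∧ (∀ z ∈ zeroSection, ψ z = z) ∧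
      ∀ z ∈ zeroSection, ∀ᶠ p in 𝓝 z,
        (inner ℝ (ψ p).1 (ψ p).2 : ℝ) = inner ℝ p.1 p.2 ∧ ‖(ψ p).2‖ = ‖p.2‖ ∧
        ∀ X Y, σ₁ (ψ p) ![fderiv ℝ ψ p X, fderiv ℝ ψ p Y] = retractedStdForm p ![X, Y] := by
  have hσ₀ := isBasicClosed_retractedStdForm
  have hdiff := hσ₁.sub hσ₀
  obtain ⟨τ, hτ, -, hτeq⟩ := exists_contDiff_extension isCompact_zeroSection
    (fun p hp => (hdiff p hp).mono fun _ h => h.1)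
  have hτb : IsBasicClosed τ := hdiff.congr hτeq
  obtain ⟨α, hαdef⟩ : ∃ α, α = fibrePrimitive τ := ⟨_, rfl⟩
  have hα : ContDiff ℝ ∞ α := by rw [hαdef]; exact contDiff_fibrePrimitive hτ
  have hα0 : ∀ p ∈ zeroSection, α p = 0 := fun p hp => by
    rw [hαdef]; exact fibrePrimitive_zero hτ hp.1
  have hαrad : ∀ p ∈ zeroSection, ∀ᶠ p' in 𝓝 p, ∀ c e : ℝ, α p' (c • p'.2, e • p'.2) = 0 :=
    fun p hp => by rw [hαdef]; exact fibrePrimitive_radial hτ hτb hp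
  have hdα : ∀ p ∈ zeroSection, ∀ᶠ p' in 𝓝 p, extDerivOne α p' = τ p' :=
    fun p hp => by rw [hαdef]; exact extDerivOne_fibrePrimitive hτ hτb hp
  clear hαdef
  -- the path of symplectic forms on `ℝ³ × ℝ³`
  set B : ℝ × Ambient → Ambient →L[ℝ] Ambient →L[ℝ] ℝ := fun x =>
    toBilin (retractedStdForm x.2 + x.1 • τ x.2 + normalForm x.2) with hB
  have hBapp : ∀ x X Y, B x X Y = retractedStdForm x.2 ![X, Y] + x.1 * τ x.2 ![X, Y] +
      normalForm x.2 ![X, Y] := fun x X Y => by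
    simp only [hB]
    rw [toBilin_apply]
    rfl
  have hBs : ∀ (s : ℝ), ∀ z ∈ zeroSection, ∀ᶠ x in 𝓝 ((s, z) : ℝ × Ambient), ContDiffAt ℝ ∞ B x := by
    intro s z hz
    have h1 : ∀ᶠ x in 𝓝 ((s, z) : ℝ × Ambient), ContDiffAt ℝ ∞ retractedStdForm x.2 :=
      (continuousAt_snd (p := ((s, z) : ℝ × Ambient))).eventually
        ((hσ₀ z hz).mono fun _ h => h.1)
    filter_upwards [h1] with x hx
    have h2 : ContDiffAt ℝ ∞ (fun x : ℝ × Ambient => retractedStdForm x.2) x :=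
      ContDiffAt.comp (g := retractedStdForm) x hx contDiffAt_snd
    have h3 : ContDiffAt ℝ ∞ (fun x : ℝ × Ambient => x.1 • τ x.2) x :=
      contDiffAt_fst.smul (hτ.contDiffAt.comp x contDiffAt_snd)
    have h4 : ContDiffAt ℝ ∞ (fun x : ℝ × Ambient => normalForm x.2) x :=
      contDiff_normalForm.contDiffAt.comp x contDiffAt_snd
    exact contDiff_toBilin.contDiffAt.comp x ((h2.add h3).add h4)
  have hBinj : ∀ (s : ℝ), ∀ z ∈ zeroSection, ∀ X, B (s, z) X = 0 → X = 0 := by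
    intro s z hz X hX
    have hτv : ∀ (X : Ambient) (a : R3), τ z ![X, (0, a)] = 0 := fun X a => by
      rw [(hτeq z hz).self_of_nhds, ContinuousAlternatingMap.sub_apply, hvert z hz, sub_self]
    have h1 : ∀ Y, stdForm X Y + s * τ z ![X, Y] = 0 := fun Y => by
      have h2 : B (s, z) X Y = 0 := by rw [hX]; rfl
      rw [hBapp] at h2
      have h3 := retractedStdForm_add_normalForm hz X Y
      simp only at h2
      linarith
    have hX1 : X.1 = 0 := by
      have h2 := h1 (0, X.1)
      rw [hτv] at h2
      simpa [stdForm] using h2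
    have hXe : X = (0, X.2) := Prod.ext hX1 rfl
    have hX2 : X.2 = 0 := by
      have h2 := h1 (X.2, 0)
      rw [form_swap, hXe, hτv] at h2
      simpa [stdForm] using h2
    exact Prod.ext hX1 hX2
  have hsolve : ∀ (s : ℝ), ∀ z ∈ zeroSection, ∀ᶠ x in 𝓝 ((s, z) : ℝ × Ambient),
      ContDiffAt ℝ ∞ (fun x => -(B x).inverse (α x.2)) x ∧
        B x (-(B x).inverse (α x.2)) = -α x.2 := fun s z hz =>
    contDiffAt_solve (α := fun x : ℝ × Ambient => α x.2) finrank_continuousDual (hBs s z hz)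
      (hα.comp contDiff_snd) (hBinj s z hz)
  obtain ⟨V, hV, hVc, hVeq⟩ := exists_contDiff_extension
    ((isCompact_Icc (a := (0 : ℝ)) (b := 1)).prod isCompact_zeroSection)
    (g := fun x : ℝ × Ambient => -(B x).inverse (α x.2))
    (fun x hx => (hsolve x.1 x.2 hx.2).mono fun _ h => h.1)
  have hnear : ∀ s ∈ Set.Icc (0 : ℝ) 1, ∀ z ∈ zeroSection, ∀ᶠ x in 𝓝 ((s, z) : ℝ × Ambient),
      B x (V x) = -α x.2 := by
    intro s hs z hz
    filter_upwards [hsolve s z hz, hVeq (s, z) ⟨hs, hz⟩] with x h1 h2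
    rw [h2, h1.2]
  have hV0 : ∀ s ∈ Set.Icc (0 : ℝ) 1, ∀ z ∈ zeroSection, V (s, z) = 0 := by
    intro s hs z hz
    rw [(hVeq (s, z) ⟨hs, hz⟩).self_of_nhds, hα0 z hz, map_zero, neg_zero]
  -- the radial components of the field vanish
  have hVn : ∀ s ∈ Set.Icc (0 : ℝ) 1, ∀ z ∈ zeroSection, ∀ᶠ x in 𝓝 ((s, z) : ℝ × Ambient),
      derivPairing x.2 (V x) = 0 ∧ derivHalfSq x.2 (V x) = 0 ∧
      ∀ Y, retractedStdForm x.2 ![V x, Y] + x.1 * τ x.2 ![V x, Y] = - α x.2 Y := by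
    intro s hs z hz
    have hsnd := (continuousAt_snd (p := ((s, z) : ℝ × Ambient))).tendsto
    filter_upwards [hnear s hs z hz, hsnd.eventually (hσ₀ z hz), hsnd.eventually (hτb z hz),
      hsnd.eventually (hαrad z hz), hsnd.eventually (eventually_snd_ne_zero hz)] with x h1 h2 h3 h4 h5
    have hn : 0 < ‖x.2.2‖ ^ 2 := by have := norm_pos_iff.2 h5; positivity
    have hrad : ∀ c e : ℝ, normalForm x.2 ![V x, (c • x.2.2, e • x.2.2)] = 0 := by
      intro c e
      have h6 := congrArg (fun L : Ambient →L[ℝ] ℝ => L (c • x.2.2, e • x.2.2)) h1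
      simp only [hBapp, h2.2.2.1, h3.2.2.1, neg_apply, h4] at h6
      linarith
    have e1 := hrad 1 0
    have e2 := hrad 0 1
    simp only [normalForm_apply, derivPairing_apply, derivHalfSq_apply, one_smul, zero_smul,
      inner_zero_right, real_inner_self_eq_norm_sq, mul_zero, add_zero, zero_add, zero_sub,
      neg_eq_zero, mul_eq_zero, hn.ne', false_or] at e1 e2
    rw [e1, mul_zero, sub_zero, mul_eq_zero] at e2
    have hA : derivPairing x.2 (V x) = 0 := e2.resolve_right hn.ne'
    have hH : derivHalfSq x.2 (V x) = 0 := e1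
    refine ⟨hA, hH, fun Y => ?_⟩
    have h6 := congrArg (fun L : Ambient →L[ℝ] ℝ => L Y) h1
    simp only [hBapp, normalForm_apply, hA, hH, neg_apply] at h6
    linarith
  -- the field on space-time and its flow
  set W : ℝ × Ambient → ℝ × Ambient := fun x => (1, V x) with hW
  have hWs : ContDiff ℝ ∞ W := contDiff_const.prodMk hV
  obtain ⟨C, hC⟩ := hV.lipschitzWith_of_hasCompactSupport hVc (by simp)
  have hWlip : LipschitzWith (max 0 C) W := (LipschitzWith.const (1 : ℝ)).prodMk hC
  obtain ⟨G, hG⟩ := exists_flowMap hWs hWlip (w := ((1, 0) : ℝ × Ambient))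
    (Z := {0} ×ˢ zeroSection) (by
      rintro ⟨t, z⟩ ⟨ht, hz⟩ s hs
      obtain rfl : t = 0 := ht
      simp only [hW, Prod.smul_mk, Prod.mk_add_mk, smul_zero, add_zero, zero_add, smul_eq_mul,
        mul_one]
      rw [hV0 s hs z hz])
  have hseg : ∀ (z : Ambient) (s : ℝ), ((0, z) : ℝ × Ambient) + s • (1, 0) = (s, z) := fun z s => by
    simp
  have hin : ∀ z : Ambient, Tendsto (fun p : Ambient => ((0, p) : ℝ × Ambient)) (𝓝 z) (𝓝 (0, z)) :=
    fun z => (by fun_prop : Continuous (fun p : Ambient => ((0, p) : ℝ × Ambient))).tendsto z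
  have hGz : ∀ z ∈ zeroSection, G (0, z) = (1, z) := fun z hz => by
    rw [hG.apply (0, z) ⟨rfl, hz⟩]; simp
  have hψs : ContDiff ℝ ∞ (fun p => (G (0, p)).2) :=
    contDiff_snd.comp (hG.smooth.comp (contDiff_const.prodMk contDiff_id))
  refine ⟨fun p => (G (0, p)).2, hψs, fun z hz => congrArg Prod.snd (hGz z hz), fun z hz => ?_⟩
  have hmem : ((0, z) : ℝ × Ambient) ∈ ({0} ×ˢ zeroSection : Set (ℝ × Ambient)) := ⟨rfl, hz⟩
  have hfst := hG.function _ hmem Prod.fst 1 (fun s hs => Eventually.of_forall fun y =>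
    ⟨differentiableAt_fst, by rw [fderiv_fst]; rfl⟩)
  have hpair := hG.function _ hmem (fun x => inner ℝ x.2.1 x.2.2) 0 (fun s hs => by
    rw [hseg]
    filter_upwards [hVn s hs z hz] with x hx
    have h1 : HasFDerivAt (fun x : ℝ × Ambient => (inner ℝ x.2.1 x.2.2 : ℝ)) _ x :=
      (hasFDerivAt_snd (𝕜 := ℝ) (E := ℝ) (F := Ambient) (p := x)).fst.inner ℝ
        (hasFDerivAt_snd (𝕜 := ℝ) (E := ℝ) (F := Ambient) (p := x)).snd
    refine ⟨h1.differentiableAt, ?_⟩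
    rw [h1.fderiv]
    have h2 := hx.1
    rw [derivPairing_apply, real_inner_comm] at h2
    simpa [hW, add_comm] using h2)
  have hnorm := hG.function _ hmem (fun x => inner ℝ x.2.2 x.2.2) 0 (fun s hs => by
    rw [hseg]
    filter_upwards [hVn s hs z hz] with x hx
    have h1 : HasFDerivAt (fun x : ℝ × Ambient => (inner ℝ x.2.2 x.2.2 : ℝ)) _ x :=
      (hasFDerivAt_snd (𝕜 := ℝ) (E := ℝ) (F := Ambient) (p := x)).snd.inner ℝ
        (hasFDerivAt_snd (𝕜 := ℝ) (E := ℝ) (F := Ambient) (p := x)).snd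
    refine ⟨h1.differentiableAt, ?_⟩
    rw [h1.fderiv]
    have h2 := hx.2.1
    rw [derivHalfSq_apply] at h2
    simp [hW, h2, real_inner_comm x.2.2])
  have hform := hG.form _ hmem (spaceTimeForm retractedStdForm α) (fun s hs => by
    rw [hseg]
    have hsnd := (continuousAt_snd (p := ((s, z) : ℝ × Ambient))).tendsto
    filter_upwards [hVn s hs z hz, hsnd.eventually (hσ₀ z hz), hsnd.eventually (hdα z hz)]
      with x h1 h2 h3
    obtain ⟨e1, e2⟩ := differentiableAt_spaceTimeForm hα (h2.1.differentiableAt (by simp)) h2.2.1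
    refine ⟨e1, e2, fun Y => ?_⟩
    rw [spaceTimeForm_apply hα, h3]
    have h4 := h1.2.2 Y.2
    have h5 := h1.2.2 (V x)
    rw [form_self, form_self] at h5
    simp only [hW]
    linear_combination h4 - Y.1 * h5)
  have hψt : Tendsto (fun p => (G (0, p)).2) (𝓝 z) (𝓝 z) := by
    have h1 := hψs.continuous.tendsto z
    rwa [hGz z hz] at h1
  filter_upwards [((hin z).eventually hfst).eventually_nhds, (hin z).eventually hpair,
    (hin z).eventually hnorm, (hin z).eventually hform, hψt.eventually (hdα z hz),
    hψt.eventually (hτeq z hz)] with p h1 h2 h3 h4 h5 h6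
  refine ⟨by simpa using h2, ?_, fun X Y => ?_⟩
  · simp only [real_inner_self_eq_norm_sq, add_zero] at h3
    exact (sq_eq_sq₀ (norm_nonneg _) (norm_nonneg _)).1 h3
  · have hd : ∀ X, fderiv ℝ G (0, p) (0, X) = (0, fderiv ℝ (fun p => (G (0, p)).2) p X) := by
      intro X
      have d1 : HasFDerivAt (fun p : Ambient => ((0, p) : ℝ × Ambient))
        (ContinuousLinearMap.inr ℝ ℝ Ambient) p := (ContinuousLinearMap.inr ℝ ℝ Ambient).hasFDerivAt
      have d2 : HasFDerivAt (fun p : Ambient => G (0, p)) _ p :=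
        HasFDerivAt.comp (g := G) p (hG.smooth.differentiable (by simp) _).hasFDerivAt d1
      have d3 : HasFDerivAt (fun p : Ambient => (G (0, p)).1) (0 : Ambient →L[ℝ] ℝ) p :=
        (hasFDerivAt_const (1 : ℝ) p).congr_of_eventuallyEq (h1.mono fun q hq => by
          simpa using hq)
      have d4 := congrArg (fun L : Ambient →L[ℝ] ℝ => L X) (d2.fst.unique d3)
      rw [d2.snd.fderiv]
      exact Prod.ext d4 rfl
    have h7 := h4 (0, X) (0, Y)
    rw [hd, hd, spaceTimeForm_apply hα, spaceTimeForm_apply hα] at h7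
    have h8 : (G (0, p)).1 = 1 := by simpa using h1.self_of_nhds
    rw [h8, h5, h6, ContinuousAlternatingMap.sub_apply] at h7
    simp only [zero_mul, sub_self, one_mul, zero_add, add_zero] at h7
    rw [← h7]
    ring

end Moser

/-! ### Weinstein neighbourhoods and the existence of Dehn twists -/

section Existence

set_option linter.unusedSectionVars false

open Filter Topology

theorem eq_zero_of_stdForm_ambient {X : Ambient} (h : ∀ Y, stdForm X Y = 0) : X = 0 := by
  have h1 := h (0, X.1)
  have h2 := h (X.2, 0)
  simp [stdForm] at h1 h2
  exact Prod.ext h1 h2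

/-- The Moser map is immersive along the zero-section, since it preserves a symplectic form of
`ℝ³ × ℝ³` there. -/
theorem moser_map_injective {σ₁ : Ambient → Ambient [⋀^Fin 2]→L[ℝ] ℝ} {ψ : Ambient → Ambient}
    (hψ : ContDiff ℝ ∞ ψ) {z : Ambient} (hz : z ∈ zeroSection)
    (h : ∀ᶠ p in 𝓝 z,
        (inner ℝ (ψ p).1 (ψ p).2 : ℝ) = inner ℝ p.1 p.2 ∧ ‖(ψ p).2‖ = ‖p.2‖ ∧
        ∀ X Y, σ₁ (ψ p) ![fderiv ℝ ψ p X, fderiv ℝ ψ p Y] = retractedStdForm p ![X, Y])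
    (X : Ambient) (hX : fderiv ℝ ψ z X = 0) : X = 0 := by
  have hd := (hψ.differentiable (by simp) z).hasFDerivAt
  have hi : HasFDerivAt (fun p : Ambient => p) (ContinuousLinearMap.id ℝ Ambient) z :=
    hasFDerivAt_id z
  have hA : derivPairing z X = 0 := by
    have h1 : HasFDerivAt (fun p => (inner ℝ (ψ p).1 (ψ p).2 : ℝ)) _ z := hd.fst.inner ℝ hd.snd
    have h2 : HasFDerivAt (fun p : Ambient => (inner ℝ p.1 p.2 : ℝ)) _ z := hi.fst.inner ℝ hi.snd
    have h3 := congrArg (fun L : Ambient →L[ℝ] ℝ => L X)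
      ((h1.congr_of_eventuallyEq (h.mono fun p hp => hp.1.symm)).unique h2)
    simp [hX] at h3
    rw [derivPairing_apply, real_inner_comm]
    linarith
  have hH : derivHalfSq z X = 0 := by
    have h1 : HasFDerivAt (fun p => (inner ℝ (ψ p).2 (ψ p).2 : ℝ)) _ z := hd.snd.inner ℝ hd.snd
    have h2 : HasFDerivAt (fun p : Ambient => (inner ℝ p.2 p.2 : ℝ)) _ z := hi.snd.inner ℝ hi.snd
    have h3 := congrArg (fun L : Ambient →L[ℝ] ℝ => L X)
      ((h1.congr_of_eventuallyEq (h.mono fun p hp => by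
        have e : (inner ℝ p.2 p.2 : ℝ) = inner ℝ (ψ p).2 (ψ p).2 := by
          rw [real_inner_self_eq_norm_sq, real_inner_self_eq_norm_sq, hp.2.1]
        exact e)).unique h2)
    simp [hX, real_inner_comm z.2] at h3
    rw [derivHalfSq_apply]
    linarith
  refine eq_zero_of_stdForm_ambient fun Y => ?_
  have h4 := h.self_of_nhds.2.2 X Y
  have h5 : σ₁ (ψ z) ![(0 : Ambient), fderiv ℝ ψ z Y] = 0 :=
    ContinuousAlternatingMap.map_coord_zero _ 0 rfl
  rw [← retractedStdForm_add_normalForm hz, ← h4, hX, h5, normalForm_apply, hA, hH]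
  simp

theorem exists_cotangentDisc_subset {P : Ambient → Prop} (h : ∀ z ∈ zeroSection, ∀ᶠ p in 𝓝 z, P p) :
    ∃ lam : ℝ, 0 < lam ∧ ∀ p ∈ cotangentDisc lam, P p := by
  obtain ⟨δ, hδ, hsub⟩ := isCompact_zeroSection.exists_thickening_subset_open
    (isOpen_interior (s := {p | P p})) (fun z hz => mem_interior_iff_mem_nhds.2 (h z hz))
  refine ⟨δ / 2, by positivity, fun p hp => interior_subset (hsub ?_)⟩
  refine Metric.mem_thickening_iff.2 ⟨(0, p.2), ⟨rfl, hp.2.1⟩, ?_⟩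
  rw [Prod.dist_eq, dist_self, dist_zero_right]
  exact max_lt (lt_of_le_of_lt hp.2.2 (by linarith)) hδ

variable {M : Type*} [TopologicalSpace M] [T2Space M] [CompactSpace M]
  [ChartedSpace (EuclideanSpace ℝ (Fin 4)) M] [IsManifold (𝓡 4) ∞ M]
  {η : TwoForm M} {L : Set M}

/-- The Lagrangian neighbourhood theorem for a Lagrangian sphere. -/
theorem exists_isWeinsteinEmbedding (hη : IsSymplecticForm η) (hL : IsLagrangianSphere η L) :
    ∃ (lam : ℝ) (i : Ambient → M), 0 < lam ∧ IsWeinsteinEmbedding η L lam i := by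
  obtain ⟨f, hfe, rfl, hl⟩ := hL
  have hf : ContMDiff (𝓡 2) (𝓡 4) ∞ f := hfe.contMDiff
  obtain ⟨i, j, hij⟩ := exists_tubularMap hη hfe hl
  obtain ⟨ψ, hψ, hψz, hψp⟩ := exists_moser_map (hij.isBasicClosed hη hf hl)
    (fun p hp => hij.pullForm_vertical hp)
  have hψt : ∀ z ∈ zeroSection, Tendsto ψ (𝓝 z) (𝓝 z) := fun z hz => by
    have := hψ.continuous.tendsto z
    rwa [hψz z hz] at this
  obtain ⟨N, hN, hinj⟩ := Set.InjOn.exists_mem_nhdsSet (f := ψ) (s := zeroSection)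
    (fun z hz z' hz' h => by rwa [hψz z hz, hψz z' hz'] at h) isCompact_zeroSection
    (fun z _ => hψ.continuous.continuousAt) (fun z hz => by
      obtain ⟨H, -, -, -, hH⟩ := exists_local_inverse (hψ.contDiffAt (x := z))
        (moser_map_injective hψ hz (hψp z hz)) rfl
      exact ⟨_, hH, fun x hx y hy hxy => by
        rw [← (hx : H (ψ x) = x), ← (hy : H (ψ y) = y), hxy]⟩)
  have hev : ∀ z ∈ zeroSection, ∀ᶠ p in 𝓝 z, p ∈ N ∧
      ContMDiffAt 𝓘(ℝ, Ambient) (𝓡 4) ∞ i (ψ p) ∧ j (i (ψ p)) = cotangentRetraction (ψ p) ∧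
      (inner ℝ (ψ p).1 (ψ p).2 : ℝ) = inner ℝ p.1 p.2 ∧ ‖(ψ p).2‖ = ‖p.2‖ ∧
      ∀ X Y, pullForm η i (ψ p) ![fderiv ℝ ψ p X, fderiv ℝ ψ p Y] = retractedStdForm p ![X, Y] := by
    intro z hz
    filter_upwards [mem_nhdsSet_iff_forall.1 hN z hz, (hψt z hz).eventually (hij.smooth z hz),
      hψp z hz] with p h1 h2 h3 using ⟨h1, h2.1, h2.2, h3⟩
  obtain ⟨lam, hlam, hsub⟩ := exists_cotangentDisc_subset
    (fun z hz => (hev z hz).eventually_nhds)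
  have hcm : ∀ p, ContMDiffAt 𝓘(ℝ, Ambient) (𝓡 4) ∞ i (ψ p) →
      ContMDiffAt 𝓘(ℝ, Ambient) (𝓡 4) ∞ (fun p => i (ψ p)) p := fun p hp =>
    ContMDiffAt.comp (g := i) p hp hψ.contDiffAt.contMDiffAt
  have hT : ∀ p ∈ cotangentDisc lam, j (i (ψ p)) = ψ p := by
    intro p hp
    obtain ⟨-, -, h3, h4, h5, -⟩ := (hsub p hp).self_of_nhds
    rw [h3, cotangentRetraction_of_mem ⟨h4.trans hp.1, h5.trans hp.2.1⟩]
  refine ⟨lam, fun p => i (ψ p), hlam, ⟨⟨interior {p | ContMDiffAt 𝓘(ℝ, Ambient) (𝓡 4) ∞ i (ψ p)},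
    isOpen_interior, fun p hp => ?_, fun p hp => ?_⟩, fun p hp p' hp' h => ?_,
    fun p hp X Y hX hY => ?_, ?_⟩⟩
  · exact mem_interior_iff_mem_nhds.2 ((hsub p hp).mono fun q hq => hq.2.1)
  · have h : p ∈ {p | ContMDiffAt 𝓘(ℝ, Ambient) (𝓡 4) ∞ i (ψ p)} := interior_subset hp
    exact (hcm p h).contMDiffWithinAt
  · refine hinj (hsub p hp).self_of_nhds.1 (hsub p' hp').self_of_nhds.1 ?_
    have h' : i (ψ p) = i (ψ p') := h
    rw [← hT p hp, ← hT p' hp', h']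
  · obtain ⟨-, h2, -, -, -, h6⟩ := (hsub p hp).self_of_nhds
    have hc : HasMFDerivAt 𝓘(ℝ, Ambient) (𝓡 4) (i ∘ ψ) p _ :=
      HasMFDerivAt.comp p (h2.mdifferentiableAt (by simp)).hasMFDerivAt
        (hψ.differentiable (by simp) p).hasFDerivAt.hasMFDerivAt
    have hc' : derivInto (fun p => i (ψ p)) p = (derivInto i (ψ p)).comp (fderiv ℝ ψ p) := hc.mfderiv
    change formAt η (i (ψ p)) ![derivInto (fun p => i (ψ p)) p X,
      derivInto (fun p => i (ψ p)) p Y] = _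
    rw [hc']
    have h7 : formAt η (i (ψ p)) ![derivInto i (ψ p) (fderiv ℝ ψ p X),
      derivInto i (ψ p) (fderiv ℝ ψ p Y)] = retractedStdForm p ![X, Y] :=
      (pullForm_apply η i (ψ p) _ _).symm.trans (h6 X Y)
    refine h7.trans ?_
    have hpT : p ∈ cotangentBundle := ⟨hp.1, hp.2.1⟩
    rw [retractedStdForm_apply, fderiv_cotangentRetraction hpT hX,
      fderiv_cotangentRetraction hpT hY]
  · have hi0 : ∀ q : Sph, i (ψ (0, (q : R3))) = f q := fun q => by
      have hq : ‖(q : R3)‖ = 1 := by simp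
      have hq0 : (q : R3) ≠ 0 := fun h => by rw [h] at hq; simp at hq
      have hz : ((0, (q : R3)) : Ambient) ∈ zeroSection := ⟨rfl, hq⟩
      rw [hψz _ hz, hij.zero _ hq0, radialExt_coe]
    ext x
    constructor
    · rintro ⟨⟨u, v⟩, ⟨hu, hv⟩, rfl⟩
      obtain rfl : u = 0 := hu
      exact ⟨⟨v, by simpa using hv⟩, (hi0 ⟨v, by simpa using hv⟩).symm⟩
    · rintro ⟨q, rfl⟩
      exact ⟨(0, (q : R3)), ⟨rfl, by simp⟩, hi0 q⟩

theorem exists_isTwistProfile {lam : ℝ} (hlam : 0 < lam) : ∃ r, IsTwistProfile lam r := by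
  have hsymm : ∀ x : ℝ, Real.smoothTransition (1 - x) = 1 - Real.smoothTransition x := fun x => by
    have h := (Real.smoothTransition.pos_denom x).ne'
    rw [Real.smoothTransition, Real.smoothTransition, sub_sub_cancel, add_comm (expNegInvGlue (1 - x))]
    field_simp
    ring
  refine ⟨fun t => t * Real.smoothTransition (1 / 2 - t / lam), ?_, fun t ht => ?_, fun t => ?_⟩
  · exact contDiff_id.mul (Real.smoothTransition.contDiff.comp (by fun_prop))
  · have h1 : 1 / 2 - t / lam ≤ 0 := by
      rw [sub_nonpos, le_div_iff₀ hlam]; linarith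
    simp only [Real.smoothTransition.zero_of_nonpos h1, mul_zero]
  · have h1 : 1 / 2 - -t / lam = 1 - (1 / 2 - t / lam) := by ring
    simp only [h1, hsymm]
    ring

/-- Dehn twists along a Lagrangian sphere exist. -/
theorem exists_isDehnTwist (hη : IsSymplecticForm η) (hL : IsLagrangianSphere η L) :
    ∃ τ : M → M, IsDehnTwist η L τ := by
  classical
  obtain ⟨lam, i, hlam, hi⟩ := exists_isWeinsteinEmbedding hη hL
  obtain ⟨r, hr⟩ := exists_isTwistProfile hlam
  refine ⟨fun x => if x ∈ i '' cotangentDisc lam then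
    i (modelTwist r (Function.invFunOn i (cotangentDisc lam) x)) else x, lam, i, r, hlam, hi, hr,
    fun p hp => ?_, fun x hx => if_neg hx⟩
  simp only [if_pos (Set.mem_image_of_mem i hp), hi.injOn.leftInvOn_invFunOn hp]

end Existence

end FourDim

end

theorem mainTheorem9 {M : Type*} [TopologicalSpace M] [T2Space M] [CompactSpace M]
    [ChartedSpace (EuclideanSpace ℝ (Fin 4)) M] [IsManifold (𝓡 4) ∞ M]
    (η : FourDim.TwoForm M) (hη : FourDim.IsSymplecticForm η)
    (L : Set M) (hL : FourDim.IsLagrangianSphere η L) :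
    (∃ τ : M → M, FourDim.IsDehnTwist η L τ) ∧
    ∀ τ : M → M, FourDim.IsDehnTwist η L τ → FourDim.PotentiallyFragile η (τ ∘ τ) := by
  exact ⟨FourDim.exists_isDehnTwist hη hL, fun τ hτ => FourDim.potentiallyFragile_sq hη hτ⟩
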